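/- Let $n\ge 0$ and let $\beta=\sigma_{i_1}\cdots\sigma_{i_r}$ be a positive braid word on $n$ strands, the strands being labelled from bottom to top. Let $\Delta=(\sigma_1)(\sigma_2\sigma_1)\cdots(\sigma_{n-1}\cdots\sigma_1)$ be the half twist. The Demazure product $\delta$ is defined by $\delta(1)=1$ and $\delta(\beta\sigma_i)=\delta(\beta)s_i$ if $\ell(\delta(\beta)s_i)=\ell(\delta(\beta))+1$, and $\delta(\beta\sigma_i)=\delta(\beta)$ otherwise; put $w_0=\delta(\Delta)$. *Braid variety.* Let $B_i(z)$ be the identity matrix with the block $\begin{pmatrix}0&1\\1&z\end{pmatrix}$ inserted in rows and columns $i,i+1$, and let $B_\beta(z)=B_{i_r}(z_r)\cdots B_{i_1}(z_1)$. Then $X(\beta)$ is the affine scheme over $\mathbb{C}$ whose points over a commutative $\mathbb{C}$-algebra $A$ are the $z\in A^r$ for which $B_\beta(z)\,\delta(\beta)$ is upper triangular, where $\delta(\beta)$ is viewed as a permutation matrix. *Augmentation variety.* Let $\Lambda(\beta\Delta)$ be the Legendrian $(-1)$-closure of $\beta\Delta$, given by its front in plat position: $n$ vertically shifted parallel copies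 of the standard Legendrian unknot with the braid $\beta\Delta$ inserted in the $n$ bottom strands. The Maslov potential is the one for which the upper strand of each cusp has potential $1$ and the lower one has potential $0$. There is one marked point on each strand of the braid, placed between $\beta$ and $\Delta$. Let $(\mathcal{A},\partial)$ be its Chekanov–Eliashberg dg algebra over $\mathbb{Z}[t_1^{\pm1},\dots,t_n^{\pm1}]$, generated by the crossings and right cusps of the front, with the sign convention in which the bottom quadrant of a crossing of even degree has orientation sign $-1$. The generators of degree $0$ are the crossings of $\beta\Delta$. For a commutative $\mathbb{C}$-algebra $A$, an $A$-valued augmentation is a unital dg algebra map $\epsilon\colon(\mathcal{A},\partial)\to(A,0)$, with $A$ in degree $0$. Two augmentations $\epsilon_1,\epsilon_2$ are homotopic if there is an additive map $\eta\colon\mathcal{A}\to A$ of degree $1$ with $\epsilon_1-\epsilon_2=\eta\circ\partial$ and $\eta(xy)=\eta(x)\epsilon_2(y)+(-1)^{|x|}\epsilon_1(x)\eta(y)$. The augmentation variety $\mathrm{Aug}(\Lambda(\beta\Delta))$ is the functor sending $A$ to the set of $A$-valued augmentations modulo homotopy. **Theorem.** Suppose that $\delta(\beta)=w_0$. Then there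 is an isomorphism $$\Phi\colon \mathrm{Aug}(\Lambda(\beta\Delta))\;\cong\; X(\beta)$$ over $\mathbb{C}$, that is, there are bijections $\Phi_A\colon \mathrm{Aug}(\Lambda(\beta\Delta))(A)\to X(\beta)(A)$ for all commutative $\mathbb{C}$-algebras $A$, natural in $A$. Moreover, if $\beta=\Delta\gamma$ for a positive braid word $\gamma$, then $\Phi$ is the identity on the degree $0$ generators corresponding to $\gamma$: for every $A$-valued augmentation $\epsilon$ and every $k$ with $\binom n2<k\le r$, the $k$-th coordinate of $\Phi_A([\epsilon])$ equals $\epsilon(x_k)$, where $x_k$ is the generator at the crossing of the $k$-th letter of $\beta$. -/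

import Mathlib

noncomputable section

namespace LegendrianBraid

/-! ## Positive braid words and the Demazure product -/

/-- A positive braid word on `n` strands. The letter `i : Fin (n - 1)` is the Artin generator
crossing the strands at heights `i` and `i + 1`; heights are counted from `0`, bottom to top. -/
abbrev BraidWord (n : ℕ) : Type := List (Fin (n - 1))

/-- The lower of the two strand heights met by the `i`-th Artin generator. -/
def lowerStrand {n : ℕ} (i : Fin (n - 1)) : Fin n := ⟨i, by omega⟩

/-- The upper of the two strand heights met by the `i`-th Artin generator. -/
def upperStrand {n : ℕ} (i : Fin (n - 1)) : Fin n := ⟨i + 1, by omega⟩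

/-- The elementary transposition `s_i` in the symmetric group. -/
def simpleTransposition {n : ℕ} (i : Fin (n - 1)) : Equiv.Perm (Fin n) :=
  Equiv.swap (lowerStrand i) (upperStrand i)

/-- The length of a permutation: the least length of a word in the elementary transpositions
representing it. -/
def permLength {n : ℕ} (w : Equiv.Perm (Fin n)) : ℕ :=
  sInf {k | ∃ l : BraidWord n, l.length = k ∧ (l.map simpleTransposition).prod = w}

open Classical in
/-- One step of the Demazure product: multiply by `s_i` on the right if this raises the length. -/
def demazureStep {n : ℕ} (w : Equiv.Perm (Fin n)) (i : Fin (n - 1)) : Equiv.Perm (Fin n) :=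
  if permLength (w * simpleTransposition i) = permLength w + 1 then w * simpleTransposition i
  else w

/-- The Demazure product `δ(β)`: `δ(1) = 1`, and `δ(β σ_i)` is `δ(β) s_i` if this is longer than
`δ(β)`, and `δ(β)` otherwise. -/
def demazure {n : ℕ} (β : BraidWord n) : Equiv.Perm (Fin n) := β.foldl demazureStep 1

/-- The half twist `Δ = (σ₁)(σ₂σ₁)⋯(σ_{n-1}⋯σ₁)`. -/
def halfTwist (n : ℕ) : BraidWord n :=
  (List.finRange (n - 1)).flatMap fun j => ((List.finRange (n - 1)).filter (· ≤ j)).reverse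

/-- The element `w₀ = δ(Δ)` of the symmetric group. -/
def longestElement (n : ℕ) : Equiv.Perm (Fin n) := demazure (halfTwist n)

/-! ## Braid varieties -/

section BraidVariety

variable {n : ℕ} (A : Type) [CommRing A]

/-- The permutation matrix of `π`, sending the basis vector `e_j` to `e_{π j}`. -/
def permutationMatrix (π : Equiv.Perm (Fin n)) : Matrix (Fin n) (Fin n) A :=
  Matrix.of fun i j => if i = π j then 1 else 0

/-- The braid matrix `B_i(z)`: the identity matrix with the block `(0 1; 1 z)` in the rows and
columns `i, i + 1`. -/
def braidMatrix (i : Fin (n - 1)) (z : A) : Matrix (Fin n) (Fin n) A :=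
  Matrix.of fun a b =>
    if a = lowerStrand i then (if b = upperStrand i then 1 else 0)
    else if a = upperStrand i then
      (if b = lowerStrand i then 1 else if b = upperStrand i then z else 0)
    else if a = b then 1 else 0

/-- `B_β(z) = B_{i_r}(z_r) ⋯ B_{i_1}(z_1)` for `β = σ_{i_1} ⋯ σ_{i_r}`. -/
def braidWordMatrix : (β : BraidWord n) → (Fin β.length → A) → Matrix (Fin n) (Fin n) A
  | [], _ => 1
  | i :: β, z => braidWordMatrix β (fun k => z k.succ) * braidMatrix A i (z 0)

/-- The `A`-valued points of the braid variety `X(β, π)`: those `z ∈ A^r` for which the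
(invertible) matrix `B_β(z) π` is upper triangular. -/
def BraidVarietyOf (β : BraidWord n) (π : Equiv.Perm (Fin n)) : Type :=
  {z : Fin β.length → A //
    (braidWordMatrix A β z * permutationMatrix A π).BlockTriangular id}

/-- The `A`-valued points of the braid variety `X(β) = X(β, δ(β))`. -/
abbrev BraidVariety (β : BraidWord n) : Type := BraidVarietyOf A β (demazure β)

end BraidVariety

/-! ## Front diagrams in plat position and their Chekanov–Eliashberg dg algebras

A plat front with `N` left cusps and `N` right cusps is a sequence of events, listed from left to
right, on `2 N` strands at the heights `0, …, 2 N - 1` (bottom to top). To the left of all events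
the strands at heights `2 m` and `2 m + 1` are joined by a left cusp, and to the right of all
events they are joined by a right cusp. -/

/-- An event of a front diagram whose crossings are named by `C` and whose marked points are named
by `T`. -/
inductive FrontEvent (C T : Type) : Type
  /-- The strands at heights `k` and `k + 1` cross at the crossing `c`. -/
  | crossing (k : ℕ) (c : C) : FrontEvent C T
  /-- The strand at height `p`, which is oriented from left to right, carries the marked
  point `t`. -/
  | marked (p : ℕ) (t : T) : FrontEvent C T

/-- A front diagram in plat position. -/
structure PlatFront (C T : Type) : Type where
  /-- The number of left cusps, which is also the number of right cusps. -/
  cusps : ℕ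
  /-- The crossings and marked points, from left to right. -/
  events : List (FrontEvent C T)

/-- The coefficient ring `ℤ[t^{±1} : t ∈ T]` of Laurent polynomials. -/
abbrev LaurentRing (T : Type) : Type := AddMonoidAlgebra ℤ (T →₀ ℤ)

/-- The Laurent monomial `t ^ e`. -/
def laurentMonomial {T : Type} (t : T) (e : ℤ) : LaurentRing T :=
  AddMonoidAlgebra.single (Finsupp.single t e) 1

namespace PlatFront

variable {C T : Type} (D : PlatFront C T)

/-- The generators of the Chekanov–Eliashberg algebra: the crossings and the right cusps. -/
abbrev Gen : Type := C ⊕ Fin D.cusps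

/-- The underlying algebra: noncommutative polynomials in the generators with coefficients in
`ℤ[t^{±1}]`. -/
abbrev Alg : Type := MonoidAlgebra (LaurentRing T) (FreeMonoid D.Gen)

/-- A word in the generators as an element of the algebra. -/
def word (w : List D.Gen) : D.Alg := MonoidAlgebra.single (FreeMonoid.ofList w) 1

/-- A generator as an element of the algebra. -/
def gen (g : D.Gen) : D.Alg := D.word [g]

/-- A coefficient as an element of the algebra. -/
def coeffElem (r : LaurentRing T) : D.Alg := MonoidAlgebra.single 1 r

/-- The Maslov potential to the left of all events, as a function of the height: the upper strand
of each cusp has potential one higher than the lower strand. -/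
def initialPotential (p : ℕ) : ℤ := if Even p then 0 else 1

open Classical in
/-- The grading of the crossing `c` in a list of events, the potential of the strands at the left
end of the list being `μ`. In a front the over strand at a crossing is the one of smaller slope,
that is the one which is the upper strand to the left of the crossing; the grading is the
potential of the over strand minus that of the under strand. -/
def crossingDegree : List (FrontEvent C T) → (ℕ → ℤ) → C → ℤ
  | [], _, _ => 0
  | .marked _ _ :: l, μ, c => crossingDegree l μ c
  | .crossing k c' :: l, μ, c =>
      if c = c' then μ (k + 1) - μ k
      else crossingDegree l (fun p => μ (Equiv.swap k (k + 1) p)) c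

/-- The degree of a generator; right cusps have degree one. -/
def degree : D.Gen → ℤ
  | .inl c => crossingDegree D.events initialPotential c
  | .inr _ => 1

/-- The degree of a word in the generators (the coefficients have degree zero). -/
def wordDegree (w : List D.Gen) : ℤ := (w.map D.degree).sum

/-- The element `x` of the algebra is homogeneous of degree `d`. -/
def IsHomogeneous (d : ℤ) (x : D.Alg) : Prop :=
  ∀ w ∈ x.coeff.support, D.wordDegree (FreeMonoid.toList w) = d

/-- The orientation sign of a convex corner of a disk which fills the bottom quadrant of the
crossing `c`: `-1` if the crossing has even degree, and `1` otherwise. All other corners of disks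
have sign `1`. -/
def bottomSign (c : C) : ℤ := if Even (D.degree (.inl c)) then -1 else 1

/-- The signed count of immersed disks of a plat front (equivalently of its resolution) with one
positive corner, truncated at a vertical line. The list contains the events to the left of that
line, *from right to left*, and the disk meets the line in the segment from height `i` to height
`j`, `i < j`.

Moving to the left, the lower and the upper boundary of the disk follow strands of the front. At a
crossing on the upper boundary the disk may have a convex corner in the bottom quadrant, and at a
crossing on the lower boundary it may have a convex corner in the top quadrant; otherwise the
boundary goes straight through the crossing. There are no concave corners, the two
boundaries never meet at a crossing, and the disk ends at a left cusp.

The word of a disk lists its negative corners and marked points counterclockwise, starting from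
the positive corner: along the upper boundary from right to left, and then along the lower
boundary from left to right. A marked point, on a strand oriented to the right,
contributes `t` on the lower boundary and `t⁻¹` on the upper boundary. -/
def diskCount : List (FrontEvent C T) → ℕ → ℕ → D.Alg
  | [], i, j => if Even i ∧ j = i + 1 then 1 else 0
  | .marked p t :: l, i, j =>
      if p = i then D.coeffElem (laurentMonomial t 1) * diskCount l i j
      else if p = j then D.coeffElem (laurentMonomial t (-1)) * diskCount l i j
      else diskCount l i j
  | .crossing k c :: l, i, j =>
      if i = k ∧ j = k + 1 then 0
      else if i = k + 1 then diskCount l k j + diskCount l (k + 1) j * D.gen (.inl c)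
      else if i = k then diskCount l (k + 1) j
      else if j = k then
        diskCount l i (k + 1) + D.bottomSign c • (D.gen (.inl c) * diskCount l i k)
      else if j = k + 1 then diskCount l i k
      else diskCount l i j

open Classical in
/-- The differential of the crossing `c`: the count of the disks with positive corner in the left
quadrant of `c`. The first list contains the events already passed, from right to left; the second
one contains the remaining events, from left to right. -/
def crossingDifferential : List (FrontEvent C T) → List (FrontEvent C T) → C → D.Alg
  | _, [], _ => 0
  | l, .marked p t :: l', c => crossingDifferential (.marked p t :: l) l' c
  | l, .crossing k c' :: l', c =>
      if c = c' then D.diskCount l k (k + 1)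
      else crossingDifferential (.crossing k c' :: l) l' c

/-- The differential of a generator. For a right cusp there is, besides the disks with
positive corner at the cusp, the disk filling the loop of the resolution of the front there, which
contributes `1`. -/
def genDifferential : D.Gen → D.Alg
  | .inl c => D.crossingDifferential [] D.events c
  | .inr m => 1 + D.diskCount D.events.reverse (2 * m) (2 * m + 1)

/-- The differential of a word, by the graded Leibniz rule
`∂(x y) = (∂ x) y + (-1)^{|x|} x (∂ y)`. -/
def wordDifferential : List D.Gen → D.Alg
  | [] => 0
  | g :: w => D.genDifferential g * D.word w +
      ((D.degree g).negOnePow : ℤ) • (D.gen g * wordDifferential w)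

/-- The differential of the Chekanov–Eliashberg algebra, linear over `ℤ[t^{±1}]`. -/
def differential (x : D.Alg) : D.Alg :=
  x.coeff.sum fun w r => D.coeffElem r * D.wordDifferential (FreeMonoid.toList w)

/-! ### Augmentations, homotopies and the augmentation variety -/

/-- An `A`-valued augmentation: a unital dg algebra map to `A`, the latter in degree zero and with
zero differential. It is determined by its values on the marked points and the generators of
degree zero. -/
structure Augmentation (A : Type) [CommRing A] where
  /-- The underlying ring homomorphism. -/
  toRingHom : D.Alg →+* A
  /-- The map preserves degrees: it kills the elements of nonzero degree. -/
  map_of_degree_ne_zero : ∀ (d : ℤ) (x : D.Alg), d ≠ 0 → D.IsHomogeneous d x → toRingHom x = 0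
  /-- The map is a chain map. -/
  map_differential : ∀ x : D.Alg, toRingHom (D.differential x) = 0

variable {D}

/-- The value of an augmentation on a generator. -/
def Augmentation.eval {A : Type} [CommRing A] (ε : D.Augmentation A) (g : D.Gen) : A :=
  ε.toRingHom (D.gen g)

/-- Change of the target ring of an augmentation. -/
def Augmentation.map {A B : Type} [CommRing A] [CommRing B] (f : A →+* B)
    (ε : D.Augmentation A) : D.Augmentation B where
  toRingHom := f.comp ε.toRingHom
  map_of_degree_ne_zero d x hd hx := by simp [ε.map_of_degree_ne_zero d x hd hx]
  map_differential x := by simp [ε.map_differential x]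

/-- Two augmentations are dg algebra homotopic: there is an additive map `η` of degree one with
`ε₁ - ε₂ = η ∘ ∂` and `η(x y) = η(x) ε₂(y) + (-1)^{|x|} ε₁(x) η(y)`. -/
def Augmentation.Homotopic {A : Type} [CommRing A] (ε₁ ε₂ : D.Augmentation A) : Prop :=
  ∃ η : D.Alg →+ A,
    (∀ (d : ℤ) (x : D.Alg), d + 1 ≠ 0 → D.IsHomogeneous d x → η x = 0) ∧
    (∀ x : D.Alg, ε₁.toRingHom x - ε₂.toRingHom x = η (D.differential x)) ∧
    (∀ (d : ℤ) (x y : D.Alg), D.IsHomogeneous d x →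
      η (x * y) = η x * ε₂.toRingHom y + (d.negOnePow : ℤ) • (ε₁.toRingHom x * η y))

theorem Augmentation.Homotopic.map {A B : Type} [CommRing A] [CommRing B] (f : A →+* B)
    {ε₁ ε₂ : D.Augmentation A} (h : ε₁.Homotopic ε₂) : (ε₁.map f).Homotopic (ε₂.map f) := by
  obtain ⟨η, h1, h2, h3⟩ := h
  refine ⟨f.toAddMonoidHom.comp η, fun d x hd hx => ?_, fun x => ?_, fun d x y hx => ?_⟩
  · simp [h1 d x hd hx]
  · simp [Augmentation.map, ← h2 x]
  · simp [Augmentation.map, h3 d x y hx]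

variable (D)

/-- The `A`-valued points of the augmentation variety of the front `D`: the `A`-valued
augmentations up to dg algebra homotopy. -/
def AugVariety (A : Type) [CommRing A] : Type :=
  Quot (Augmentation.Homotopic : D.Augmentation A → D.Augmentation A → Prop)

variable {D}

/-- The class of an augmentation in the augmentation variety. -/
def AugVariety.mk {A : Type} [CommRing A] (ε : D.Augmentation A) : D.AugVariety A :=
  Quot.mk _ ε

/-- The functoriality of the points of the augmentation variety. -/
def AugVariety.map {A B : Type} [CommRing A] [CommRing B] (f : A →+* B) :
    D.AugVariety A → D.AugVariety B :=
  Quot.map (Augmentation.map f) fun _ _ h => h.map f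

end PlatFront

/-! ## The Legendrian (-1)-closure -/

/-- The crossings of the front of the `(-1)`-closure of a word of length `r` on `n` strands. The
cusps are numbered from bottom to top. -/
inductive ClosureCrossing (n r : ℕ) : Type
  /-- The crossing, to the left of the braid, of the strands of the cusps `i < j`. -/
  | left (j : Fin n) (i : Fin j) : ClosureCrossing n r
  /-- The crossing of the `k`-th letter of the braid word. -/
  | braid (k : Fin r) : ClosureCrossing n r
  /-- The crossing, to the right of the braid, of the strands of the cusps `i < j`. -/
  | right (j : Fin n) (i : Fin j) : ClosureCrossing n r

/-- The crossings to the left of the braid, from left to right. One after another, the lower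
strand of the `j`-th left cusp, `j = 0, 1, …`, crosses the upper strands of the left cusps
`i = j - 1, …, 0`. Afterwards, the lower strands of the cusps are the `n` bottom strands, and the
upper strands of the cusps are the `n` top strands, both in the order of the cusps. -/
def leftCrossings (n r : ℕ) : List (FrontEvent (ClosureCrossing n r) (Fin n)) :=
  (List.finRange n).flatMap fun j : Fin n =>
    (List.finRange (j : ℕ)).reverse.map fun i : Fin (j : ℕ) =>
      .crossing ((j : ℕ) + (i : ℕ)) (.left j i)

/-- The crossings to the right of the braid, from left to right: the mirror image of those to the
left of it. -/
def rightCrossings (n r : ℕ) : List (FrontEvent (ClosureCrossing n r) (Fin n)) :=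
  ((List.finRange n).flatMap fun j : Fin n =>
    (List.finRange (j : ℕ)).reverse.map fun i : Fin (j : ℕ) =>
      .crossing ((j : ℕ) + (i : ℕ)) (.right j i)).reverse

/-- The crossings of the braid word, from left to right, placed on the `n` bottom strands. -/
def braidCrossings {n : ℕ} (β : BraidWord n) :
    List (FrontEvent (ClosureCrossing n β.length) (Fin n)) :=
  List.ofFn fun k : Fin β.length => .crossing (β.get k) (.braid k)

/-- One marked point on each of the `n` strands of the braid. -/
def strandMarks (n r : ℕ) : List (FrontEvent (ClosureCrossing n r) (Fin n)) :=
  List.ofFn fun p : Fin n => .marked p p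

/-- The front of the Legendrian `(-1)`-closure `Λ(β β')` in plat position, with one marked
point on each strand of the braid, placed between `β` and `β'`. It is the front of `n` parallel
copies of the standard Legendrian unknot, shifted vertically, with the braid inserted in the
`n` bottom strands. -/
def minusOneClosure {n : ℕ} (β β' : BraidWord n) :
    PlatFront (ClosureCrossing n (β ++ β').length) (Fin n) where
  cusps := n
  events :=
    leftCrossings n (β ++ β').length ++
    (braidCrossings (β ++ β')).take β.length ++ strandMarks n (β ++ β').length ++
    (braidCrossings (β ++ β')).drop β.length ++ rightCrossings n (β ++ β').length

/-- The generator of the Chekanov–Eliashberg algebra of `Λ(β β')` at the crossing of the `k`-th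
letter of `β`. -/
def braidGen {n : ℕ} (β β' : BraidWord n) (k : Fin β.length) : (minusOneClosure β β').Gen :=
  .inl (.braid ⟨k, by simp only [List.length_append]; omega⟩)

end LegendrianBraid

end

/-!
An augmentation kills all generators of nonzero degree, so that it is given by its values `z` and
`w` at the letters of `β` and of the half twist `Δ` and by its values `t` at the marked points. The
disks between a bottom strand and a top strand are counted by braid matrices: each crossing of the
braid multiplies the matrix of disk counts by `B_i`, the marked points multiply it by `diag(t)`,
and the crossings outside the braid, on which an augmentation vanishes, do nothing. Hence the
differentials of the crossings to the right of the braid and of the right cusps say that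
`V = B_Δ(w) diag(t) B_β(z)` is upper triangular with all diagonal entries `-1`
(`map_genDifferential_closure`, `IsAugPoint`).

A homotopy is a derivation `η` of degree one. It is given by its values on the crossings to the
left of the braid, the generators of degree `-1`, and they form an upper unipotent matrix `P`. The
value of `η` on the differential of a letter `σ_i` is the entry `(i, i + 1)` of `P`, so that the
homotopy replaces the coordinate `z` of this letter by `z' = z - P_{i,i+1}`; on the other side of
the letter, the matrix of values of `η` on disks is `B_i(z') P B_i(z)⁻¹`, which is unipotent again
(`DerivationState.braidEvents`). Moving `P` through all of `β` defines an action `act` of the upper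
unipotent matrices on the coordinates, with `B_β(act z P) P = out z P * B_β(z)`. Thus homotopy
classes are orbits (`exists_act_of_homotopic`, `homotopic_of_act`).

The half twist is a reduced word for the longest element `w₀`, hence `w₀ B_Δ(w)` is upper
unipotent. What arrives at the end of `Δ` is then both upper and lower triangular, so that it is
the identity (`out_halfTwist`): the half twist absorbs all unipotent matrices. It also follows that
`w ↦ w₀ B_Δ(w)` is a bijection to the upper unipotent matrices (`exists_halfTwist_eq`,
`halfTwist_injective`).

For a solution of the augmentation equations, `-V` is upper unipotent, and acting by it changes `z`
into a point of `X(β)`: since `B_β(z) = diag(t)⁻¹ (w₀ B_Δ(w))⁻¹ w₀ V`, the new braid matrix is an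
upper triangular matrix times `w₀`. This defines the map to the braid variety. An orbit meets
`X(β)` only once, as `w₀ R w₀` is upper triangular only for `R = 1` if `R` is upper unipotent
(`IsBraidPoint.eq_act`); so the map is well defined on homotopy classes. Over a point of `X(β)`
there is exactly one pair `(t, w)`: the matrix `V` has to be `-1`, and `w₀ B_Δ(w) diag(t)` is
determined by `B_β(z)` (`IsBraidPoint.exists_isAugPoint`, `IsBraidPoint.isAugPoint_unique`). So the
map is bijective. If `β` starts with `Δ`, then `-V` is absorbed there, and the later letters do not
move.
-/

noncomputable section

namespace LegendrianBraid

/-! ### Inversions and reduced words -/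

/-- The permutation `s_{i_1} ⋯ s_{i_r}` represented by a word. -/
def wordPerm {n : ℕ} (l : BraidWord n) : Equiv.Perm (Fin n) := (l.map simpleTransposition).prod

/-- The number of inversions of a permutation. -/
def inversionCount {n : ℕ} (w : Equiv.Perm (Fin n)) : ℕ :=
  (Finset.univ.filter fun p : Fin n × Fin n => p.1 < p.2 ∧ w p.2 < w p.1).card

/-- A word is reduced if it is as long as its permutation has inversions. -/
def Reduced {n : ℕ} (l : BraidWord n) : Prop := inversionCount (wordPerm l) = l.length

lemma lowerStrand_lt_upperStrand {n : ℕ} (i : Fin (n - 1)) : lowerStrand i < upperStrand i := by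
  simp [lowerStrand, upperStrand, Fin.lt_def]

lemma lowerStrand_ne_upperStrand {n : ℕ} (i : Fin (n - 1)) : lowerStrand i ≠ upperStrand i :=
  (lowerStrand_lt_upperStrand i).ne

@[simp] lemma wordPerm_nil {n : ℕ} : wordPerm ([] : BraidWord n) = 1 := rfl

@[simp] lemma wordPerm_cons {n : ℕ} (i : Fin (n - 1)) (l : BraidWord n) :
    wordPerm (i :: l) = simpleTransposition i * wordPerm l := by simp [wordPerm]

@[simp] lemma wordPerm_append {n : ℕ} (l l' : BraidWord n) :
    wordPerm (l ++ l') = wordPerm l * wordPerm l' := by simp [wordPerm]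

@[simp] lemma simpleTransposition_mul_self {n : ℕ} (i : Fin (n - 1)) :
    simpleTransposition i * simpleTransposition i = 1 := by simp [simpleTransposition]

@[simp] lemma simpleTransposition_lower {n : ℕ} (i : Fin (n - 1)) :
    simpleTransposition i (lowerStrand i) = upperStrand i := by simp [simpleTransposition]

@[simp] lemma simpleTransposition_upper {n : ℕ} (i : Fin (n - 1)) :
    simpleTransposition i (upperStrand i) = lowerStrand i := by simp [simpleTransposition]

lemma simpleTransposition_of_ne {n : ℕ} (i : Fin (n - 1)) {a : Fin n} (h : a ≠ lowerStrand i)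
    (h' : a ≠ upperStrand i) : simpleTransposition i a = a := Equiv.swap_apply_of_ne_of_ne h h'

@[simp] lemma simpleTransposition_apply_apply {n : ℕ} (i : Fin (n - 1)) (a : Fin n) :
    simpleTransposition i (simpleTransposition i a) = a := by simp [simpleTransposition]

/-- An elementary transposition preserves the order of all pairs but `(i, i + 1)`. -/
lemma simpleTransposition_lt {n : ℕ} (i : Fin (n - 1)) {a b : Fin n} (h : a < b)
    (hne : ¬ (a = lowerStrand i ∧ b = upperStrand i)) :
    simpleTransposition i a < simpleTransposition i b := by
  simp only [simpleTransposition, Equiv.swap_apply_def]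
  simp only [lowerStrand, upperStrand, Fin.ext_iff, Fin.lt_def] at *
  split_ifs <;> simp_all <;> omega

lemma inversionCount_mul_of_lt {n : ℕ} (w : Equiv.Perm (Fin n)) (i : Fin (n - 1))
    (h : w (lowerStrand i) < w (upperStrand i)) :
    inversionCount (w * simpleTransposition i) = inversionCount w + 1 := by
  -- The inversions of `w s_i` are `(i, i + 1)` and the images of the inversions of `w` under `s_i`.
  have key : (Finset.univ.filter fun p : Fin n × Fin n =>
      p.1 < p.2 ∧ (w * simpleTransposition i) p.2 < (w * simpleTransposition i) p.1) =
      insert (lowerStrand i, upperStrand i)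
        ((Finset.univ.filter fun p : Fin n × Fin n => p.1 < p.2 ∧ w p.2 < w p.1).map
          (Equiv.prodCongr (simpleTransposition i) (simpleTransposition i)).toEmbedding) := by
    ext ⟨a, b⟩
    have hs : (simpleTransposition i).symm = simpleTransposition i := by
      simp [simpleTransposition]
    rw [Finset.mem_filter, Finset.mem_insert, Finset.mem_map_equiv, Finset.mem_filter]
    simp only [Finset.mem_univ, true_and, Equiv.Perm.mul_apply, Equiv.prodCongr_symm,
      Equiv.prodCongr_apply, Prod.map, Prod.mk.injEq, hs]
    by_cases hab : a = lowerStrand i ∧ b = upperStrand i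
    · obtain ⟨rfl, rfl⟩ := hab
      simp [h, lowerStrand_lt_upperStrand]
    · simp only [hab, false_or]
      refine and_congr_left fun hw => ⟨fun hlt => simpleTransposition_lt i hlt hab, fun hlt => ?_⟩
      have := simpleTransposition_lt i hlt ?_
      · simpa using this
      · rintro ⟨h1, h2⟩
        rw [h1, h2] at hw
        exact absurd h hw.not_gt
  rw [inversionCount, key, Finset.card_insert_of_notMem, Finset.card_map, inversionCount]
  simp only [Finset.mem_map_equiv, Equiv.prodCongr_symm, Equiv.prodCongr_apply, Prod.map,
    Finset.mem_filter, Finset.mem_univ, true_and, not_and]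
  intro h'
  have hs : (simpleTransposition i).symm = simpleTransposition i := by simp [simpleTransposition]
  rw [hs, simpleTransposition_lower, simpleTransposition_upper] at h'
  exact absurd h' (lowerStrand_lt_upperStrand i).not_gt

lemma inversionCount_mul_of_gt {n : ℕ} (w : Equiv.Perm (Fin n)) (i : Fin (n - 1))
    (h : w (upperStrand i) < w (lowerStrand i)) :
    inversionCount (w * simpleTransposition i) + 1 = inversionCount w := by
  have := inversionCount_mul_of_lt (w * simpleTransposition i) i (by simpa using h)
  rw [← this, mul_assoc, simpleTransposition_mul_self, mul_one]

lemma inversionCount_mul_le {n : ℕ} (w : Equiv.Perm (Fin n)) (i : Fin (n - 1)) :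
    inversionCount (w * simpleTransposition i) ≤ inversionCount w + 1 := by
  rcases lt_trichotomy (w (lowerStrand i)) (w (upperStrand i)) with h | h | h
  · exact (inversionCount_mul_of_lt w i h).le
  · exact absurd (w.injective h) (lowerStrand_ne_upperStrand i)
  · have := inversionCount_mul_of_gt w i h
    omega

lemma inversionCount_mul_wordPerm_le {n : ℕ} (l : BraidWord n) (w : Equiv.Perm (Fin n)) :
    inversionCount (w * wordPerm l) ≤ inversionCount w + l.length := by
  induction l generalizing w with
  | nil => simp
  | cons i l ih =>
    have h1 := ih (w * simpleTransposition i)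
    have h2 := inversionCount_mul_le w i
    rw [wordPerm_cons, ← mul_assoc, List.length_cons]
    omega

@[simp] lemma inversionCount_one {n : ℕ} : inversionCount (1 : Equiv.Perm (Fin n)) = 0 := by
  simp only [inversionCount, Finset.card_eq_zero, Finset.filter_eq_empty_iff]
  rintro p - ⟨h1, h2⟩
  exact absurd h1 h2.not_gt

lemma inversionCount_wordPerm_le {n : ℕ} (l : BraidWord n) :
    inversionCount (wordPerm l) ≤ l.length := by
  simpa using inversionCount_mul_wordPerm_le l 1

lemma inversionCount_inv {n : ℕ} (w : Equiv.Perm (Fin n)) :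
    inversionCount w⁻¹ = inversionCount w := by
  refine Finset.card_bij' (fun p _ => (w⁻¹ p.2, w⁻¹ p.1)) (fun p _ => (w p.2, w p.1)) ?_ ?_ ?_ ?_ <;>
    simp +contextual

lemma wordPerm_reverse {n : ℕ} (l : BraidWord n) : wordPerm l.reverse = (wordPerm l)⁻¹ := by
  induction l with
  | nil => simp
  | cons i l ih =>
    rw [List.reverse_cons, wordPerm_append, ih, wordPerm_cons, wordPerm_cons, mul_inv_rev]
    simp [simpleTransposition]

lemma Reduced.of_append_left {n : ℕ} {l l' : BraidWord n} (h : Reduced (l ++ l')) : Reduced l := by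
  have h1 := inversionCount_mul_wordPerm_le l' (wordPerm l)
  have h2 := inversionCount_wordPerm_le l
  rw [Reduced, wordPerm_append, List.length_append] at h
  rw [Reduced]
  omega

lemma Reduced.reverse {n : ℕ} {l : BraidWord n} (h : Reduced l) : Reduced l.reverse := by
  rw [Reduced, wordPerm_reverse, inversionCount_inv, List.length_reverse]
  exact h

lemma Reduced.of_cons {n : ℕ} {i : Fin (n - 1)} {l : BraidWord n} (h : Reduced (i :: l)) :
    Reduced l := by
  have := h.reverse
  rw [List.reverse_cons] at this
  simpa using this.of_append_left.reverse

lemma Reduced.lt_of_append {n : ℕ} {i : Fin (n - 1)} {l : BraidWord n} (h : Reduced (l ++ [i])) :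
    wordPerm l (lowerStrand i) < wordPerm l (upperStrand i) := by
  -- Otherwise the last letter would remove an inversion.
  by_contra hc
  have hlt := lt_of_le_of_ne (not_lt.1 hc)
    (fun he => lowerStrand_ne_upperStrand i ((wordPerm l).injective he).symm)
  have h1 := inversionCount_mul_of_gt _ _ hlt
  have h2 : inversionCount (wordPerm l) = l.length := h.of_append_left
  simp only [Reduced, wordPerm_append, wordPerm_cons, wordPerm_nil, mul_one, List.length_append,
    List.length_singleton] at h
  omega

lemma Reduced.permLength_eq {n : ℕ} {l : BraidWord n} (h : Reduced l) :
    permLength (wordPerm l) = l.length := by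
  apply le_antisymm
  · exact Nat.sInf_le ⟨l, rfl, rfl⟩
  · have hne : {k | ∃ l' : BraidWord n, l'.length = k ∧
        (l'.map simpleTransposition).prod = wordPerm l}.Nonempty := ⟨_, l, rfl, rfl⟩
    obtain ⟨l', h1, h2⟩ := Nat.sInf_mem hne
    have h3 := inversionCount_wordPerm_le l'
    rw [wordPerm, h2, h, h1] at h3
    exact h3

/-- The Demazure product of a reduced word is the ordinary product. -/
lemma Reduced.demazure_eq {n : ℕ} {l : BraidWord n} (h : Reduced l) : demazure l = wordPerm l := by
  induction l using List.reverseRecOn with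
  | nil => rfl
  | append_singleton l i ih =>
    have hl := h.of_append_left
    have h1 : wordPerm (l ++ [i]) = wordPerm l * simpleTransposition i := by simp
    have h2 := h.permLength_eq
    rw [h1, List.length_append, List.length_singleton] at h2
    rw [demazure, List.foldl_append]
    change demazureStep (demazure l) i = _
    rw [ih hl, demazureStep, if_pos (by rw [h2, hl.permLength_eq]), h1]

/-! ### The half twist -/

lemma filter_le_finRange {N : ℕ} (j : Fin N) :
    (List.finRange N).filter (· ≤ j) = (List.finRange N).take (j + 1) := by
  rw [← List.take_append_drop ((j : ℕ) + 1) (List.finRange N), List.filter_append,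
    List.filter_eq_self.2, List.filter_eq_nil_iff.2]
  · simp
  · intro a ha
    rw [List.mem_drop_iff_getElem] at ha
    obtain ⟨k, hk, rfl⟩ := ha
    simp [Fin.le_def]
    omega
  · intro a ha
    rw [List.mem_take_iff_getElem] at ha
    obtain ⟨k, hk, rfl⟩ := ha
    simp [Fin.le_def] at hk ⊢
    omega

/-- The factor `σ_{m} ⋯ σ_1` of the half twist represents a cycle. -/
lemma wordPerm_reverse_take_finRange {n : ℕ} (m : ℕ) (hm : m ≤ n - 1) (a : Fin n) :
    ((wordPerm ((List.finRange (n - 1)).take m).reverse a : Fin n) : ℕ) =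
      if (a : ℕ) = 0 then m else if (a : ℕ) ≤ m then a - 1 else a := by
  induction m with
  | zero =>
    simp only [List.take_zero, List.reverse_nil, wordPerm_nil, Equiv.Perm.coe_one, id_eq]
    split_ifs <;> omega
  | succ m ih =>
    have hm' : m < n - 1 := hm
    rw [List.take_add_one, List.getElem?_eq_getElem (by simpa using hm')]
    simp only [Option.toList_some, List.reverse_append, List.reverse_cons, List.reverse_nil,
      List.nil_append, List.singleton_append, wordPerm_cons, Equiv.Perm.mul_apply,
      List.getElem_finRange]
    have := ih hm'.le
    simp only [simpleTransposition, Equiv.swap_apply_def, lowerStrand, upperStrand, Fin.ext_iff,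
      apply_ite Fin.val, this]
    simp only [Fin.cast_mk]
    split_ifs <;> omega

/-- The first `m` factors of the half twist reverse the heights `0, …, m`. -/
lemma wordPerm_take_halfTwist {n : ℕ} (m : ℕ) (hm : m ≤ n - 1) (a : Fin n) :
    ((wordPerm (((List.finRange (n - 1)).take m).flatMap fun j =>
      ((List.finRange (n - 1)).filter (· ≤ j)).reverse) a : Fin n) : ℕ) =
      if (a : ℕ) ≤ m then m - a else a := by
  induction m generalizing a with
  | zero => simp
  | succ m ih =>
    have hm' : m < n - 1 := hm
    rw [List.take_add_one, List.getElem?_eq_getElem (by simpa using hm')]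
    simp only [Option.toList_some, List.flatMap_append, List.flatMap_cons, List.flatMap_nil,
      List.append_nil, List.getElem_finRange, wordPerm_append, Equiv.Perm.mul_apply]
    rw [ih hm'.le, filter_le_finRange]
    have := wordPerm_reverse_take_finRange (m + 1) hm a
    simp only [Fin.cast_mk] at this ⊢
    rw [this]
    split_ifs <;> omega

lemma wordPerm_halfTwist (n : ℕ) : wordPerm (halfTwist n) = Fin.revPerm := by
  ext a
  have := wordPerm_take_halfTwist (n - 1) le_rfl a
  rw [List.take_of_length_le (by simp)] at this
  rw [halfTwist, this]
  have ha := a.2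
  rw [if_pos (by omega), Fin.revPerm_apply, Fin.val_rev]
  omega

lemma length_halfTwist (n : ℕ) : (halfTwist n).length = ∑ b : Fin n, (b : ℕ) := by
  rw [halfTwist, List.length_flatMap]
  cases n with
  | zero => rfl
  | succ n =>
    rw [Fin.sum_univ_succ, Fin.val_zero, zero_add, ← List.sum_ofFn, List.ofFn_eq_map]
    congr 1
    apply List.map_congr_left
    intro j _
    rw [filter_le_finRange]
    simp

lemma reduced_halfTwist (n : ℕ) : Reduced (halfTwist n) := by
  rw [Reduced, wordPerm_halfTwist, length_halfTwist, inversionCount]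
  simp only [Fin.revPerm_apply, Fin.rev_lt_rev, and_self]
  rw [Finset.card_filter, Fintype.sum_prod_type_right]
  refine Finset.sum_congr rfl fun b _ => ?_
  rw [← Finset.card_filter]
  have : (Finset.univ.filter fun a : Fin n => a < b) = Finset.Iio b := by ext; simp
  simp [this]

lemma longestElement_eq (n : ℕ) : longestElement n = Fin.revPerm := by
  rw [longestElement, (reduced_halfTwist n).demazure_eq, wordPerm_halfTwist]

/-! ### Triangular matrices and permutation matrices -/

section Matrices

open Matrix

variable {n : ℕ} {A : Type} [CommRing A]

/-- Upper triangular matrices with ones on the diagonal. -/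
def UpperUnipotent (P : Matrix (Fin n) (Fin n) A) : Prop :=
  P.BlockTriangular id ∧ ∀ a, P a a = 1

lemma upperTriangular_mul_apply_self {P Q : Matrix (Fin n) (Fin n) A} (hP : P.BlockTriangular id)
    (hQ : Q.BlockTriangular id) (a : Fin n) : (P * Q) a a = P a a * Q a a := by
  rw [Matrix.mul_apply]
  refine Finset.sum_eq_single a (fun b _ hb => ?_) (by simp)
  rcases lt_or_gt_of_ne hb with h | h
  · rw [hP (show id b < id a from h), zero_mul]
  · rw [hQ (show id a < id b from h), mul_zero]

lemma upperTriangular_of_mul_eq_one {P Q : Matrix (Fin n) (Fin n) A} (hP : P.BlockTriangular id)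
    (h : P * Q = 1) : Q.BlockTriangular id := by
  have : Invertible P := ⟨Q, mul_eq_one_comm.1 h, h⟩
  rw [← Matrix.inv_eq_right_inv h]
  exact blockTriangular_inv_of_blockTriangular hP

namespace UpperUnipotent

variable {P Q : Matrix (Fin n) (Fin n) A}

lemma one : UpperUnipotent (1 : Matrix (Fin n) (Fin n) A) :=
  ⟨blockTriangular_one, fun _ => Matrix.one_apply_eq _⟩

lemma mul (hP : UpperUnipotent P) (hQ : UpperUnipotent Q) : UpperUnipotent (P * Q) :=
  ⟨hP.1.mul hQ.1, fun a => by
    rw [upperTriangular_mul_apply_self hP.1 hQ.1, hP.2, hQ.2, one_mul]⟩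

lemma isUnit_det (hP : UpperUnipotent P) : IsUnit P.det := by
  rw [det_of_isUpperTriangular hP.1]
  simp [hP.2]

lemma mul_inv (hP : UpperUnipotent P) : P * P⁻¹ = 1 := Matrix.mul_nonsing_inv _ hP.isUnit_det

lemma inv_mul (hP : UpperUnipotent P) : P⁻¹ * P = 1 := Matrix.nonsing_inv_mul _ hP.isUnit_det

lemma inv (hP : UpperUnipotent P) : UpperUnipotent P⁻¹ := by
  have h := upperTriangular_of_mul_eq_one hP.1 hP.mul_inv
  refine ⟨h, fun a => ?_⟩
  have := upperTriangular_mul_apply_self hP.1 h a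
  rw [hP.mul_inv, hP.2, Matrix.one_apply_eq, one_mul] at this
  exact this.symm

lemma transvection {a b : Fin n} (h : a < b) (z : A) : UpperUnipotent (transvection a b z) := by
  refine ⟨fun c d hcd => ?_, fun c => ?_⟩
  · have hcd : d < c := hcd
    simp only [Matrix.transvection, Matrix.add_apply, Matrix.single_apply,
      Matrix.one_apply_ne hcd.ne', zero_add]
    rw [if_neg]
    rintro ⟨rfl, rfl⟩
    exact absurd h hcd.not_gt
  · simp only [Matrix.transvection, Matrix.add_apply, Matrix.single_apply, Matrix.one_apply_eq]
    rw [if_neg, add_zero]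
    rintro ⟨rfl, rfl⟩
    exact absurd h (lt_irrefl _)

/-- Next to the diagonal, the product of unipotent matrices is additive. -/
lemma mul_apply_adjacent (hP : UpperUnipotent P) (hQ : UpperUnipotent Q) (i : Fin (n - 1)) :
    (P * Q) (lowerStrand i) (upperStrand i) =
      P (lowerStrand i) (upperStrand i) + Q (lowerStrand i) (upperStrand i) := by
  rw [Matrix.mul_apply, ← Finset.sum_subset (Finset.subset_univ {lowerStrand i, upperStrand i}),
    Finset.sum_pair (lowerStrand_ne_upperStrand i), hP.2, hQ.2, one_mul, mul_one, add_comm]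
  intro c _ hc
  simp only [Finset.mem_insert, Finset.mem_singleton, not_or] at hc
  have hl : (c : ℕ) ≠ i := fun h => hc.1 (Fin.ext h)
  have hu : (c : ℕ) ≠ i + 1 := fun h => hc.2 (Fin.ext h)
  rcases lt_or_gt_of_ne hl with h | h
  · rw [hP.1 (show id c < id (lowerStrand i) from h), zero_mul]
  · rw [hQ.1 (show id (upperStrand i) < id c from Fin.lt_def.2 (by simp [upperStrand]; omega)),
      mul_zero]

lemma neg_of_diag {V : Matrix (Fin n) (Fin n) A} (h : V.BlockTriangular id)
    (h' : ∀ a, V a a = -1) : UpperUnipotent (-V) := ⟨h.neg, fun a => by simp [h']⟩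

lemma conj_diagonal (hP : UpperUnipotent P) (t : Fin n → Aˣ) :
    UpperUnipotent (diagonal (fun a => (t a : A)) * P *
      diagonal (fun a => ((t a)⁻¹ : Aˣ) : _ → A)) := by
  refine ⟨fun a b hab => ?_, fun a => ?_⟩
  · simp [Matrix.diagonal_mul, Matrix.mul_diagonal, hP.1 hab]
  · simp [Matrix.diagonal_mul, Matrix.mul_diagonal, hP.2]

end UpperUnipotent

lemma diagonal_units_mul_inv (t : Fin n → Aˣ) :
    diagonal (fun a => (t a : A)) * diagonal (fun a => ((t a)⁻¹ : Aˣ) : _ → A) = 1 := by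
  simp

lemma diagonal_units_inv_mul (t : Fin n → Aˣ) :
    diagonal (fun a => ((t a)⁻¹ : Aˣ) : _ → A) * diagonal (fun a => (t a : A)) = 1 := by
  simp

lemma permutationMatrix_mul_apply (π : Equiv.Perm (Fin n)) (M : Matrix (Fin n) (Fin n) A)
    (a b : Fin n) : (permutationMatrix A π * M) a b = M (π⁻¹ a) b := by
  rw [Matrix.mul_apply, Finset.sum_eq_single (π⁻¹ a)]
  · simp [permutationMatrix]
  · intro c _ hc
    have : a ≠ π c := fun h => hc (by simp [h])
    simp [permutationMatrix, this]
  · simp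

lemma mul_permutationMatrix_apply (π : Equiv.Perm (Fin n)) (M : Matrix (Fin n) (Fin n) A)
    (a b : Fin n) : (M * permutationMatrix A π) a b = M a (π b) := by
  rw [Matrix.mul_apply, Finset.sum_eq_single (π b)]
  · simp [permutationMatrix]
  · intro c _ hc
    simp [permutationMatrix, hc]
  · simp

lemma permutationMatrix_mul (π σ : Equiv.Perm (Fin n)) :
    permutationMatrix A (π * σ) = permutationMatrix A π * permutationMatrix A σ := by
  ext a b
  rw [mul_permutationMatrix_apply]
  rfl

@[simp] lemma permutationMatrix_one : permutationMatrix A (1 : Equiv.Perm (Fin n)) = 1 := by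
  ext a b
  rfl

/-- The permutation matrix of the longest element. -/
abbrev revMatrix (n : ℕ) (A : Type) [CommRing A] : Matrix (Fin n) (Fin n) A :=
  permutationMatrix A Fin.revPerm

lemma revMatrix_mul_self :
    revMatrix n A * revMatrix n A = 1 := by
  rw [revMatrix, ← permutationMatrix_mul, ← permutationMatrix_one]
  congr 1
  ext a
  simp

lemma revMatrix_conj_apply (Q : Matrix (Fin n) (Fin n) A) (a b : Fin n) :
    (revMatrix n A * Q * revMatrix n A) a b = Q a.rev b.rev := by
  rw [mul_permutationMatrix_apply, permutationMatrix_mul_apply]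
  congr 1

/-- A matrix is diagonal if it is upper triangular and lower triangular; the latter means that its
conjugate by `w₀` is upper triangular. -/
lemma eq_diagonal_of_rev_conj {Q : Matrix (Fin n) (Fin n) A} (h : Q.BlockTriangular id)
    (h' : (revMatrix n A * Q * revMatrix n A).BlockTriangular id) :
    Q = diagonal fun a => Q a a := by
  ext a b
  rcases lt_trichotomy a b with hab | rfl | hab
  · have := h' (show id b.rev < id a.rev from Fin.rev_lt_rev.2 hab)
    rw [revMatrix_conj_apply, Fin.rev_rev, Fin.rev_rev] at this
    rw [this, diagonal_apply_ne _ hab.ne]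
  · simp
  · rw [h hab, diagonal_apply_ne _ hab.ne']

lemma UpperUnipotent.eq_one_of_rev_conj {Q : Matrix (Fin n) (Fin n) A} (h : UpperUnipotent Q)
    (h' : (revMatrix n A * Q * revMatrix n A).BlockTriangular id) : Q = 1 := by
  rw [eq_diagonal_of_rev_conj h.1 h', ← diagonal_one]
  congr 1
  ext a
  exact h.2 a

/-! ### Braid matrices -/

@[simp] lemma simpleTransposition_inv (i : Fin (n - 1)) :
    (simpleTransposition i : Equiv.Perm (Fin n))⁻¹ = simpleTransposition i := by
  simp [simpleTransposition]

lemma braidMatrix_eq (i : Fin (n - 1)) (z : A) :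
    braidMatrix A i z = permutationMatrix A (simpleTransposition i) *
      transvection (lowerStrand i) (upperStrand i) z := by
  ext a b
  have hne := lowerStrand_ne_upperStrand i
  rw [permutationMatrix_mul_apply, simpleTransposition_inv]
  simp only [braidMatrix, Matrix.of_apply, transvection, Matrix.add_apply, Matrix.single_apply,
    Matrix.one_apply]
  by_cases h1 : a = lowerStrand i
  · subst h1
    simp [hne, eq_comm]
  · by_cases h2 : a = upperStrand i
    · subst h2
      by_cases h3 : b = lowerStrand i
      · subst h3
        simp [hne.symm]
      · by_cases h4 : b = upperStrand i
        · subst h4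
          simp [hne, hne.symm]
        · simp [h3, h4, hne.symm, Ne.symm h3, Ne.symm h4]
    · rw [simpleTransposition_of_ne i h1 h2]
      simp [h1, h2, Ne.symm h1]

lemma simpleMatrix_mul_self (i : Fin (n - 1)) :
    permutationMatrix A (simpleTransposition i) * permutationMatrix A (simpleTransposition i) =
      1 := by
  rw [← permutationMatrix_mul, simpleTransposition_mul_self, permutationMatrix_one]

/-- The inverse of the braid matrix `B_i(z)`. -/
def braidMatrixInv (i : Fin (n - 1)) (z : A) : Matrix (Fin n) (Fin n) A :=
  transvection (lowerStrand i) (upperStrand i) (-z) * permutationMatrix A (simpleTransposition i)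

lemma braidMatrixInv_mul (i : Fin (n - 1)) (z : A) :
    braidMatrixInv i z * braidMatrix A i z = 1 := by
  rw [braidMatrix_eq, braidMatrixInv, Matrix.mul_assoc, ← Matrix.mul_assoc (permutationMatrix A _),
    simpleMatrix_mul_self, Matrix.one_mul,
    transvection_mul_transvection_same _ _ (lowerStrand_ne_upperStrand i), neg_add_cancel,
    transvection_zero]

lemma braidMatrix_mul_inv (i : Fin (n - 1)) (z : A) :
    braidMatrix A i z * braidMatrixInv i z = 1 :=
  mul_eq_one_comm.1 (braidMatrixInv_mul i z)

lemma isUnit_det_braidWordMatrix (β : BraidWord n) (z : Fin β.length → A) :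
    IsUnit (braidWordMatrix A β z).det := by
  induction β with
  | nil => simp [braidWordMatrix]
  | cons i β ih =>
    rw [braidWordMatrix, det_mul]
    refine (ih _).mul ?_
    exact (Matrix.isUnit_iff_isUnit_det _).1
      ⟨⟨_, _, braidMatrix_mul_inv i (z 0), braidMatrixInv_mul i (z 0)⟩, rfl⟩

lemma braidWordMatrix_append_singleton (l : BraidWord n) (i : Fin (n - 1))
    (z : Fin (l ++ [i]).length → A) :
    braidWordMatrix A (l ++ [i]) z = braidMatrix A i (z ⟨l.length, by grind⟩) *
      braidWordMatrix A l (fun k => z ⟨k, by grind⟩) := by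
  induction l with
  | nil => simp [braidWordMatrix]
  | cons j l ih =>
    change braidWordMatrix A (l ++ [i]) (fun k => z k.succ) * braidMatrix A j (z ⟨0, by grind⟩) = _
    rw [ih, Matrix.mul_assoc]
    rfl

/-- The braid matrix of a reduced word is the inverse of its permutation matrix times a unipotent
matrix: each new letter contributes a transvection whose position is an inversion. -/
lemma Reduced.upperUnipotent {l : BraidWord n} (h : Reduced l) (z : Fin l.length → A) :
    UpperUnipotent (permutationMatrix A (wordPerm l) * braidWordMatrix A l z) := by
  induction l using List.reverseRecOn with
  | nil => simpa [braidWordMatrix] using UpperUnipotent.one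
  | append_singleton l i ih =>
    rw [braidWordMatrix_append_singleton, braidMatrix_eq, wordPerm_append, permutationMatrix_mul]
    set z0 := z ⟨l.length, by grind⟩
    -- Moving the transvection to the left of the permutation matrix permutes its indices.
    have key : permutationMatrix A (wordPerm l) *
        transvection (lowerStrand i) (upperStrand i) z0 =
        transvection (wordPerm l (lowerStrand i)) (wordPerm l (upperStrand i)) z0 *
          permutationMatrix A (wordPerm l) := by
      ext a b
      rw [permutationMatrix_mul_apply, mul_permutationMatrix_apply]
      simp only [transvection, Matrix.add_apply, Matrix.single_apply, Matrix.one_apply,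
        Equiv.Perm.inv_eq_iff_eq, EmbeddingLike.apply_eq_iff_eq, Equiv.Perm.eq_inv_iff_eq]
    have : permutationMatrix A (wordPerm l) * permutationMatrix A (wordPerm [i]) *
        (permutationMatrix A (simpleTransposition i) *
          transvection (lowerStrand i) (upperStrand i) z0 *
          braidWordMatrix A l fun k => z ⟨k, by grind⟩) =
        transvection (wordPerm l (lowerStrand i)) (wordPerm l (upperStrand i)) z0 *
        (permutationMatrix A (wordPerm l) * braidWordMatrix A l fun k => z ⟨k, by grind⟩) := by
      rw [← Matrix.mul_assoc _ (permutationMatrix A (wordPerm l)), ← key]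
      simp only [Matrix.mul_assoc, wordPerm_cons, wordPerm_nil, mul_one]
      rw [← Matrix.mul_assoc (permutationMatrix A (simpleTransposition i)),
        simpleMatrix_mul_self, Matrix.one_mul]
    rw [this]
    exact (UpperUnipotent.transvection h.lt_of_append _).mul (ih h.of_append_left _)

/-- Among the braid matrices of a reduced word, the inverse of its permutation matrix occurs only at
the origin. -/
lemma Reduced.eq_zero_of_eq_one {l : BraidWord n} (h : Reduced l) (z : Fin l.length → A)
    (hz : permutationMatrix A (wordPerm l) * braidWordMatrix A l z = 1) : z = 0 := by
  induction l with
  | nil => ext k; exact k.elim0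
  | cons i l ih =>
    set S := permutationMatrix A (simpleTransposition i)
    set U := permutationMatrix A (wordPerm l) * braidWordMatrix A l fun k => z k.succ with hU
    have h1 : S * (U * braidMatrix A i (z 0)) = 1 := by
      rw [← hz, wordPerm_cons, permutationMatrix_mul, braidWordMatrix]
      simp only [hU, S, Matrix.mul_assoc]
    have h2 : U = S * braidMatrixInv i (z 0) := by
      calc U = (S * S) * (U * (braidMatrix A i (z 0) * braidMatrixInv i (z 0))) := by
            rw [braidMatrix_mul_inv, simpleMatrix_mul_self, Matrix.one_mul, Matrix.mul_one]
        _ = S * (S * (U * braidMatrix A i (z 0))) * braidMatrixInv i (z 0) := by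
            simp only [Matrix.mul_assoc]
        _ = _ := by rw [h1, Matrix.mul_one]
    -- `U` is unipotent and equals `s_i B_i(z₀)⁻¹`, whose entry at `(i + 1, i)` is `-z₀`.
    have h3 : z 0 = 0 := by
      have := (h.of_cons.upperUnipotent fun k => z k.succ).1
        (show id (lowerStrand i) < id (upperStrand i) from lowerStrand_lt_upperStrand i)
      rw [← hU, h2, permutationMatrix_mul_apply, braidMatrixInv, mul_permutationMatrix_apply] at this
      simpa [transvection, Matrix.one_apply_ne (lowerStrand_ne_upperStrand i)] using this
    have h4 : U = 1 := by
      rw [h2, h3, braidMatrixInv, neg_zero, transvection_zero, Matrix.one_mul,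
        simpleMatrix_mul_self]
    have h5 := ih h.of_cons _ h4
    ext k
    refine Fin.cases h3 (fun k => ?_) k
    exact congrFun h5 k

lemma braidWordMatrix_zero (l : BraidWord n) :
    permutationMatrix A (wordPerm l) * braidWordMatrix A l (fun _ => 0) = 1 := by
  induction l with
  | nil => simp [braidWordMatrix]
  | cons i l ih =>
    rw [wordPerm_cons, permutationMatrix_mul, braidWordMatrix, braidMatrix_eq, transvection_zero,
      Matrix.mul_one, Matrix.mul_assoc, ← Matrix.mul_assoc _ (braidWordMatrix A l _), ih,
      Matrix.one_mul, simpleMatrix_mul_self]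

end Matrices

section Gauge

open Matrix

variable {n : ℕ} {A : Type} [CommRing A]

/-! ### The action of unipotent matrices on braid words -/

/-- The matrix `B_i(z') P B_i(z)⁻¹`, where `z' = z - P_{i,i+1}`: what becomes of `P` when it is
moved through the letter `σ_i`. -/
def transfer (i : Fin (n - 1)) (z : A) (P : Matrix (Fin n) (Fin n) A) : Matrix (Fin n) (Fin n) A :=
  braidMatrix A i (z - P (lowerStrand i) (upperStrand i)) * P * braidMatrixInv i z

/-- The action of a unipotent matrix `P` on the coordinates of a braid word: the matrix is moved
through the letters one after another, by `transfer`. -/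
def act : (β : BraidWord n) → (Fin β.length → A) → Matrix (Fin n) (Fin n) A → Fin β.length → A
  | [], z, _ => z
  | i :: β, z, P =>
    Fin.cons (α := fun _ => A) (z 0 - P (lowerStrand i) (upperStrand i))
      (act β (fun k => z k.succ) (transfer i (z 0) P))

/-- The matrix which arrives at the end of the braid word when `P` is moved through it. -/
def out : (β : BraidWord n) → (Fin β.length → A) → Matrix (Fin n) (Fin n) A →
    Matrix (Fin n) (Fin n) A
  | [], _, P => P
  | i :: β, z, P => out β (fun k => z k.succ) (transfer i (z 0) P)

lemma transfer_mul_braidMatrix (i : Fin (n - 1)) (z : A) (P : Matrix (Fin n) (Fin n) A) :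
    transfer i z P * braidMatrix A i z =
      braidMatrix A i (z - P (lowerStrand i) (upperStrand i)) * P := by
  rw [transfer, Matrix.mul_assoc _ (braidMatrixInv i z), braidMatrixInv_mul, Matrix.mul_one]

/-- The coordinate `z' = z - P_{i,i+1}` is the one for which `B_i(z') P B_i(z)⁻¹` is unipotent
again. -/
lemma UpperUnipotent.transfer {P : Matrix (Fin n) (Fin n) A} (hP : UpperUnipotent P)
    (i : Fin (n - 1)) (z : A) : UpperUnipotent (transfer i z P) := by
  set z' := z - P (lowerStrand i) (upperStrand i) with hz'
  set R := Matrix.transvection (lowerStrand i) (upperStrand i) z' * P *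
    Matrix.transvection (lowerStrand i) (upperStrand i) (-z) with hR
  have hlt := lowerStrand_lt_upperStrand i
  have hu : UpperUnipotent R :=
    ((UpperUnipotent.transvection hlt _).mul hP).mul (UpperUnipotent.transvection hlt _)
  -- Conjugation by `s_i` exchanges the entries at `(i, i + 1)` and `(i + 1, i)`, so the former has
  -- to vanish; this is what fixes `z'`.
  have h0 : R (lowerStrand i) (upperStrand i) = 0 := by
    rw [hR, ((UpperUnipotent.transvection hlt _).mul hP).mul_apply_adjacent
      (UpperUnipotent.transvection hlt _), (UpperUnipotent.transvection hlt _).mul_apply_adjacent hP]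
    simp [Matrix.transvection, Matrix.one_apply_ne hlt.ne, hz']
  have he : LegendrianBraid.transfer i z P = permutationMatrix A (simpleTransposition i) * R *
      permutationMatrix A (simpleTransposition i) := by
    rw [LegendrianBraid.transfer, braidMatrix_eq, braidMatrixInv, hR]
    simp only [Matrix.mul_assoc]
    rfl
  refine ⟨fun a b hab => ?_, fun a => ?_⟩
  · rw [he, mul_permutationMatrix_apply, permutationMatrix_mul_apply, simpleTransposition_inv]
    by_cases h : b = lowerStrand i ∧ a = upperStrand i
    · obtain ⟨rfl, rfl⟩ := h
      simpa using h0
    · exact hu.1 (simpleTransposition_lt i hab h)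
  · rw [he, mul_permutationMatrix_apply, permutationMatrix_mul_apply, simpleTransposition_inv]
    exact hu.2 _

lemma UpperUnipotent.out {P : Matrix (Fin n) (Fin n) A} (hP : UpperUnipotent P) (β : BraidWord n)
    (z : Fin β.length → A) : UpperUnipotent (out β z P) := by
  induction β generalizing P with
  | nil => exact hP
  | cons i β ih => exact ih (hP.transfer i _) _

/-- The braid matrix is equivariant for the action. -/
lemma braidWordMatrix_act (β : BraidWord n) (z : Fin β.length → A)
    (P : Matrix (Fin n) (Fin n) A) :
    braidWordMatrix A β (act β z P) * P = out β z P * braidWordMatrix A β z := by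
  induction β generalizing P with
  | nil => simp [braidWordMatrix, out]
  | cons i β ih =>
    simp only [braidWordMatrix, act, out, Fin.cons_zero, Fin.cons_succ]
    rw [Matrix.mul_assoc, ← transfer_mul_braidMatrix, ← Matrix.mul_assoc, ih, Matrix.mul_assoc]

lemma transfer_transfer {P Q : Matrix (Fin n) (Fin n) A} (hP : UpperUnipotent P)
    (hQ : UpperUnipotent Q) (i : Fin (n - 1)) (z : A) :
    transfer i (z - P (lowerStrand i) (upperStrand i)) Q * transfer i z P =
      transfer i z (Q * P) := by
  rw [transfer, transfer, transfer, hQ.mul_apply_adjacent hP, sub_sub, add_comm (Q _ _)]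
  set z' := z - P (lowerStrand i) (upperStrand i)
  set B := braidMatrix A i (z - (P (lowerStrand i) (upperStrand i) +
    Q (lowerStrand i) (upperStrand i)))
  calc _ = B * Q * (braidMatrixInv i z' * braidMatrix A i z') * (P * braidMatrixInv i z) := by
        simp only [Matrix.mul_assoc]
    _ = _ := by rw [braidMatrixInv_mul, Matrix.mul_one]; simp only [Matrix.mul_assoc]

lemma act_act {P Q : Matrix (Fin n) (Fin n) A} (hP : UpperUnipotent P) (hQ : UpperUnipotent Q)
    (β : BraidWord n) (z : Fin β.length → A) : act β (act β z P) Q = act β z (Q * P) := by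
  induction β generalizing P Q with
  | nil => rfl
  | cons i β ih =>
    simp only [act, Fin.cons_zero, Fin.cons_succ]
    rw [ih (hP.transfer i _) (hQ.transfer i _), transfer_transfer hP hQ,
      hQ.mul_apply_adjacent hP, sub_sub, add_comm (Q _ _)]

lemma transfer_one (i : Fin (n - 1)) (z : A) : transfer i z 1 = 1 := by
  rw [transfer, Matrix.one_apply_ne (lowerStrand_ne_upperStrand i), sub_zero, Matrix.mul_one,
    braidMatrix_mul_inv]

lemma act_one (β : BraidWord n) (z : Fin β.length → A) : act β z 1 = z := by
  induction β with
  | nil => rfl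
  | cons i β ih =>
    simp only [act, transfer_one, ih, Matrix.one_apply_ne (lowerStrand_ne_upperStrand i), sub_zero]
    exact Fin.cons_self_tail z

/-- If the identity arrives at the end of `β`, then the coordinates after `β` do not move. -/
lemma act_append_of_out_eq_one (β γ : BraidWord n) (z : Fin (β ++ γ).length → A)
    (P : Matrix (Fin n) (Fin n) A) (h : out β (fun k => z ⟨k, by grind⟩) P = 1)
    (k : Fin (β ++ γ).length) (hk : β.length ≤ k) : act (β ++ γ) z P k = z k := by
  induction β generalizing P with
  | nil =>
    have : P = 1 := h
    subst this
    exact congrFun (act_one γ z) k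
  | cons i β ih =>
    obtain ⟨k, hk'⟩ := k
    obtain _ | k := k
    · simp at hk
    · exact ih (fun k => z k.succ) _ h ⟨k, Nat.lt_of_succ_lt_succ hk'⟩ (Nat.le_of_succ_le_succ hk)

lemma map_transvection {B : Type} [CommRing B] (f : A →+* B) (a b : Fin n) (z : A) :
    (transvection a b z).map f = transvection a b (f z) := by
  ext c d
  simp only [transvection, Matrix.map_apply, Matrix.add_apply, Matrix.single_apply,
    Matrix.one_apply]
  split_ifs <;> simp

lemma map_permutationMatrix {B : Type} [CommRing B] (f : A →+* B) (π : Equiv.Perm (Fin n)) :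
    (permutationMatrix A π).map f = permutationMatrix B π := by
  ext c d
  simp only [permutationMatrix, Matrix.map_apply, Matrix.of_apply]
  split_ifs <;> simp

lemma map_braidMatrix {B : Type} [CommRing B] (f : A →+* B) (i : Fin (n - 1)) (z : A) :
    (braidMatrix A i z).map f = braidMatrix B i (f z) := by
  rw [braidMatrix_eq, Matrix.map_mul, map_permutationMatrix, map_transvection, ← braidMatrix_eq]

lemma map_transfer {B : Type} [CommRing B] (f : A →+* B) (i : Fin (n - 1)) (z : A)
    (P : Matrix (Fin n) (Fin n) A) :
    (transfer i z P).map f = transfer i (f z) (P.map f) := by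
  rw [transfer, transfer, Matrix.map_mul, Matrix.map_mul, map_braidMatrix, braidMatrixInv,
    Matrix.map_mul, map_transvection, map_permutationMatrix, braidMatrixInv, map_neg, map_sub]
  rfl

lemma map_act {B : Type} [CommRing B] (f : A →+* B) (β : BraidWord n) (z : Fin β.length → A)
    (P : Matrix (Fin n) (Fin n) A) (k : Fin β.length) :
    f (act β z P k) = act β (fun k => f (z k)) (P.map f) k := by
  induction β generalizing P with
  | nil => rfl
  | cons i β ih =>
    refine Fin.cases ?_ (fun k => ?_) k
    · simp [act]
    · simp only [act, Fin.cons_succ]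
      rw [ih, map_transfer]

lemma map_braidWordMatrix {B : Type} [CommRing B] (f : A →+* B) (β : BraidWord n)
    (z : Fin β.length → A) :
    (braidWordMatrix A β z).map f = braidWordMatrix B β fun k => f (z k) := by
  induction β with
  | nil => simp [braidWordMatrix]
  | cons i β ih => rw [braidWordMatrix, Matrix.map_mul, ih, map_braidMatrix]; rfl

/-! ### The braid matrix of the half twist -/

lemma upperUnipotent_halfTwist (w : Fin (halfTwist n).length → A) :
    UpperUnipotent (revMatrix n A * braidWordMatrix A (halfTwist n) w) := by
  have := (reduced_halfTwist n).upperUnipotent w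
  rwa [wordPerm_halfTwist] at this

/-- The half twist absorbs every unipotent matrix: what arrives at its end is both upper and lower
triangular. -/
lemma out_halfTwist (w : Fin (halfTwist n).length → A) {P : Matrix (Fin n) (Fin n) A}
    (hP : UpperUnipotent P) : out (halfTwist n) w P = 1 := by
  have h := braidWordMatrix_act (halfTwist n) w P
  have hU := upperUnipotent_halfTwist w
  set U := revMatrix n A * braidWordMatrix A (halfTwist n) w with hUdef
  refine (hP.out _ w).eq_one_of_rev_conj ?_
  have : revMatrix n A * out (halfTwist n) w P * revMatrix n A =
      revMatrix n A * braidWordMatrix A (halfTwist n) (act (halfTwist n) w P) * P * U⁻¹ := by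
    have h1 : braidWordMatrix A (halfTwist n) w = revMatrix n A * U := by
      rw [hUdef, ← Matrix.mul_assoc, revMatrix_mul_self, Matrix.one_mul]
    rw [Matrix.mul_assoc (revMatrix n A) _ P, h, h1]
    simp only [Matrix.mul_assoc]
    rw [hU.mul_inv, Matrix.mul_one]
  rw [this]
  exact (((upperUnipotent_halfTwist _).mul hP).mul hU.inv).1

lemma revMatrix_mul_act_halfTwist (w : Fin (halfTwist n).length → A)
    {P : Matrix (Fin n) (Fin n) A} (hP : UpperUnipotent P) :
    revMatrix n A * braidWordMatrix A (halfTwist n) (act (halfTwist n) w P) * P =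
      revMatrix n A * braidWordMatrix A (halfTwist n) w := by
  rw [Matrix.mul_assoc, braidWordMatrix_act, out_halfTwist w hP, Matrix.one_mul]

/-- The half twist parametrizes the unipotent matrices: existence. -/
lemma exists_halfTwist_eq {U : Matrix (Fin n) (Fin n) A} (hU : UpperUnipotent U) :
    ∃ w, revMatrix n A * braidWordMatrix A (halfTwist n) w = U := by
  refine ⟨act (halfTwist n) (fun _ => 0) U⁻¹, ?_⟩
  have h := revMatrix_mul_act_halfTwist (fun _ => 0) hU.inv
  have h0 := braidWordMatrix_zero (A := A) (halfTwist n)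
  rw [wordPerm_halfTwist] at h0
  rw [h0] at h
  have := congrArg (· * U) h
  simpa only [Matrix.mul_assoc, hU.inv_mul, Matrix.mul_one, Matrix.one_mul] using this

/-- The half twist parametrizes the unipotent matrices: uniqueness. -/
lemma halfTwist_injective {w w' : Fin (halfTwist n).length → A}
    (h : revMatrix n A * braidWordMatrix A (halfTwist n) w =
      revMatrix n A * braidWordMatrix A (halfTwist n) w') : w = w' := by
  -- Acting by `w₀ B_Δ(w)` moves `w` to the origin, and the action is invertible.
  have key : ∀ w : Fin (halfTwist n).length → A,
      act (halfTwist n) w (revMatrix n A * braidWordMatrix A (halfTwist n) w) = 0 := by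
    intro w
    have hU := upperUnipotent_halfTwist w
    have h := revMatrix_mul_act_halfTwist w hU
    refine (reduced_halfTwist n).eq_zero_of_eq_one _ ?_
    rw [wordPerm_halfTwist]
    have := congrArg (· * (revMatrix n A * braidWordMatrix A (halfTwist n) w)⁻¹) h
    rwa [hU.mul_inv, Matrix.mul_assoc _ (revMatrix n A * _) (_)⁻¹, hU.mul_inv, Matrix.mul_one]
      at this
  have h1 := key w
  have h2 := key w'
  rw [← h] at h2
  have hU := upperUnipotent_halfTwist w
  rw [← act_one (halfTwist n) w, ← act_one (halfTwist n) w', ← hU.inv_mul,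
    ← act_act hU hU.inv, ← act_act hU hU.inv, h1, h2]

/-! ### The augmentation equations and the braid variety -/

/-- The matrix `B_Δ(w) diag(t) B_β(z)` whose triangularity characterizes augmentations. -/
def closureMatrix (β : BraidWord n) (z : Fin β.length → A) (t : Fin n → Aˣ)
    (w : Fin (halfTwist n).length → A) : Matrix (Fin n) (Fin n) A :=
  braidWordMatrix A (halfTwist n) w * diagonal (fun a => (t a : A)) * braidWordMatrix A β z

/-- The equations cutting out the augmentations of the closure of `βΔ`. -/
def IsAugPoint (β : BraidWord n) (z : Fin β.length → A) (t : Fin n → Aˣ)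
    (w : Fin (halfTwist n).length → A) : Prop :=
  (closureMatrix β z t w).BlockTriangular id ∧ ∀ a, closureMatrix β z t w a a = -1

/-- The point of the braid variety in the orbit of a solution of the augmentation equations: the
matrix which moves it there is the negative of `closureMatrix`, and this matrix is unipotent. -/
def slicePoint (β : BraidWord n) (z : Fin β.length → A) (t : Fin n → Aˣ)
    (w : Fin (halfTwist n).length → A) : Fin β.length → A :=
  act β z (-closureMatrix β z t w)

/-- Membership in the braid variety of the longest element. -/
def IsBraidPoint (β : BraidWord n) (x : Fin β.length → A) : Prop :=
  (braidWordMatrix A β x * revMatrix n A).BlockTriangular id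

variable {β : BraidWord n} {z x : Fin β.length → A} {t t' : Fin n → Aˣ}
  {w w' : Fin (halfTwist n).length → A}

lemma IsAugPoint.upperUnipotent (h : IsAugPoint β z t w) :
    UpperUnipotent (-closureMatrix β z t w) := UpperUnipotent.neg_of_diag h.1 h.2

/-- `B_β(z) = diag(t)⁻¹ (w₀ B_Δ(w))⁻¹ w₀ V`, where `V` is `closureMatrix`. -/
lemma braidWordMatrix_eq_of_closureMatrix (β : BraidWord n) (z : Fin β.length → A)
    (t : Fin n → Aˣ) (w : Fin (halfTwist n).length → A) :
    diagonal (fun a => ((t a)⁻¹ : Aˣ) : _ → A) *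
      (revMatrix n A * braidWordMatrix A (halfTwist n) w)⁻¹ * revMatrix n A *
        closureMatrix β z t w = braidWordMatrix A β z := by
  have hU := upperUnipotent_halfTwist w
  calc _ = diagonal (fun a => ((t a)⁻¹ : Aˣ) : _ → A) *
        ((revMatrix n A * braidWordMatrix A (halfTwist n) w)⁻¹ *
          (revMatrix n A * braidWordMatrix A (halfTwist n) w)) *
          diagonal (fun a => (t a : A)) * braidWordMatrix A β z := by
        simp only [closureMatrix, Matrix.mul_assoc]
    _ = _ := by rw [hU.inv_mul, Matrix.mul_one, diagonal_units_inv_mul, Matrix.one_mul]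

/-- As `B_β(z) = diag(t)⁻¹ U⁻¹ w₀ V` with `U = w₀ B_Δ(w)`, acting by `-V` leaves a product of upper
triangular matrices and `w₀`. -/
lemma IsAugPoint.isBraidPoint_slicePoint (h : IsAugPoint β z t w) :
    IsBraidPoint β (slicePoint β z t w) := by
  have hV := h.upperUnipotent
  have hU := upperUnipotent_halfTwist w
  set V := closureMatrix β z t w with hVdef
  set U := revMatrix n A * braidWordMatrix A (halfTwist n) w
  set D' := diagonal (fun a => ((t a)⁻¹ : Aˣ) : _ → A)
  have h1 := braidWordMatrix_act β z (-V)
  have h2 : D' * U⁻¹ * revMatrix n A * V = braidWordMatrix A β z :=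
    braidWordMatrix_eq_of_closureMatrix β z t w
  have h3 : braidWordMatrix A β (act β z (-V)) * revMatrix n A =
      -(out β z (-V) * (D' * U⁻¹)) := by
    have h4 : braidWordMatrix A β (act β z (-V)) =
        -(out β z (-V) * (D' * U⁻¹ * revMatrix n A)) := by
      calc _ = braidWordMatrix A β (act β z (-V)) * (-V) * (-V)⁻¹ := by
            rw [Matrix.mul_assoc, hV.mul_inv, Matrix.mul_one]
        _ = -(out β z (-V) * (D' * U⁻¹ * revMatrix n A * ((-V) * (-V)⁻¹))) := by
            rw [h1, ← h2]
            simp only [Matrix.mul_assoc, Matrix.mul_neg, Matrix.neg_mul, neg_neg]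
        _ = _ := by rw [hV.mul_inv, Matrix.mul_one]
    rw [h4]
    simp only [Matrix.neg_mul, Matrix.mul_assoc, revMatrix_mul_self, Matrix.mul_one]
  rw [IsBraidPoint, slicePoint, h3]
  exact ((hV.out β z).1.mul ((blockTriangular_diagonal _).mul hU.inv.1)).neg

/-- For a point `x` of the braid variety, the inverse of `B_β(x) w₀` is upper triangular, too. -/
lemma IsBraidPoint.exists_inv (h : IsBraidPoint β x) : ∃ T : Matrix (Fin n) (Fin n) A,
    T.BlockTriangular id ∧ braidWordMatrix A β x * revMatrix n A * T = 1 ∧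
      T * (braidWordMatrix A β x * revMatrix n A) = 1 := by
  have hu : IsUnit (braidWordMatrix A β x * revMatrix n A).det := by
    rw [det_mul]
    refine (isUnit_det_braidWordMatrix β x).mul ?_
    exact (Matrix.isUnit_iff_isUnit_det _).1
      ⟨⟨_, _, revMatrix_mul_self, revMatrix_mul_self⟩, rfl⟩
  exact ⟨_, upperTriangular_of_mul_eq_one h (Matrix.mul_nonsing_inv _ hu),
    Matrix.mul_nonsing_inv _ hu, Matrix.nonsing_inv_mul _ hu⟩

/-- Orbits meet the braid variety in at most one point. -/
lemma IsBraidPoint.eq_act (h : IsBraidPoint β x) {R : Matrix (Fin n) (Fin n) A}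
    (hR : UpperUnipotent R) (h' : IsBraidPoint β (act β x R)) : act β x R = x := by
  obtain ⟨T, hT, hT1, hT2⟩ := h'.exists_inv
  have h1 := braidWordMatrix_act β x R
  have h2 : revMatrix n A * R * revMatrix n A =
      T * (out β x R * (braidWordMatrix A β x * revMatrix n A)) := by
    calc _ = T * (braidWordMatrix A β (act β x R) * revMatrix n A) *
          (revMatrix n A * R * revMatrix n A) := by rw [hT2, Matrix.one_mul]
      _ = T * (braidWordMatrix A β (act β x R) * (revMatrix n A * revMatrix n A) * R *
          revMatrix n A) := by simp only [Matrix.mul_assoc]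
      _ = _ := by rw [revMatrix_mul_self, Matrix.mul_one, h1]; simp only [Matrix.mul_assoc]
  have : R = 1 := by
    refine hR.eq_one_of_rev_conj ?_
    rw [h2]
    exact hT.mul ((hR.out β x).1.mul h)
  rw [this, act_one]

/-- Solutions in the same orbit have the same point in the braid variety. -/
lemma IsAugPoint.slicePoint_act {P : Matrix (Fin n) (Fin n) A} (h : IsAugPoint β z t w)
    (hP : UpperUnipotent P) (h' : IsAugPoint β (act β z P) t' w') :
    slicePoint β (act β z P) t' w' = slicePoint β z t w := by
  have hV := h.upperUnipotent
  have hV' := h'.upperUnipotent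
  have key : slicePoint β (act β z P) t' w' = act β (slicePoint β z t w)
      (-closureMatrix β (act β z P) t' w' * P * (-closureMatrix β z t w)⁻¹) := by
    rw [slicePoint, slicePoint, act_act hP hV', act_act hV ((hV'.mul hP).mul hV.inv),
      Matrix.mul_assoc _ _ (-closureMatrix β z t w), hV.inv_mul, Matrix.mul_one]
  have h1 := h'.isBraidPoint_slicePoint
  rw [key] at h1 ⊢
  exact h.isBraidPoint_slicePoint.eq_act ((hV'.mul hP).mul hV.inv) h1

/-- The matrix `diag(t) Q diag(t)⁻¹` which enters the half twist, `Q` being the one which leaves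
`β`. -/
def crossMarks (t : Fin n → Aˣ) (Q : Matrix (Fin n) (Fin n) A) : Matrix (Fin n) (Fin n) A :=
  diagonal (fun a => (t a : A)) * Q * diagonal (fun a => ((t a)⁻¹ : Aˣ) : _ → A)

/-- The action on all coordinates multiplies `closureMatrix` by `P⁻¹`, since the identity arrives at
the end of the half twist. -/
lemma closureMatrix_act (β : BraidWord n) (z : Fin β.length → A) (t : Fin n → Aˣ)
    (w : Fin (halfTwist n).length → A) {P : Matrix (Fin n) (Fin n) A} (hP : UpperUnipotent P) :
    closureMatrix β (act β z P) t (act (halfTwist n) w (crossMarks t (out β z P))) * P =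
      closureMatrix β z t w := by
  set Q := out β z P with hQ
  have hc : UpperUnipotent (crossMarks t Q) := (hP.out β z).conj_diagonal t
  rw [closureMatrix, Matrix.mul_assoc, braidWordMatrix_act, ← hQ]
  calc _ = braidWordMatrix A (halfTwist n) (act (halfTwist n) w (crossMarks t Q)) *
        crossMarks t Q * diagonal (fun a => (t a : A)) * braidWordMatrix A β z := by
        rw [crossMarks]
        simp only [Matrix.mul_assoc]
        rw [← Matrix.mul_assoc (diagonal _) (diagonal _) (braidWordMatrix A β z),
          diagonal_units_inv_mul, Matrix.one_mul]
    _ = _ := by rw [braidWordMatrix_act, out_halfTwist _ hc, Matrix.one_mul, closureMatrix]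

lemma IsAugPoint.act {P : Matrix (Fin n) (Fin n) A} (h : IsAugPoint β z t w)
    (hP : UpperUnipotent P) :
    IsAugPoint β (act β z P) t (act (halfTwist n) w (crossMarks t (out β z P))) := by
  have hV := h.upperUnipotent
  have h1 := closureMatrix_act β z t w hP
  set V' := closureMatrix β (LegendrianBraid.act β z P) t
    (LegendrianBraid.act (halfTwist n) w (crossMarks t (out β z P))) with hV'
  have h2 : V' = -(-closureMatrix β z t w * P⁻¹) := by
    rw [← h1, Matrix.neg_mul, neg_neg, Matrix.mul_assoc, hP.mul_inv, Matrix.mul_one]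
  rw [IsAugPoint, ← hV', h2]
  refine ⟨(hV.mul hP.inv).1.neg, fun a => ?_⟩
  rw [Matrix.neg_apply, (hV.mul hP.inv).2]

/-- Every point of the braid variety comes from a solution of the augmentation equations. -/
lemma IsBraidPoint.exists_isAugPoint (h : IsBraidPoint β x) :
    ∃ t w, IsAugPoint β x t w ∧ slicePoint β x t w = x := by
  -- The inverse `T` of `B_β(x) w₀` is factored as `-U diag(t)` with `U` unipotent; then `w` is the
  -- solution of `U = w₀ B_Δ(w)`.
  obtain ⟨T, hT, hT1, hT2⟩ := h.exists_inv
  have hu : ∀ a, T a a * (braidWordMatrix A β x * revMatrix n A) a a = 1 := fun a => by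
    rw [← upperTriangular_mul_apply_self hT h, hT2, Matrix.one_apply_eq]
  have hu' : ∀ a, IsUnit (-T a a) := fun a => (IsUnit.of_mul_eq_one _ (hu a)).neg
  choose t ht using hu'
  have hU : UpperUnipotent (-T * diagonal (fun a => ((t a)⁻¹ : Aˣ) : _ → A)) := by
    refine ⟨hT.neg.mul (blockTriangular_diagonal _), fun a => ?_⟩
    rw [Matrix.mul_diagonal, Matrix.neg_apply, ← ht, Units.mul_inv]
  obtain ⟨w, hw⟩ := exists_halfTwist_eq hU
  have hV : closureMatrix β x t w = -1 := by
    calc closureMatrix β x t w = (revMatrix n A * revMatrix n A) * closureMatrix β x t w *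
          (revMatrix n A * revMatrix n A) := by
          rw [revMatrix_mul_self, Matrix.one_mul, Matrix.mul_one]
      _ = revMatrix n A * ((revMatrix n A * braidWordMatrix A (halfTwist n) w) *
          diagonal (fun a => (t a : A)) * (braidWordMatrix A β x * revMatrix n A)) *
            revMatrix n A := by simp only [closureMatrix, Matrix.mul_assoc]
      _ = revMatrix n A * (-(T * (diagonal (fun a => ((t a)⁻¹ : Aˣ) : _ → A) *
          diagonal (fun a => (t a : A))) * (braidWordMatrix A β x * revMatrix n A))) *
            revMatrix n A := by
          rw [hw]; simp only [Matrix.mul_assoc, Matrix.neg_mul, Matrix.mul_neg]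
      _ = -1 := by
          rw [diagonal_units_inv_mul, Matrix.mul_one, hT2, Matrix.mul_neg, Matrix.mul_one,
            Matrix.neg_mul, revMatrix_mul_self]
  refine ⟨t, w, ⟨?_, fun a => ?_⟩, ?_⟩
  · rw [hV]
    exact (blockTriangular_one).neg
  · rw [hV, Matrix.neg_apply, Matrix.one_apply_eq]
  · rw [slicePoint, hV, neg_neg, act_one]

/-- Over a point of the braid variety, the solution of the augmentation equations is unique. -/
lemma IsBraidPoint.isAugPoint_unique (h : IsBraidPoint β x) (h1 : IsAugPoint β x t w)
    (h2 : IsAugPoint β x t' w') : t = t' ∧ w = w' := by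
  obtain ⟨T, hT, hT1, hT2⟩ := h.exists_inv
  have key : ∀ {t w}, IsAugPoint β x t w →
      (revMatrix n A * braidWordMatrix A (halfTwist n) w) * diagonal (fun a => (t a : A)) = -T := by
    intro t w hx
    have hU := upperUnipotent_halfTwist w
    have e1 : revMatrix n A * closureMatrix β x t w * revMatrix n A =
        (revMatrix n A * braidWordMatrix A (halfTwist n) w) * diagonal (fun a => (t a : A)) *
          (braidWordMatrix A β x * revMatrix n A) := by
      simp only [closureMatrix, Matrix.mul_assoc]
    -- Both `V` and `w₀ V w₀` are upper triangular, so `V` is diagonal.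
    have e2 : closureMatrix β x t w = -1 := by
      have e3 := eq_diagonal_of_rev_conj hx.1
        (by rw [e1]; exact (hU.1.mul (blockTriangular_diagonal _)).mul h)
      have e4 : (fun a => closureMatrix β x t w a a) = fun _ => -1 := funext hx.2
      rw [e4] at e3
      rw [e3]
      ext a b
      by_cases hab : a = b <;> simp [hab]
    have e5 : (revMatrix n A * braidWordMatrix A (halfTwist n) w) *
        diagonal (fun a => (t a : A)) * (braidWordMatrix A β x * revMatrix n A) = -1 := by
      rw [← e1, e2, Matrix.mul_neg, Matrix.mul_one, Matrix.neg_mul, revMatrix_mul_self]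
    have e6 := congrArg (· * T) e5
    rwa [Matrix.mul_assoc _ _ T, hT1, Matrix.mul_one, Matrix.neg_mul, Matrix.one_mul] at e6
  have hU := upperUnipotent_halfTwist w
  have hU' := upperUnipotent_halfTwist w'
  have e := (key h1).trans (key h2).symm
  have ht : t = t' := by
    ext a
    have := congrFun (congrFun e a) a
    simpa only [Matrix.mul_diagonal, hU.2, hU'.2, one_mul] using this
  refine ⟨ht, halfTwist_injective ?_⟩
  subst ht
  have := congrArg (· * diagonal (fun a => ((t a)⁻¹ : Aˣ) : _ → A)) e
  simpa only [Matrix.mul_assoc _ (diagonal _) (diagonal _), diagonal_units_mul_inv, Matrix.mul_one]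
    using this

end Gauge

namespace PlatFront

open scoped Pointwise

variable {C T : Type} {D : PlatFront C T}

/-! ### Homogeneous elements and the differential -/

@[simp] lemma wordDegree_nil : D.wordDegree [] = 0 := rfl

@[simp] lemma wordDegree_cons (g : D.Gen) (w : List D.Gen) :
    D.wordDegree (g :: w) = D.degree g + D.wordDegree w := by simp [wordDegree]

@[simp] lemma wordDegree_append (w w' : List D.Gen) :
    D.wordDegree (w ++ w') = D.wordDegree w + D.wordDegree w' := by simp [wordDegree]

lemma isHomogeneous_zero (d : ℤ) : D.IsHomogeneous d 0 := by
  intro w hw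
  simp at hw

lemma IsHomogeneous.add {d : ℤ} {x y : D.Alg} (hx : D.IsHomogeneous d x)
    (hy : D.IsHomogeneous d y) : D.IsHomogeneous d (x + y) := by
  classical
  intro w hw
  rw [MonoidAlgebra.coeff_add] at hw
  rcases Finset.mem_union.1 (Finsupp.support_add hw) with h | h
  exacts [hx w h, hy w h]

lemma IsHomogeneous.neg {d : ℤ} {x : D.Alg} (hx : D.IsHomogeneous d x) :
    D.IsHomogeneous d (-x) := by
  intro w hw
  rw [MonoidAlgebra.coeff_neg, Finsupp.support_neg] at hw
  exact hx w hw

lemma IsHomogeneous.mul {d e : ℤ} {x y : D.Alg} (hx : D.IsHomogeneous d x)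
    (hy : D.IsHomogeneous e y) : D.IsHomogeneous (d + e) (x * y) := by
  classical
  intro w hw
  obtain ⟨u, hu, v, hv, rfl⟩ := Finset.mem_mul.1 (MonoidAlgebra.support_coeff_mul_subset x y hw)
  rw [FreeMonoid.toList_mul, wordDegree_append, hx u hu, hy v hv]

lemma isHomogeneous_single (w : FreeMonoid D.Gen) (r : LaurentRing T) :
    D.IsHomogeneous (D.wordDegree w.toList) (MonoidAlgebra.single w r : D.Alg) := by
  intro w' hw'
  rw [MonoidAlgebra.coeff_single] at hw'
  rw [Finset.mem_singleton.1 (Finsupp.support_single_subset hw')]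

lemma isHomogeneous_coeffElem (r : LaurentRing T) : D.IsHomogeneous 0 (D.coeffElem r) :=
  isHomogeneous_single 1 r

lemma isHomogeneous_gen (g : D.Gen) : D.IsHomogeneous (D.degree g) (D.gen g) := by
  have := isHomogeneous_single (D := D) (FreeMonoid.ofList [g]) 1
  rwa [FreeMonoid.toList_ofList, wordDegree_cons, wordDegree_nil, add_zero] at this

lemma single_eq_coeffElem_mul_word (w : FreeMonoid D.Gen) (r : LaurentRing T) :
    (MonoidAlgebra.single w r : D.Alg) = D.coeffElem r * D.word w.toList := by
  simp [coeffElem, word, MonoidAlgebra.single_mul_single]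

@[simp] lemma word_nil : D.word [] = 1 := rfl

lemma word_cons (g : D.Gen) (w : List D.Gen) : D.word (g :: w) = D.gen g * D.word w := by
  simp only [gen, word, MonoidAlgebra.single_mul_single, one_mul]
  rfl

lemma coeffElem_mul (r s : LaurentRing T) :
    D.coeffElem (r * s) = D.coeffElem r * D.coeffElem s := by
  simp [coeffElem, MonoidAlgebra.single_mul_single]

@[simp] lemma coeffElem_one : D.coeffElem 1 = 1 := rfl

lemma coeffElem_zero : D.coeffElem 0 = 0 := by simp [coeffElem]

lemma coeffElem_add (r s : LaurentRing T) :
    D.coeffElem (r + s) = D.coeffElem r + D.coeffElem s := by simp [coeffElem]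

@[simp] lemma laurentMonomial_zero (t : T) : laurentMonomial t 0 = 1 := by
  simp [laurentMonomial, AddMonoidAlgebra.one_def]

lemma laurentMonomial_add (t : T) (a b : ℤ) :
    laurentMonomial t (a + b) = laurentMonomial t a * laurentMonomial t b := by
  simp [laurentMonomial, AddMonoidAlgebra.single_mul_single]

lemma differential_single (w : FreeMonoid D.Gen) (r : LaurentRing T) :
    D.differential (MonoidAlgebra.single w r) = D.coeffElem r * D.wordDifferential w.toList := by
  rw [differential, MonoidAlgebra.coeff_single, Finsupp.sum_single_index]
  simp [coeffElem_zero]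

lemma differential_zero : D.differential 0 = 0 := by simp [differential]

lemma differential_add (x y : D.Alg) :
    D.differential (x + y) = D.differential x + D.differential y := by
  classical
  simp only [differential, MonoidAlgebra.coeff_add]
  rw [Finsupp.sum_add_index]
  · simp [coeffElem_zero]
  · intro w _ r s
    rw [coeffElem_add, add_mul]

lemma differential_gen (g : D.Gen) : D.differential (D.gen g) = D.genDifferential g := by
  rw [gen, word, differential_single]
  simp [wordDifferential]

lemma differential_coeffElem (r : LaurentRing T) : D.differential (D.coeffElem r) = 0 := by
  rw [coeffElem, differential_single]
  simp [wordDifferential]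

/-! ### Augmentations and homotopies in terms of generators -/

section Augmentation

variable {A : Type} [CommRing A]

/-- A ring homomorphism which kills the differentials of the generators kills all of them. -/
lemma map_differential_eq_zero (f : D.Alg →+* A)
    (hf : ∀ g, f (D.genDifferential g) = 0) (x : D.Alg) : f (D.differential x) = 0 := by
  have hw : ∀ w : List D.Gen, f (D.wordDifferential w) = 0 := by
    intro w
    induction w with
    | nil => simp [wordDifferential]
    | cons g w ih => simp [wordDifferential, hf, ih]
  induction x using MonoidAlgebra.induction_linear with
  | zero => rw [differential_zero, map_zero]
  | add x y hx hy => rw [differential_add, map_add, hx, hy, add_zero]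
  | single w r => rw [differential_single, map_mul, hw, mul_zero]

/-- The ring homomorphism with given values on the generators and on the marked points. -/
def evalHom [Fintype T] (D : PlatFront C T) (v : D.Gen → A) (t : T → Aˣ) : D.Alg →+* A :=
  MonoidAlgebra.liftNCRingHom
    (AddMonoidAlgebra.liftNCRingHom (Int.castRingHom A)
      { toFun := fun e => ((∏ i, t i ^ (Multiplicative.toAdd e i) : Aˣ) : A)
        map_one' := by simp
        map_mul' := fun a b => by simp [zpow_add, Finset.prod_mul_distrib] }
      fun _ _ => Commute.all _ _)
    (FreeMonoid.lift v) fun _ _ => Commute.all _ _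

lemma evalHom_gen [Fintype T] (v : D.Gen → A) (t : T → Aˣ) (g : D.Gen) :
    D.evalHom v t (D.gen g) = v g := by
  rw [evalHom, gen, word, MonoidAlgebra.liftNCRingHom_single, map_one, one_mul]
  simp [FreeMonoid.lift_apply]

lemma evalHom_mark [Fintype T] (v : D.Gen → A) (t : T → Aˣ) (i : T) :
    D.evalHom v t (D.coeffElem (laurentMonomial i 1)) = t i := by
  classical
  rw [evalHom, coeffElem, MonoidAlgebra.liftNCRingHom_single, map_one, mul_one, laurentMonomial,
    AddMonoidAlgebra.liftNCRingHom_single]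
  simp only [map_one, one_mul, MonoidHom.coe_mk, OneHom.coe_mk, toAdd_ofAdd]
  rw [Finset.prod_eq_single i]
  · simp
  · intro j _ hj
    simp [Finsupp.single_eq_of_ne hj]
  · simp

lemma map_word_eq_zero (f : D.Alg →+* A) (hf : ∀ g, D.degree g ≠ 0 → f (D.gen g) = 0)
    (w : List D.Gen) (hw : D.wordDegree w ≠ 0) : f (D.word w) = 0 := by
  induction w with
  | nil => simp at hw
  | cons g w ih =>
    rw [word_cons, map_mul]
    by_cases hg : D.degree g = 0
    · rw [ih (by simpa [hg] using hw), mul_zero]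
    · rw [hf g hg, zero_mul]

/-- An element is the sum of its terms, so that an additive statement on homogeneous elements needs
a proof for single words only. -/
lemma addMonoidHom_eq_zero_of_isHomogeneous (f : D.Alg →+ A) {d : ℤ}
    (hf : ∀ w r, D.wordDegree (FreeMonoid.toList w) = d → f (MonoidAlgebra.single w r) = 0)
    {x : D.Alg} (hx : D.IsHomogeneous d x) : f x = 0 := by
  have h : x = x.coeff.sum fun w r => (MonoidAlgebra.single w r : D.Alg) := by
    simp
  rw [h, Finsupp.sum, map_sum]
  exact Finset.sum_eq_zero fun w hw => hf w _ (hx w hw)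

lemma map_eq_zero_of_isHomogeneous (f : D.Alg →+* A)
    (hf : ∀ g, D.degree g ≠ 0 → f (D.gen g) = 0) {d : ℤ} (hd : d ≠ 0) {x : D.Alg}
    (hx : D.IsHomogeneous d x) : f x = 0 := by
  refine addMonoidHom_eq_zero_of_isHomogeneous (f : D.Alg →+ A) (fun w r hw => ?_) hx
  rw [AddMonoidHom.coe_coe, single_eq_coeffElem_mul_word, map_mul,
    map_word_eq_zero f hf _ (hw ▸ hd), mul_zero]

/-- The augmentation with given values on the generators of degree zero and on the marked points. -/
def Augmentation.mk' [Fintype T] (v : D.Gen → A) (t : T → Aˣ)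
    (hv : ∀ g, D.degree g ≠ 0 → v g = 0)
    (hd : ∀ g, D.evalHom v t (D.genDifferential g) = 0) : D.Augmentation A where
  toRingHom := D.evalHom v t
  map_of_degree_ne_zero _ _ hd' hx := map_eq_zero_of_isHomogeneous _
    (fun g hg => by rw [evalHom_gen, hv g hg]) hd' hx
  map_differential := map_differential_eq_zero _ hd

namespace Augmentation

/-- The value of an augmentation at a marked point. -/
def mark (ε : D.Augmentation A) (i : T) : Aˣ where
  val := ε.toRingHom (D.coeffElem (laurentMonomial i 1))
  inv := ε.toRingHom (D.coeffElem (laurentMonomial i (-1)))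
  val_inv := by rw [← map_mul, ← coeffElem_mul, ← laurentMonomial_add]; simp
  inv_val := by rw [← map_mul, ← coeffElem_mul, ← laurentMonomial_add]; simp

lemma eval_eq_zero (ε : D.Augmentation A) {g : D.Gen} (hg : D.degree g ≠ 0) : ε.eval g = 0 :=
  ε.map_of_degree_ne_zero _ _ hg (isHomogeneous_gen g)

lemma map_genDifferential (ε : D.Augmentation A) (g : D.Gen) :
    ε.toRingHom (D.genDifferential g) = 0 := by
  rw [← differential_gen, ε.map_differential]

/-- Ring homomorphisms on the Laurent polynomials are determined by the marked points. -/
lemma map_coeffElem_congr {f f' : D.Alg →+* A}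
    (h : ∀ i, f (D.coeffElem (laurentMonomial i 1)) = f' (D.coeffElem (laurentMonomial i 1)))
    (r : LaurentRing T) : f (D.coeffElem r) = f' (D.coeffElem r) := by
  let ι : LaurentRing T →+* D.Alg := MonoidAlgebra.singleOneRingHom
  have hmono : ∀ i, ∀ e : ℤ, f (D.coeffElem (laurentMonomial i e)) =
      f' (D.coeffElem (laurentMonomial i e)) := by
    intro i e
    let u : (D.Alg)ˣ := ⟨D.coeffElem (laurentMonomial i 1), D.coeffElem (laurentMonomial i (-1)),
      by rw [← coeffElem_mul, ← laurentMonomial_add]; simp,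
      by rw [← coeffElem_mul, ← laurentMonomial_add]; simp⟩
    have hu : ∀ e : ℤ, ((u ^ e : (D.Alg)ˣ) : D.Alg) = D.coeffElem (laurentMonomial i e) := by
      intro e
      induction e using Int.induction_on with
      | zero => simp
      | succ k ih => rw [zpow_add_one, Units.val_mul, ih, laurentMonomial_add, coeffElem_mul]
      | pred k ih =>
        rw [zpow_sub_one, Units.val_mul, ih, sub_eq_add_neg, laurentMonomial_add, coeffElem_mul]
        rfl
    have h2 : Units.map (f : D.Alg →* A) u = Units.map (f' : D.Alg →* A) u := Units.ext (h i)
    have h3 : Units.map (f : D.Alg →* A) (u ^ e) = Units.map (f' : D.Alg →* A) (u ^ e) := by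
      rw [map_zpow, map_zpow, h2]
    rw [← hu]
    exact congrArg Units.val h3
  have hexp : ∀ e : T →₀ ℤ, f (ι (AddMonoidAlgebra.single e 1)) =
      f' (ι (AddMonoidAlgebra.single e 1)) := by
    intro e
    induction e using Finsupp.induction_linear with
    | zero => rw [← AddMonoidAlgebra.one_def, map_one, map_one, map_one]
    | add a b ha hb =>
      have : (AddMonoidAlgebra.single (a + b) 1 : LaurentRing T) =
          AddMonoidAlgebra.single a 1 * AddMonoidAlgebra.single b 1 := by
        simp [AddMonoidAlgebra.single_mul_single]
      rw [this, map_mul, map_mul, map_mul, ha, hb]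
    | single i e => exact hmono i e
  have : f.comp ι = f'.comp ι := by
    refine AddMonoidAlgebra.ringHom_ext (fun n => ?_) fun e => hexp e
    have : (AddMonoidAlgebra.single 0 n : LaurentRing T) = ((n : ℤ) : LaurentRing T) := by
      rw [AddMonoidAlgebra.intCast_def]
      simp
    rw [this, map_intCast, map_intCast]
  exact RingHom.congr_fun this r

lemma ext_of_eval {ε ε' : D.Augmentation A} (h : ∀ g, ε.eval g = ε'.eval g)
    (h' : ∀ i, ε.mark i = ε'.mark i) : ε = ε' := by
  have : ε.toRingHom = ε'.toRingHom := by
    refine MonoidAlgebra.ringHom_ext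
      (map_coeffElem_congr fun i => congrArg Units.val (h' i)) fun w => ?_
    induction w using FreeMonoid.inductionOn' with
    | one => rw [← MonoidAlgebra.one_def, map_one, map_one]
    | of_mul g w ih =>
      have : (MonoidAlgebra.single (FreeMonoid.of g * w) 1 : D.Alg) =
          D.gen g * MonoidAlgebra.single w 1 := by
        rw [gen, word, MonoidAlgebra.single_mul_single, one_mul]
        rfl
      rw [this, map_mul, map_mul, ih]
      exact congrArg (· * _) (h g)
  cases ε
  cases ε'
  cases this
  rfl

end Augmentation

/-- The sign in the derivation rule is irrelevant, as `ε₁` vanishes in nonzero degree. -/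
lemma derivation_mul {ε₁ ε₂ : D.Augmentation A} {η : D.Alg →+ A}
    (h : ∀ (d : ℤ) (x y : D.Alg), D.IsHomogeneous d x →
      η (x * y) = η x * ε₂.toRingHom y + (d.negOnePow : ℤ) • (ε₁.toRingHom x * η y))
    (x y : D.Alg) : η (x * y) = η x * ε₂.toRingHom y + ε₁.toRingHom x * η y := by
  induction x using MonoidAlgebra.induction_linear with
  | zero => simp
  | add x x' hx hx' => rw [add_mul, map_add, hx, hx', map_add, map_add]; ring
  | single w r =>
    have hw := isHomogeneous_single (D := D) w r
    rw [h _ _ _ hw]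
    by_cases hd : D.wordDegree w.toList = 0
    · simp [hd]
    · rw [ε₁.map_of_degree_ne_zero _ _ hd hw]
      simp

namespace Augmentation

/-- The `(ε₁, ε₂)`-derivation with given values on the generators, on words. The rule
`η(x y) = η(x) ε₂(y) + ε₁(x) η(y)` has no sign. -/
def derivationWord (ε₁ ε₂ : D.Augmentation A) (a : D.Gen → A) : List D.Gen → A
  | [] => 0
  | g :: w => a g * ε₂.toRingHom (D.word w) + ε₁.eval g * derivationWord ε₁ ε₂ a w

/-- The `(ε₁, ε₂)`-derivation with given values on the generators, which vanishes on the
coefficients. -/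
def derivation (ε₁ ε₂ : D.Augmentation A) (a : D.Gen → A) : D.Alg →+ A :=
  MonoidAlgebra.liftNC
    (ε₁.toRingHom.toAddMonoidHom.comp (MonoidAlgebra.singleOneRingHom :
      LaurentRing T →+* D.Alg).toAddMonoidHom)
    fun w => derivationWord ε₁ ε₂ a w.toList

variable {ε₁ ε₂ : D.Augmentation A} {a : D.Gen → A}

lemma derivation_single (w : FreeMonoid D.Gen) (r : LaurentRing T) :
    derivation ε₁ ε₂ a (MonoidAlgebra.single w r) =
      ε₁.toRingHom (D.coeffElem r) * derivationWord ε₁ ε₂ a w.toList :=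
  MonoidAlgebra.liftNC_single _ _ _ _

lemma derivation_gen (g : D.Gen) : derivation ε₁ ε₂ a (D.gen g) = a g := by
  rw [gen, word, derivation_single]
  simp [derivationWord]

lemma derivationWord_append (w w' : List D.Gen) :
    derivationWord ε₁ ε₂ a (w ++ w') = derivationWord ε₁ ε₂ a w * ε₂.toRingHom (D.word w') +
      ε₁.toRingHom (D.word w) * derivationWord ε₁ ε₂ a w' := by
  induction w with
  | nil => simp [derivationWord]
  | cons g w ih =>
    have hw : D.word (w ++ w') = D.word w * D.word w' := by
      simp [word, MonoidAlgebra.single_mul_single]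
    rw [List.cons_append, derivationWord, derivationWord, ih, hw, word_cons, map_mul, map_mul]
    simp only [eval]
    ring

/-- The values on the coefficients have to agree, as coefficients commute with words. -/
lemma derivation_mul' (ht : ∀ i, ε₁.mark i = ε₂.mark i) (x y : D.Alg) :
    derivation ε₁ ε₂ a (x * y) =
      derivation ε₁ ε₂ a x * ε₂.toRingHom y + ε₁.toRingHom x * derivation ε₁ ε₂ a y := by
  induction x using MonoidAlgebra.induction_linear with
  | zero => simp
  | add x x' hx hx' => rw [add_mul, map_add, hx, hx', map_add, map_add]; ring
  | single w r =>
    induction y using MonoidAlgebra.induction_linear with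
    | zero => simp
    | add y y' hy hy' => rw [mul_add, map_add, hy, hy', map_add, map_add]; ring
    | single w' r' =>
      rw [MonoidAlgebra.single_mul_single, derivation_single, derivation_single,
        derivation_single, FreeMonoid.toList_mul, derivationWord_append, coeffElem_mul,
        single_eq_coeffElem_mul_word, single_eq_coeffElem_mul_word, map_mul, map_mul, map_mul,
        ← map_coeffElem_congr (fun i => congrArg Units.val (ht i)) r']
      ring

/-- A word on which the derivation does not vanish contains one generator of degree `-1` and
otherwise generators of degree zero. -/
lemma derivation_eq_zero (ha : ∀ g, D.degree g ≠ -1 → a g = 0) (d : ℤ) (x : D.Alg)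
    (hd : d + 1 ≠ 0) (hx : D.IsHomogeneous d x) : derivation ε₁ ε₂ a x = 0 := by
  refine addMonoidHom_eq_zero_of_isHomogeneous _ (fun w r hw => ?_) hx
  have key : ∀ w : List D.Gen, D.wordDegree w ≠ -1 → derivationWord ε₁ ε₂ a w = 0 := by
    intro w
    induction w with
    | nil => intro _; rfl
    | cons g w ih =>
      intro hw
      rw [wordDegree_cons] at hw
      rw [derivationWord]
      by_cases h1 : D.degree g = -1
      · rw [ε₁.eval_eq_zero (by omega), map_word_eq_zero _ (fun g hg => ε₂.eval_eq_zero hg) w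
          (by omega)]
        simp
      · rw [ha g h1, zero_mul, zero_add]
        by_cases h2 : D.degree g = 0
        · rw [ih (by omega), mul_zero]
        · rw [ε₁.eval_eq_zero h2, zero_mul]
  rw [derivation_single, key _ (by omega), mul_zero]

/-- An additive map is an `(ε₁, ε₂)`-derivation of degree one. The usual sign is left out: it only
matters in degrees in which `ε₁` vanishes. -/
structure IsDerivation (ε₁ ε₂ : D.Augmentation A) (η : D.Alg →+ A) : Prop where
  eq_zero : ∀ (d : ℤ) (x : D.Alg), d + 1 ≠ 0 → D.IsHomogeneous d x → η x = 0
  map_mul : ∀ x y, η (x * y) = η x * ε₂.toRingHom y + ε₁.toRingHom x * η y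

lemma isDerivation_derivation (ht : ∀ i, ε₁.mark i = ε₂.mark i)
    (ha : ∀ g, D.degree g ≠ -1 → a g = 0) : IsDerivation ε₁ ε₂ (derivation ε₁ ε₂ a) :=
  ⟨derivation_eq_zero ha, derivation_mul' ht⟩

/-- A homotopy is a derivation `η` with `ε₁ - ε₂ = η ∘ ∂` on generators. On the marked points this
equation says that `ε₁` and `ε₂` agree, because their differentials vanish. -/
lemma homotopic_iff : ε₁.Homotopic ε₂ ↔ (∀ i, ε₁.mark i = ε₂.mark i) ∧
    ∃ η, IsDerivation ε₁ ε₂ η ∧ ∀ g, ε₁.eval g - ε₂.eval g = η (D.genDifferential g) := by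
  constructor
  · rintro ⟨η, h1, h2, h3⟩
    refine ⟨fun i => Units.ext ?_, η, ⟨h1, derivation_mul h3⟩, fun g => ?_⟩
    · have := h2 (D.coeffElem (laurentMonomial i 1))
      rwa [differential_coeffElem, map_zero, sub_eq_zero] at this
    · rw [← differential_gen, ← h2]
      rfl
  rintro ⟨ht, η, hη, h⟩
  have hcoeff := map_coeffElem_congr (f := ε₁.toRingHom) (f' := ε₂.toRingHom)
    (fun i => congrArg Units.val (ht i))
  refine ⟨η, hη.eq_zero, fun x => ?_, fun d x y hx => ?_⟩
  · have key : ∀ w : List D.Gen, ε₁.toRingHom (D.word w) - ε₂.toRingHom (D.word w) =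
        η (D.wordDifferential w) := by
      intro w
      induction w with
      | nil => simp [wordDifferential]
      | cons g w ih =>
        have h0 : ε₁.toRingHom (D.wordDifferential w) = 0 ∧
            ε₂.toRingHom (D.wordDifferential w) = 0 := by
          have := differential_single (D := D) (FreeMonoid.ofList w) 1
          rw [coeffElem_one, one_mul] at this
          change _ = D.wordDifferential w at this
          rw [← this]
          exact ⟨ε₁.map_differential _, ε₂.map_differential _⟩
        rw [wordDifferential, map_add, map_zsmul, hη.map_mul, hη.map_mul,
          ← h g, ε₁.map_genDifferential, h0.2, ← ih, word_cons, map_mul, map_mul]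
        change ε₁.eval g * _ - ε₂.eval g * _ = _
        change _ = _ + _ • (_ + ε₁.eval g * _)
        by_cases hg : D.degree g = 0
        · rw [hg]
          simp
          ring
        · rw [ε₁.eval_eq_zero hg]
          simp
    induction x using MonoidAlgebra.induction_linear with
    | zero => simp [differential_zero]
    | add x y hx hy => rw [differential_add, map_add, map_add, map_add, ← hx, ← hy]; ring
    | single w r =>
      rw [differential_single, hη.map_mul, hη.eq_zero 0 _ (by omega) (isHomogeneous_coeffElem r),
        zero_mul, zero_add, ← key, single_eq_coeffElem_mul_word, map_mul, map_mul, ← hcoeff]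
      ring
  · rw [hη.map_mul]
    by_cases hd : d = 0
    · simp [hd]
    · rw [ε₁.map_of_degree_ne_zero _ _ hd hx]
      simp

end Augmentation

end Augmentation

end PlatFront

namespace PlatFront

variable {C T : Type} {D : PlatFront C T}

/-! ### Disk counts of plat fronts -/

/-- The Maslov potential to the right of a list of events, which is given from right to left. -/
def potential : List (FrontEvent C T) → ℕ → ℤ
  | [] => initialPotential
  | .marked _ _ :: l => potential l
  | .crossing k _ :: l => fun p => potential l (Equiv.swap k (k + 1) p)

/-- Every crossing `c` in a list of events, given from right to left, satisfies `Q l k c`, where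
`l` lists the events to the left of `c` and `k` is the height of `c`. -/
def CrossingsSatisfy (Q : List (FrontEvent C T) → ℕ → C → Prop) : List (FrontEvent C T) → Prop
  | [] => True
  | .marked _ _ :: l => CrossingsSatisfy Q l
  | .crossing k c :: l => Q l k c ∧ CrossingsSatisfy Q l

lemma CrossingsSatisfy.of_append {Q : List (FrontEvent C T) → ℕ → C → Prop}
    {l l' : List (FrontEvent C T)} (h : CrossingsSatisfy Q (l ++ l')) : CrossingsSatisfy Q l' := by
  induction l with
  | nil => exact h
  | cons e l ih =>
    cases e with
    | marked p t => exact ih h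
    | crossing k c => exact ih h.2

lemma crossingsSatisfy_of_forall {Q : List (FrontEvent C T) → ℕ → C → Prop}
    {l : List (FrontEvent C T)} (h : ∀ l₁ k c l₂, l = l₁ ++ .crossing k c :: l₂ → Q l₂ k c) :
    CrossingsSatisfy Q l := by
  induction l with
  | nil => trivial
  | cons e l ih =>
    have h' := ih fun l₁ k c l₂ hl => h (e :: l₁) k c l₂ (by rw [hl]; rfl)
    cases e with
    | marked p t => exact h'
    | crossing k c => exact ⟨h [] k c l rfl, h'⟩

/-- The name of the crossing at an event, if it is one. -/
def crossingName : FrontEvent C T → Option C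
  | .marked _ _ => none
  | .crossing _ c => some c

lemma crossingDegree_append {l' l₂ : List (FrontEvent C T)} (l : List (FrontEvent C T)) (k : ℕ)
    {c : C} (hc : c ∉ l'.filterMap crossingName) :
    crossingDegree (l' ++ .crossing k c :: l₂) (potential l) c =
      potential (l'.reverse ++ l) (k + 1) - potential (l'.reverse ++ l) k := by
  induction l' generalizing l with
  | nil => simp [crossingDegree]
  | cons e l' ih =>
    cases e with
    | marked p t =>
      simpa [crossingDegree, potential] using ih (.marked p t :: l) (by simpa [crossingName] using hc)
    | crossing k' c' =>
      simp only [List.filterMap_cons, crossingName, List.mem_cons, not_or] at hc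
      simpa [crossingDegree, potential, hc.1] using ih (.crossing k' c' :: l) hc.2

lemma crossingDifferential_append {l' l₂ : List (FrontEvent C T)} (l : List (FrontEvent C T))
    (k : ℕ) {c : C} (hc : c ∉ l'.filterMap crossingName) :
    D.crossingDifferential l (l' ++ .crossing k c :: l₂) c =
      D.diskCount (l'.reverse ++ l) k (k + 1) := by
  induction l' generalizing l with
  | nil => simp [crossingDifferential]
  | cons e l' ih =>
    cases e with
    | marked p t =>
      simpa [crossingDifferential] using ih (.marked p t :: l) (by simpa [crossingName] using hc)
    | crossing k' c' =>
      simp only [List.filterMap_cons, crossingName, List.mem_cons, not_or] at hc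
      simpa [crossingDifferential, hc.1] using ih (.crossing k' c' :: l) hc.2

/-- At every crossing in the list, the degree and the differential of the crossing are given by the
potential and the disk count there. -/
def Sound (D : PlatFront C T) (l : List (FrontEvent C T)) : Prop :=
  CrossingsSatisfy (fun l k c => D.degree (.inl c) = potential l (k + 1) - potential l k ∧
    D.genDifferential (.inl c) = D.diskCount l k (k + 1)) l

lemma sound_reverse_events (h : (D.events.filterMap crossingName).Nodup) :
    D.Sound D.events.reverse := by
  refine crossingsSatisfy_of_forall fun l₁ k c l₂ hl => ?_
  have he : D.events = l₂.reverse ++ .crossing k c :: l₁.reverse := by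
    rw [← List.reverse_reverse D.events, hl]
    simp
  have hc : c ∉ l₂.reverse.filterMap crossingName := by
    intro hc
    rw [he, List.filterMap_append, List.nodup_append] at h
    exact h.2.2 c hc c (by simp [crossingName]) rfl
  constructor
  · rw [degree, he]
    have := crossingDegree_append (l₂ := l₁.reverse) [] k hc
    rwa [List.reverse_reverse, List.append_nil] at this
  · rw [genDifferential, he]
    simpa using crossingDifferential_append (D := D) [] k hc

/-! The recursion for disk counts at a crossing, case by case. -/

section Recursion

variable {l : List (FrontEvent C T)} {k : ℕ} {c : C} {i j : ℕ}

lemma diskCount_crossing_same : D.diskCount (.crossing k c :: l) k (k + 1) = 0 := by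
  simp [diskCount]

lemma diskCount_crossing_of_ne (h1 : i ≠ k) (h2 : i ≠ k + 1) (h3 : j ≠ k) (h4 : j ≠ k + 1) :
    D.diskCount (.crossing k c :: l) i j = D.diskCount l i j := by
  simp [diskCount, h1, h2, h3, h4]

lemma diskCount_crossing_lower_top :
    D.diskCount (.crossing k c :: l) (k + 1) j =
      D.diskCount l k j + D.diskCount l (k + 1) j * D.gen (.inl c) := by
  simp [diskCount]

lemma diskCount_crossing_lower_bottom (h : j ≠ k + 1) :
    D.diskCount (.crossing k c :: l) k j = D.diskCount l (k + 1) j := by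
  simp [diskCount, h]

lemma diskCount_crossing_upper_bottom (h1 : i ≠ k) (h2 : i ≠ k + 1) :
    D.diskCount (.crossing k c :: l) i k =
      D.diskCount l i (k + 1) + D.bottomSign c • (D.gen (.inl c) * D.diskCount l i k) := by
  simp [diskCount, h1, h2]

lemma diskCount_crossing_upper_top (h1 : i ≠ k) (h2 : i ≠ k + 1) :
    D.diskCount (.crossing k c :: l) i (k + 1) = D.diskCount l i k := by
  simp [diskCount, h1, h2]

end Recursion

lemma IsHomogeneous.bottomSign_smul {d : ℤ} {x : D.Alg} (hx : D.IsHomogeneous d x) (c : C) :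
    D.IsHomogeneous d (D.bottomSign c • x) := by
  rw [bottomSign]
  split_ifs
  · rw [neg_one_zsmul]
    exact hx.neg
  · rwa [one_zsmul]

/-- The disks which end in the segment from `i` to `j` have degree `μ(j) - μ(i) - 1`. -/
lemma isHomogeneous_diskCount {l : List (FrontEvent C T)} (hl : D.Sound l) {i j : ℕ}
    (hij : i < j) :
    D.IsHomogeneous (potential l j - potential l i - 1) (D.diskCount l i j) := by
  induction l generalizing i j with
  | nil =>
    rw [diskCount]
    split_ifs with h
    · obtain ⟨h, rfl⟩ := h
      have h' : ¬ Even (i + 1) := by simpa [Nat.even_add_one] using h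
      simp only [potential, initialPotential, h, h', if_true, if_false]
      exact isHomogeneous_coeffElem 1
    · exact isHomogeneous_zero _
  | cons e l ih =>
    cases e with
    | marked p t =>
      have ih := ih hl hij
      rw [diskCount]
      simp only [potential]
      split_ifs
      · simpa using (isHomogeneous_coeffElem _).mul ih
      · simpa using (isHomogeneous_coeffElem _).mul ih
      · exact ih
    | crossing k c =>
      have hdeg := hl.1.1
      replace ih : ∀ {i j : ℕ}, i < j → _ := fun {i j} => ih hl.2 (i := i) (j := j)
      have hgen := isHomogeneous_gen (D := D) (.inl c)
      rw [hdeg] at hgen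
      have hp : potential (.crossing k c :: l) = fun p => potential l (Equiv.swap k (k + 1) p) := rfl
      rw [hp]
      by_cases h1 : i = k + 1
      · subst h1
        simp only [Equiv.swap_apply_right, Equiv.swap_apply_of_ne_of_ne (show j ≠ k by omega)
          (show j ≠ k + 1 by omega), diskCount_crossing_lower_top]
        refine (ih (by omega)).add ?_
        convert! (ih (i := k + 1) (j := j) (by omega)).mul hgen using 1
        ring
      by_cases h2 : i = k
      · subst h2
        by_cases h3 : j = i + 1
        · subst h3
          rw [diskCount_crossing_same]
          exact isHomogeneous_zero _
        · simp only [Equiv.swap_apply_left, Equiv.swap_apply_of_ne_of_ne (show j ≠ i by omega) h3,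
            diskCount_crossing_lower_bottom h3]
          exact ih (by omega)
      simp only [Equiv.swap_apply_of_ne_of_ne h2 h1]
      by_cases h3 : j = k
      · subst h3
        simp only [Equiv.swap_apply_left, diskCount_crossing_upper_bottom h2 h1]
        refine (ih (by omega)).add (IsHomogeneous.bottomSign_smul ?_ c)
        convert! hgen.mul (ih (i := i) (j := j) (by omega)) using 1
        ring
      by_cases h4 : j = k + 1
      · subst h4
        simp only [Equiv.swap_apply_right, diskCount_crossing_upper_top h2 h1]
        exact ih (by omega)
      simp only [Equiv.swap_apply_of_ne_of_ne h3 h4, diskCount_crossing_of_ne h2 h1 h3 h4]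
      exact ih hij

lemma isHomogeneous_crossingDifferential {l l' : List (FrontEvent C T)}
    (hl : D.Sound (l'.reverse ++ l)) (c : C) :
    D.IsHomogeneous (D.degree (.inl c) - 1) (D.crossingDifferential l l' c) := by
  induction l' generalizing l with
  | nil => exact isHomogeneous_zero _
  | cons e l' ih =>
    rw [List.reverse_cons, List.append_assoc, List.singleton_append] at hl
    cases e with
    | marked p t => exact ih hl
    | crossing k c' =>
      rw [crossingDifferential]
      split_ifs with h
      · subst h
        have := CrossingsSatisfy.of_append hl
        rw [this.1.1]
        exact isHomogeneous_diskCount this.2 (by omega)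
      · exact ih hl

end PlatFront

open Matrix PlatFront

/-! ### The crossings outside the braid -/

section CuspEvents

variable {X : Type} {n : ℕ}

/-- The list of the `E j i` in the order of `leftCrossings`. -/
def cuspEvents (E : ∀ j : Fin n, Fin (j : ℕ) → X) : List X :=
  (List.finRange n).flatMap fun j : Fin n => (List.finRange (j : ℕ)).reverse.map (E j)

/-- Induction along `cuspEvents`, the list being read from left to right and stored from right to
left. In the state `(m, q)` the cusps below `m` have been treated completely, and the cusp `m` has
crossed the cusps `m - 1, …, q`. -/
lemma cuspEvents_reverse_induction {E : ∀ j : Fin n, Fin (j : ℕ) → X} {I : ℕ → ℕ → List X → Prop}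
    {l₀ : List X} (h₀ : I 0 0 l₀) (hshift : ∀ m l, m < n → I m 0 l → I (m + 1) (m + 1) l)
    (hstep : ∀ (j : Fin n) (i : Fin (j : ℕ)) l, I j (i + 1) l → I j i (E j i :: l)) :
    I n n ((cuspEvents E).reverse ++ l₀) := by
  have inner : ∀ (j : Fin n) (l : List X), I j j l → ∀ q, q ≤ (j : ℕ) →
      I j (j - q) (((List.finRange (j : ℕ)).drop (j - q)).map (E j) ++ l) := by
    intro j l hl q
    induction q with
    | zero => intro _; rw [Nat.sub_zero, List.drop_eq_nil_of_le (by simp)]; exact hl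
    | succ q ih =>
      intro hq
      have hlt : (j : ℕ) - (q + 1) < (List.finRange (j : ℕ)).length := by simp; omega
      rw [List.drop_eq_getElem_cons hlt, List.map_cons, List.cons_append, List.getElem_finRange]
      have := hstep j (Fin.cast (List.length_finRange) ⟨(j : ℕ) - (q + 1), hlt⟩)
        (((List.finRange (j : ℕ)).drop (j - q)).map (E j) ++ l)
      simp only [Fin.cast_mk, show (j : ℕ) - (q + 1) + 1 = j - q by omega] at this ⊢
      exact this (ih (by omega))
  have outer : ∀ m, m ≤ n → I m m ((((List.finRange n).take m).flatMap fun j : Fin n =>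
      (List.finRange (j : ℕ)).reverse.map (E j)).reverse ++ l₀) := by
    intro m
    induction m with
    | zero => intro _; exact h₀
    | succ m ih =>
      intro hm
      rw [List.take_add_one, List.getElem?_eq_getElem (by simpa using hm)]
      simp only [Option.toList_some, List.flatMap_append, List.flatMap_cons, List.flatMap_nil,
        List.append_nil, List.getElem_finRange, List.reverse_append, List.append_assoc,
        ← List.map_reverse, List.reverse_reverse]
      have := inner ⟨m, hm⟩ _ (ih (by omega)) m le_rfl
      rw [Nat.sub_self, List.drop_zero] at this
      exact hshift m _ hm this
  have := outer n le_rfl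
  rwa [List.take_of_length_le (by simp)] at this

/-- Induction along the mirror image of `cuspEvents`. -/
lemma cuspEvents_induction {E : ∀ j : Fin n, Fin (j : ℕ) → X} {I : ℕ → ℕ → List X → Prop}
    {l₀ : List X} (h₀ : I n n l₀) (hshift : ∀ m l, m < n → I (m + 1) (m + 1) l → I m 0 l)
    (hstep : ∀ (j : Fin n) (i : Fin (j : ℕ)) l, I j i l → I j (i + 1) (E j i :: l)) :
    I 0 0 (cuspEvents E ++ l₀) := by
  have inner : ∀ (j : Fin n) (l : List X), I j 0 l → ∀ q, q ≤ (j : ℕ) →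
      I j q (((List.finRange (j : ℕ)).take q).reverse.map (E j) ++ l) := by
    intro j l hl q
    induction q with
    | zero => intro _; exact hl
    | succ q ih =>
      intro hq
      rw [List.take_add_one, List.getElem?_eq_getElem (by simpa using hq)]
      simp only [Option.toList_some, List.reverse_append, List.reverse_cons, List.reverse_nil,
        List.nil_append, List.map_cons, List.cons_append,
        List.getElem_finRange]
      exact hstep j ⟨q, hq⟩ _ (ih (by omega))
  have outer : ∀ m, m ≤ n → I (n - m) (n - m) ((((List.finRange n).drop (n - m)).flatMap
      fun j : Fin n => (List.finRange (j : ℕ)).reverse.map (E j)) ++ l₀) := by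
    intro m
    induction m with
    | zero => intro _; rw [Nat.sub_zero, List.drop_eq_nil_of_le (by simp)]; exact h₀
    | succ m ih =>
      intro hm
      have hlt : n - (m + 1) < (List.finRange n).length := by simp; omega
      rw [List.drop_eq_getElem_cons hlt, List.flatMap_cons, List.append_assoc,
        List.getElem_finRange]
      have h1 := ih (by omega)
      rw [show n - m = n - (m + 1) + 1 by omega] at h1
      have h2 := inner ⟨n - (m + 1), by omega⟩ _ (hshift _ _ (by omega) h1) _ le_rfl
      rwa [List.take_of_length_le (by simp)] at h2
  have := outer n le_rfl
  rwa [Nat.sub_self, List.drop_zero] at this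

end CuspEvents

/-- The height of the lower strand of the cusp `a` in the state `(m, q)`, in which the cusps below
`m` and the cusps `q, …, m - 1` with the cusp `m` have been crossed. -/
def lowerHeight (m q a : ℕ) : ℕ := if a < m then a else if a = m then m + q else 2 * a

/-- The height of the upper strand of the cusp `a` in the state `(m, q)`. -/
def upperHeight (m q a : ℕ) : ℕ :=
  if a < m then (if a < q then m + a else m + a + 1) else 2 * a + 1

lemma lowerHeight_shift (m a : ℕ) : lowerHeight (m + 1) (m + 1) a = lowerHeight m 0 a := by
  simp only [lowerHeight]; split_ifs <;> omega

lemma upperHeight_shift (m a : ℕ) : upperHeight (m + 1) (m + 1) a = upperHeight m 0 a := by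
  simp only [upperHeight]; split_ifs <;> omega

lemma lowerHeight_zero (a : ℕ) : lowerHeight 0 0 a = 2 * a := by
  simp only [lowerHeight]; split_ifs <;> omega

lemma upperHeight_zero (a : ℕ) : upperHeight 0 0 a = 2 * a + 1 := by
  simp [upperHeight]

lemma lowerHeight_full {n a : ℕ} (h : a < n) : lowerHeight n n a = a := by simp [lowerHeight, h]

lemma upperHeight_full {n a : ℕ} (h : a < n) : upperHeight n n a = n + a := by
  simp [upperHeight, h]

lemma lowerHeight_self (m q : ℕ) : lowerHeight m q m = m + q := by simp [lowerHeight]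

lemma upperHeight_same {m q : ℕ} (h : q < m) : upperHeight m q q = m + q + 1 := by
  simp [upperHeight, h]

lemma upperHeight_succ_same {m q : ℕ} (h : q < m) : upperHeight m (q + 1) q = m + q := by
  simp [upperHeight, h]

lemma lowerHeight_of_ne {m q a : ℕ} (h : q < m) (ha : a ≠ m) :
    lowerHeight m (q + 1) a = lowerHeight m q a ∧ lowerHeight m q a ≠ m + q ∧
      lowerHeight m q a ≠ m + q + 1 := by
  simp only [lowerHeight]; split_ifs <;> omega

lemma upperHeight_of_ne {m q a : ℕ} (h : q < m) (ha : a ≠ q) :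
    upperHeight m (q + 1) a = upperHeight m q a ∧ upperHeight m q a ≠ m + q ∧
      upperHeight m q a ≠ m + q + 1 := by
  simp only [upperHeight]; split_ifs <;> omega

section Potential

variable {C T : Type}

/-- In the state `(m, q)`, the lower strands have potential zero and the upper ones have potential
one. -/
def PotentialState (m q : ℕ) (l : List (FrontEvent C T)) : Prop :=
  ∀ a, potential l (lowerHeight m q a) = 0 ∧ potential l (upperHeight m q a) = 1

lemma potentialState_nil : PotentialState 0 0 ([] : List (FrontEvent C T)) := by
  intro a
  simp [lowerHeight_zero, upperHeight_zero, potential, initialPotential]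

lemma potentialState_shift {m : ℕ} {l : List (FrontEvent C T)} :
    PotentialState (m + 1) (m + 1) l ↔ PotentialState m 0 l := by
  simp only [PotentialState, lowerHeight_shift, upperHeight_shift]

lemma swap_lowerHeight {m q : ℕ} (h : q < m) (a : ℕ) :
    Equiv.swap (m + q) (m + q + 1) (lowerHeight m q a) = lowerHeight m (q + 1) a := by
  by_cases ha : a = m
  · subst ha
    rw [lowerHeight_self, lowerHeight_self, Equiv.swap_apply_left]
    omega
  · obtain ⟨h1, h2, h3⟩ := lowerHeight_of_ne h ha
    rw [h1, Equiv.swap_apply_of_ne_of_ne h2 h3]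

lemma swap_upperHeight {m q : ℕ} (h : q < m) (a : ℕ) :
    Equiv.swap (m + q) (m + q + 1) (upperHeight m q a) = upperHeight m (q + 1) a := by
  by_cases ha : a = q
  · subst ha
    rw [upperHeight_same h, upperHeight_succ_same h, Equiv.swap_apply_right]
  · obtain ⟨h1, h2, h3⟩ := upperHeight_of_ne h ha
    rw [h1, Equiv.swap_apply_of_ne_of_ne h2 h3]

lemma PotentialState.step {m q : ℕ} (h : q < m) {l : List (FrontEvent C T)} {c : C}
    (hl : PotentialState m (q + 1) l) : PotentialState m q (.crossing (m + q) c :: l) := by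
  intro a
  simp only [potential]
  rw [swap_lowerHeight h, swap_upperHeight h]
  exact hl a

/-- To the right of the braid, the same crossings are passed in the opposite direction. -/
lemma PotentialState.step' {m q : ℕ} (h : q < m) {l : List (FrontEvent C T)} {c : C}
    (hl : PotentialState m q l) : PotentialState m (q + 1) (.crossing (m + q) c :: l) := by
  intro a
  simp only [potential]
  rw [← swap_lowerHeight h, ← swap_upperHeight h, Equiv.swap_apply_self, Equiv.swap_apply_self]
  exact hl a

lemma PotentialState.at_crossing {m q : ℕ} (h : q < m) {l : List (FrontEvent C T)}
    (hl : PotentialState m (q + 1) l) : potential l (m + q + 1) - potential l (m + q) = -1 := by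
  have h1 := (hl m).1
  have h2 := (hl q).2
  rw [lowerHeight_self] at h1
  rw [upperHeight_succ_same h] at h2
  rw [h2, show m + q + 1 = m + (q + 1) by omega, h1]
  rfl

lemma PotentialState.at_crossing' {m q : ℕ} (h : q < m) {l : List (FrontEvent C T)}
    (hl : PotentialState m q l) : potential l (m + q + 1) - potential l (m + q) = 1 := by
  have h1 := (hl m).1
  have h2 := (hl q).2
  rw [lowerHeight_self] at h1
  rw [upperHeight_same h] at h2
  rw [h2, h1]
  rfl

end Potential

section Disks

variable {n r : ℕ} {D : PlatFront (ClosureCrossing n r) (Fin n)} {A : Type} [CommRing A]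

/-- In the state `(m, q)`, the disks whose lower boundary is on the lower strand of the cusp `a` and
whose upper boundary is on the upper strand of the cusp `b` are counted by `V a b`. -/
def DiskState (f : D.Alg →+* A) (V : Matrix (Fin n) (Fin n) A) (m q : ℕ)
    (l : List (FrontEvent (ClosureCrossing n r) (Fin n))) : Prop :=
  ∀ a b : Fin n, lowerHeight m q a < upperHeight m q b →
    f (D.diskCount l (lowerHeight m q a) (upperHeight m q b)) = V a b

lemma diskState_shift {f : D.Alg →+* A} {V : Matrix (Fin n) (Fin n) A} {m : ℕ}
    {l : List (FrontEvent (ClosureCrossing n r) (Fin n))} :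
    DiskState f V (m + 1) (m + 1) l ↔ DiskState f V m 0 l := by
  simp only [DiskState, lowerHeight_shift, upperHeight_shift]

lemma diskState_nil (f : D.Alg →+* A) : DiskState f 1 0 0 [] := by
  intro a b _
  rw [lowerHeight_zero, upperHeight_zero, diskCount, Matrix.one_apply]
  by_cases h : a = b
  · subst h
    simp
  · have : (b : ℕ) ≠ a := fun h' => h (Fin.ext h'.symm)
    rw [if_neg (by omega), if_neg h, map_zero]

/-- To the left of the braid, these disks have no corners. To the right of a crossing, their lower
boundary is the lower one of the two crossing strands, or their upper boundary is the upper one, and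
the boundary goes straight through the crossing. -/
lemma DiskState.step {f : D.Alg →+* A} (j : Fin n) (i : Fin (j : ℕ))
    {l : List (FrontEvent (ClosureCrossing n r) (Fin n))} {c : ClosureCrossing n r}
    (hl : DiskState f 1 j (i + 1) l) : DiskState f 1 j i (.crossing (j + i) c :: l) := by
  intro a b hab
  have hlt := i.2
  have hL := hl a b
  by_cases ha : (a : ℕ) = j
  · have hL1 := lowerHeight_self j (i + 1)
    rw [ha, lowerHeight_self] at hab ⊢
    rw [ha, hL1] at hL
    by_cases hb : (b : ℕ) = i
    · rw [hb, upperHeight_same hlt, diskCount_crossing_same, map_zero, Matrix.one_apply_ne]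
      intro h
      have := congrArg Fin.val h
      omega
    · obtain ⟨h1, h2, h3⟩ := upperHeight_of_ne hlt hb
      rw [h1] at hL
      rw [diskCount_crossing_lower_bottom h3]
      exact hL (by omega)
  · obtain ⟨g1, g2, g3⟩ := lowerHeight_of_ne hlt ha
    rw [g1] at hL
    by_cases hb : (b : ℕ) = i
    · rw [hb, upperHeight_succ_same hlt] at hL
      rw [hb, upperHeight_same hlt] at hab ⊢
      rw [diskCount_crossing_upper_top g2 g3]
      exact hL (by omega)
    · obtain ⟨h1, h2, h3⟩ := upperHeight_of_ne hlt hb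
      rw [h1] at hL
      rw [diskCount_crossing_of_ne g2 g3 h2 h3]
      exact hL hab

/-- To the right of the braid, `f` kills the disks with a corner at a crossing. -/
lemma DiskState.step' {f : D.Alg →+* A} {V : Matrix (Fin n) (Fin n) A} (j : Fin n)
    (i : Fin (j : ℕ)) {l : List (FrontEvent (ClosureCrossing n r) (Fin n))}
    {c : ClosureCrossing n r} (hc : f (D.gen (.inl c)) = 0) (hl : DiskState f V j i l) :
    DiskState f V j (i + 1) (.crossing (j + i) c :: l) := by
  intro a b hab
  have hlt := i.2
  have hL := hl a b
  by_cases ha : (a : ℕ) = j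
  · have hL1 := lowerHeight_self j (i + 1)
    rw [ha, hL1] at hab ⊢
    rw [ha, lowerHeight_self] at hL
    by_cases hb : (b : ℕ) = i
    · rw [hb, upperHeight_succ_same hlt] at hab
      omega
    · obtain ⟨h1, h2, h3⟩ := upperHeight_of_ne hlt hb
      rw [h1] at hab ⊢
      rw [← add_assoc, diskCount_crossing_lower_top, map_add, map_mul, hc, mul_zero, add_zero]
      exact hL (by omega)
  · obtain ⟨g1, g2, g3⟩ := lowerHeight_of_ne hlt ha
    rw [g1] at hab ⊢
    by_cases hb : (b : ℕ) = i
    · rw [hb, upperHeight_same hlt] at hL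
      rw [hb, upperHeight_succ_same hlt] at hab ⊢
      rw [diskCount_crossing_upper_bottom g2 g3, map_add, map_zsmul, map_mul, hc, zero_mul,
        smul_zero, add_zero]
      exact hL (by omega)
    · obtain ⟨h1, h2, h3⟩ := upperHeight_of_ne hlt hb
      rw [h1] at hab ⊢
      rw [diskCount_crossing_of_ne g2 g3 h2 h3]
      exact hL hab

lemma leftCrossings_eq : leftCrossings n r = cuspEvents fun j i =>
    .crossing ((j : ℕ) + (i : ℕ)) (.left j i) := rfl

lemma rightCrossings_eq : rightCrossings n r = (cuspEvents fun j i =>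
    .crossing ((j : ℕ) + (i : ℕ)) (.right j i)).reverse := rfl

lemma potentialState_leftCrossings : PotentialState n n (leftCrossings n r).reverse := by
  rw [← List.append_nil (leftCrossings n r).reverse, leftCrossings_eq]
  exact cuspEvents_reverse_induction potentialState_nil
    (fun m l _ => potentialState_shift.2) fun j i l => PotentialState.step i.2

lemma diskState_leftCrossings (f : D.Alg →+* A) :
    DiskState f 1 n n (leftCrossings n r).reverse := by
  rw [← List.append_nil (leftCrossings n r).reverse, leftCrossings_eq]
  exact cuspEvents_reverse_induction (diskState_nil f)
    (fun m l _ => diskState_shift.2) fun j i l => DiskState.step j i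

/-- The crossings to the left of the braid have degree `-1`. -/
lemma degree_left (hs : D.Sound (leftCrossings n r).reverse) (j : Fin n) (i : Fin (j : ℕ)) :
    D.degree (.inl (.left j i)) = -1 := by
  have key := cuspEvents_reverse_induction (n := n)
    (E := fun j i => (.crossing ((j : ℕ) + (i : ℕ)) (.left j i) :
      FrontEvent (ClosureCrossing n r) (Fin n))) (l₀ := [])
    (I := fun m q l => PotentialState m q l ∧ (D.Sound l → ∀ (j : Fin n) (i : Fin (j : ℕ)),
      ((j : ℕ) < m ∨ (j : ℕ) = m ∧ q ≤ i) → D.degree (.inl (.left j i)) = -1))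
    ⟨potentialState_nil, fun _ j i h => by have := i.2; omega⟩
    (fun m l _ h => ⟨potentialState_shift.2 h.1, fun hl j i hji => h.2 hl j i
      (by have := i.2; omega)⟩)
    (fun j i l h => ⟨h.1.step i.2, fun hl j' i' hji => by
      by_cases hj : j' = j
      · subst hj
        by_cases hi : i' = i
        · subst hi
          rw [hl.1.1, h.1.at_crossing i'.2]
        · have : (i' : ℕ) ≠ i := fun h => hi (Fin.ext h)
          exact h.2 hl.2 j' i' (by omega)
      · have : (j' : ℕ) ≠ j := fun h => hj (Fin.ext h)
        exact h.2 hl.2 j' i' (by omega)⟩)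
  rw [← leftCrossings_eq, List.append_nil] at key
  exact key.2 hs j i (Or.inl j.2)

end Disks

/-! ### The braid in the bottom strands -/

section Braid

variable {n r : ℕ} {D : PlatFront (ClosureCrossing n r) (Fin n)} {A : Type} [CommRing A]
  {l : List (FrontEvent (ClosureCrossing n r) (Fin n))}

/-- The crossings of a braid word, with names for them. -/
def braidEvents (β : BraidWord n) (c : Fin β.length → ClosureCrossing n r) :
    List (FrontEvent (ClosureCrossing n r) (Fin n)) :=
  List.ofFn fun k => .crossing (β.get k) (c k)

lemma braidEvents_cons_reverse (i : Fin (n - 1)) (β : BraidWord n)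
    (c : Fin (i :: β).length → ClosureCrossing n r) :
    (braidEvents (i :: β) c).reverse ++ l =
      (braidEvents β fun k => c k.succ).reverse ++ (.crossing i (c ⟨0, by simp⟩) :: l) := by
  have : braidEvents (i :: β) c = .crossing i (c ⟨0, by simp⟩) :: braidEvents β fun k => c k.succ :=
    List.ofFn_succ
  rw [this, List.reverse_cons, List.append_assoc, List.singleton_append]

lemma PotentialState.crossing (i : Fin (n - 1)) (c : ClosureCrossing n r)
    (hl : PotentialState n n l) : PotentialState n n (.crossing i c :: l) := by
  have hlow : ∀ p < n, potential l p = 0 := fun p hp => by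
    have := (hl p).1
    rwa [lowerHeight_full hp] at this
  have hi := i.2
  intro a
  simp only [potential, Equiv.swap_apply_def]
  constructor
  · by_cases ha : a < n
    · rw [lowerHeight_full ha]
      split_ifs <;> exact hlow _ (by omega)
    · have : n ≤ lowerHeight n n a := by simp only [lowerHeight]; split_ifs <;> omega
      rw [if_neg (by omega), if_neg (by omega)]
      exact (hl a).1
  · have : n ≤ upperHeight n n a := by simp only [upperHeight]; split_ifs <;> omega
    rw [if_neg (by omega), if_neg (by omega)]
    exact (hl a).2

lemma PotentialState.braidEvents (hl : PotentialState n n l) (β : BraidWord n)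
    (c : Fin β.length → ClosureCrossing n r) :
    PotentialState n n ((braidEvents β c).reverse ++ l) := by
  induction β generalizing l with
  | nil => exact hl
  | cons i β ih =>
    rw [braidEvents_cons_reverse]
    exact ih (hl.crossing _ _) _

/-- The crossings of the braid have degree zero. -/
lemma degree_braidEvents (hl : PotentialState n n l) (β : BraidWord n)
    (c : Fin β.length → ClosureCrossing n r) (hs : D.Sound ((braidEvents β c).reverse ++ l))
    (k : Fin β.length) : D.degree (.inl (c k)) = 0 := by
  induction β generalizing l with
  | nil => exact k.elim0
  | cons i β ih =>
    rw [braidEvents_cons_reverse] at hs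
    refine Fin.cases ?_ (fun k => ih (hl.crossing _ _) (fun k => c k.succ) hs k) k
    have h1 := (CrossingsSatisfy.of_append hs).1.1
    have hi := i.2
    have h2 := (hl i).1
    have h3 := (hl (i + 1)).1
    rw [lowerHeight_full (by omega)] at h2 h3
    rw [h2, h3, sub_zero] at h1
    exact h1

lemma diskState_full {f : D.Alg →+* A} {V : Matrix (Fin n) (Fin n) A} :
    DiskState f V n n l ↔ ∀ a b : Fin n, f (D.diskCount l a (n + b)) = V a b := by
  simp only [DiskState, lowerHeight_full (Fin.is_lt _), upperHeight_full (Fin.is_lt _)]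
  exact forall_congr' fun a => forall_congr' fun b => ⟨fun h => h (by omega), fun h _ => h⟩

lemma braidMatrix_mul_apply_lower (i : Fin (n - 1)) (z : A) (V : Matrix (Fin n) (Fin n) A)
    (b : Fin n) : (braidMatrix A i z * V) (lowerStrand i) b = V (upperStrand i) b := by
  rw [braidMatrix_eq, Matrix.mul_assoc, permutationMatrix_mul_apply, simpleTransposition_inv,
    simpleTransposition_lower, transvection_mul_apply_of_ne _ _ _ _
      (lowerStrand_ne_upperStrand i).symm]

lemma braidMatrix_mul_apply_upper (i : Fin (n - 1)) (z : A) (V : Matrix (Fin n) (Fin n) A)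
    (b : Fin n) : (braidMatrix A i z * V) (upperStrand i) b =
      V (lowerStrand i) b + z * V (upperStrand i) b := by
  rw [braidMatrix_eq, Matrix.mul_assoc, permutationMatrix_mul_apply, simpleTransposition_inv,
    simpleTransposition_upper, transvection_mul_apply_same]

lemma braidMatrix_mul_apply_of_ne (i : Fin (n - 1)) (z : A) (V : Matrix (Fin n) (Fin n) A)
    {a : Fin n} (b : Fin n) (h : a ≠ lowerStrand i) (h' : a ≠ upperStrand i) :
    (braidMatrix A i z * V) a b = V a b := by
  rw [braidMatrix_eq, Matrix.mul_assoc, permutationMatrix_mul_apply, simpleTransposition_inv,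
    simpleTransposition_of_ne i h h', transvection_mul_apply_of_ne _ _ _ _ h]

lemma mul_braidMatrixInv_apply_lower (i : Fin (n - 1)) (z : A) (V : Matrix (Fin n) (Fin n) A)
    (a : Fin n) : (V * braidMatrixInv i z) a (lowerStrand i) =
      V a (upperStrand i) - z * V a (lowerStrand i) := by
  rw [braidMatrixInv, ← Matrix.mul_assoc, mul_permutationMatrix_apply,
    simpleTransposition_lower, mul_transvection_apply_same, neg_mul, sub_eq_add_neg]

lemma mul_braidMatrixInv_apply_upper (i : Fin (n - 1)) (z : A) (V : Matrix (Fin n) (Fin n) A)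
    (a : Fin n) : (V * braidMatrixInv i z) a (upperStrand i) = V a (lowerStrand i) := by
  rw [braidMatrixInv, ← Matrix.mul_assoc, mul_permutationMatrix_apply,
    simpleTransposition_upper, mul_transvection_apply_of_ne _ _ _ _ (lowerStrand_ne_upperStrand i)]

lemma mul_braidMatrixInv_apply_of_ne (i : Fin (n - 1)) (z : A) (V : Matrix (Fin n) (Fin n) A)
    (a : Fin n) {b : Fin n} (h : b ≠ lowerStrand i) (h' : b ≠ upperStrand i) :
    (V * braidMatrixInv i z) a b = V a b := by
  rw [braidMatrixInv, ← Matrix.mul_assoc, mul_permutationMatrix_apply,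
    simpleTransposition_of_ne i h h', mul_transvection_apply_of_ne _ _ _ _ h']

/-- A crossing of the braid acts on the bottom strands only, by a braid matrix. -/
lemma DiskState.crossing {f : D.Alg →+* A} {V : Matrix (Fin n) (Fin n) A} (i : Fin (n - 1))
    (c : ClosureCrossing n r) (hl : DiskState f V n n l) :
    DiskState f (braidMatrix A i (f (D.gen (.inl c))) * V) n n (.crossing i c :: l) := by
  rw [diskState_full] at hl ⊢
  have hi := i.2
  intro a b
  by_cases h1 : a = lowerStrand i
  · subst h1
    rw [braidMatrix_mul_apply_lower, ← hl]
    change f (D.diskCount (.crossing (i : ℕ) c :: l) i _) = f (D.diskCount l (i + 1) _)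
    rw [diskCount_crossing_lower_bottom (by omega)]
  by_cases h2 : a = upperStrand i
  · subst h2
    rw [braidMatrix_mul_apply_upper, ← hl, ← hl]
    change f (D.diskCount (.crossing (i : ℕ) c :: l) (i + 1) _) =
      f (D.diskCount l i _) + _ * f (D.diskCount l (i + 1) _)
    rw [diskCount_crossing_lower_top, map_add, map_mul, mul_comm]
  rw [braidMatrix_mul_apply_of_ne _ _ _ _ h1 h2, ← hl, diskCount_crossing_of_ne (k := (i : ℕ))
    (fun h => h1 (Fin.ext h)) (fun h => h2 (Fin.ext h)) (by omega) (by omega)]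

/-- A braid multiplies the matrix of disk counts by its braid matrix. -/
lemma DiskState.braidEvents {f : D.Alg →+* A} {V : Matrix (Fin n) (Fin n) A}
    (hl : DiskState f V n n l) (β : BraidWord n) (c : Fin β.length → ClosureCrossing n r) :
    DiskState f (braidWordMatrix A β (fun k => f (D.gen (.inl (c k)))) * V) n n
      ((braidEvents β c).reverse ++ l) := by
  induction β generalizing l V with
  | nil => simpa [braidWordMatrix, LegendrianBraid.braidEvents] using hl
  | cons i β ih =>
    rw [braidEvents_cons_reverse, braidWordMatrix, Matrix.mul_assoc]
    exact ih (hl.crossing i _) _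

/-- The marked points, from right to left. -/
def markEvents (n r : ℕ) : List (FrontEvent (ClosureCrossing n r) (Fin n)) :=
  (List.finRange n).reverse.map fun p : Fin n => .marked (p : ℕ) p

lemma strandMarks_reverse : (strandMarks n r).reverse = markEvents n r := by
  rw [strandMarks, markEvents, List.ofFn_eq_map, List.map_reverse]

lemma potential_marks (ps : List (Fin n)) :
    potential (ps.map (fun p : Fin n => (.marked (p : ℕ) p :
      FrontEvent (ClosureCrossing n r) (Fin n))) ++ l) = potential l := by
  induction ps with
  | nil => rfl
  | cons p ps ih => exact ih

lemma PotentialState.markEvents (hl : PotentialState n n l) :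
    PotentialState n n (markEvents n r ++ l) := by
  rw [PotentialState, LegendrianBraid.markEvents, potential_marks]
  exact hl

lemma diskCount_marks {f : D.Alg →+* A} {t : Fin n → Aˣ}
    (ht : ∀ p, f (D.coeffElem (laurentMonomial p 1)) = t p) {ps : List (Fin n)} (hps : ps.Nodup)
    (a b : Fin n) :
    f (D.diskCount (ps.map (fun p : Fin n => .marked (p : ℕ) p) ++ l) a (n + b)) =
      (if a ∈ ps then (t a : A) else 1) * f (D.diskCount l a (n + b)) := by
  induction ps with
  | nil => simp
  | cons p ps ih =>
    have ih := ih hps.of_cons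
    rw [List.map_cons, List.cons_append, diskCount]
    by_cases h : p = a
    · subst h
      rw [if_pos rfl, map_mul, ih, ht, if_neg (List.nodup_cons.1 hps).1, one_mul,
        if_pos List.mem_cons_self]
    · rw [if_neg (fun h' => h (Fin.ext h')), if_neg (by omega), ih]
      simp [Ne.symm h]

lemma DiskState.markEvents {f : D.Alg →+* A} {V : Matrix (Fin n) (Fin n) A} {t : Fin n → Aˣ}
    (ht : ∀ p, f (D.coeffElem (laurentMonomial p 1)) = t p) (hl : DiskState f V n n l) :
    DiskState f (diagonal (fun a => (t a : A)) * V) n n (markEvents n r ++ l) := by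
  rw [diskState_full] at hl ⊢
  intro a b
  rw [LegendrianBraid.markEvents, diskCount_marks ht (List.nodup_reverse.2 (List.nodup_finRange n)),
    Matrix.diagonal_mul, hl, if_pos (by simp)]

lemma right_potential (hl : PotentialState n n l) :
    PotentialState 0 0 ((rightCrossings n r).reverse ++ l) := by
  rw [rightCrossings_eq, List.reverse_reverse]
  exact cuspEvents_induction hl (fun m l _ => potentialState_shift.1)
    fun j i l => PotentialState.step' i.2

/-- The crossings to the right of the braid have degree `1`. -/
lemma degree_right (hl : PotentialState n n l)
    (hs : D.Sound ((rightCrossings n r).reverse ++ l)) (j : Fin n) (i : Fin (j : ℕ)) :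
    D.degree (.inl (.right j i)) = 1 := by
  rw [rightCrossings_eq, List.reverse_reverse] at hs
  refine (cuspEvents_induction (n := n)
    (I := fun m q l => PotentialState m q l ∧ (D.Sound l → ∀ (j : Fin n) (i : Fin (j : ℕ)),
      (m < j ∨ (j : ℕ) = m ∧ i < q) → D.degree (.inl (.right j i)) = 1))
    ⟨hl, fun _ j i h => by omega⟩
    (fun m l _ h => ⟨potentialState_shift.1 h.1, fun hl j i hji => h.2 hl j i
      (by have := i.2; omega)⟩)
    (fun j i l h => ⟨h.1.step' i.2, fun hl j' i' hji => by
      by_cases hj : j' = j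
      · subst hj
        by_cases hi : i' = i
        · subst hi
          rw [hl.1.1, h.1.at_crossing' i'.2]
        · have : (i' : ℕ) ≠ i := fun h => hi (Fin.ext h)
          exact h.2 hl.2 j' i' (by omega)
      · have : (j' : ℕ) ≠ j := fun h => hj (Fin.ext h)
        exact h.2 hl.2 j' i' (by omega)⟩)).2 hs j i ?_
  have := i.2
  omega

/-- The differentials of the crossings to the right of the braid are the entries of the matrix of
disk counts below the diagonal, and the disks at the right cusps are counted by its diagonal. -/
lemma map_genDifferential_right {f : D.Alg →+* A} {V : Matrix (Fin n) (Fin n) A}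
    (hf : ∀ (j : Fin n) (i : Fin (j : ℕ)), f (D.gen (.inl (.right j i))) = 0)
    (hl : DiskState f V n n l) (hs : D.Sound ((rightCrossings n r).reverse ++ l)) :
    DiskState f V 0 0 ((rightCrossings n r).reverse ++ l) ∧
    ∀ (j : Fin n) (i : Fin (j : ℕ)), f (D.genDifferential (.inl (.right j i))) =
      V j ⟨i, i.2.trans j.2⟩ := by
  rw [rightCrossings_eq, List.reverse_reverse] at hs ⊢
  have key := cuspEvents_induction (n := n)
    (E := fun j i => (.crossing ((j : ℕ) + (i : ℕ)) (.right j i) :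
      FrontEvent (ClosureCrossing n r) (Fin n))) (l₀ := l)
    (I := fun m q l => DiskState f V m q l ∧ (D.Sound l → ∀ (j : Fin n) (i : Fin (j : ℕ)),
      (m < j ∨ (j : ℕ) = m ∧ i < q) → f (D.genDifferential (.inl (.right j i))) =
      V j ⟨i, i.2.trans j.2⟩))
    ⟨hl, fun _ j i h => by omega⟩
    (fun m l _ h => ⟨diskState_shift.1 h.1, fun hl j i hji => h.2 hl j i
      (by have := i.2; omega)⟩)
    (fun j i l h => ⟨h.1.step' j i (hf j i), fun hl j' i' hji => by
      by_cases hj : j' = j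
      · subst hj
        by_cases hi : i' = i
        · subst hi
          have h3 := h.1 j' ⟨i', i'.2.trans j'.2⟩
          rw [lowerHeight_self, upperHeight_same i'.2] at h3
          rw [hl.1.2, h3 (by omega)]
        · have : (i' : ℕ) ≠ i := fun h => hi (Fin.ext h)
          exact h.2 hl.2 j' i' (by omega)
      · have : (j' : ℕ) ≠ j := fun h => hj (Fin.ext h)
        exact h.2 hl.2 j' i' (by omega)⟩)
  exact ⟨key.1, fun j i => key.2 hs j i (by have := i.2; omega)⟩

end Braid

/-! ### Derivations on the disks between two bottom strands -/

section Derivation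

variable {n r : ℕ} {D : PlatFront (ClosureCrossing n r) (Fin n)} {A : Type} [CommRing A]
  {l : List (FrontEvent (ClosureCrossing n r) (Fin n))} {ε₁ ε₂ : D.Augmentation A}
  {η : D.Alg →+ A}

/-- The values of a derivation on the disks between two bottom strands are the entries of `P` above
the diagonal. -/
def DerivationState (η : D.Alg →+ A) (P : Matrix (Fin n) (Fin n) A)
    (l : List (FrontEvent (ClosureCrossing n r) (Fin n))) : Prop :=
  ∀ a b : Fin n, a < b → η (D.diskCount l a b) = P a b

/-- To the left of the braid, the only disk between the bottom strands `a < b` on which `η` does not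
vanish has one corner, at the crossing of the strand `b` with the upper strand of the cusp `a`, and
ends at this cusp. -/
lemma derivationState_leftCrossings (hη : Augmentation.IsDerivation ε₁ ε₂ η)
    (hdeg : ∀ (j : Fin n) (i : Fin (j : ℕ)), D.degree (.inl (.left j i)) = -1)
    {P : Matrix (Fin n) (Fin n) A}
    (hP : ∀ (j : Fin n) (i : Fin (j : ℕ)), η (D.gen (.inl (.left j i))) = P ⟨i, i.2.trans j.2⟩ j) :
    DerivationState η P (leftCrossings n r).reverse := by
  have key := cuspEvents_reverse_induction (n := n)
    (E := fun j i => (.crossing ((j : ℕ) + (i : ℕ)) (.left j i) :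
      FrontEvent (ClosureCrossing n r) (Fin n))) (l₀ := [])
    (I := fun m q l => DiskState ε₂.toRingHom 1 m q l ∧ ∀ a b : Fin n, a < b →
      η (D.diskCount l (lowerHeight m q a) (lowerHeight m q b)) =
        if (b : ℕ) < m ∨ (b : ℕ) = m ∧ q ≤ a then P a b else 0)
    ⟨diskState_nil _, fun a b hab => ?_⟩ (fun m l _ h => ⟨diskState_shift.2 h.1, ?_⟩)
    (fun j i l h => ⟨h.1.step j i, fun a b hab => ?_⟩)
  · rw [← leftCrossings_eq, List.append_nil] at key
    intro a b hab
    have := key.2 a b hab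
    rwa [lowerHeight_full a.2, lowerHeight_full b.2, if_pos (Or.inl b.2)] at this
  · rw [lowerHeight_zero, lowerHeight_zero, diskCount, if_neg (by omega), if_neg, map_zero]
    rintro (h | ⟨h, -⟩) <;> omega
  · intro a b hab
    have hab' : (a : ℕ) < b := hab
    simp only [lowerHeight_shift]
    rw [h.2 a b hab]
    exact if_congr (by omega) rfl rfl
  · have hi := i.2
    have hab' : (a : ℕ) < b := hab
    have h2 := h.2 a b hab
    by_cases hb : (b : ℕ) = j
    · have ha : (a : ℕ) ≠ j := by omega
      obtain ⟨g1, g2, g3⟩ := lowerHeight_of_ne hi ha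
      have hj := lowerHeight_self j (i + 1)
      rw [hb, hj, g1] at h2
      have hsign : D.bottomSign (.left j i) = 1 := by
        rw [bottomSign, hdeg, if_neg (by decide)]
      rw [hb, lowerHeight_self, diskCount_crossing_upper_bottom g2 g3, map_add, hsign, one_zsmul,
        hη.map_mul]
      have h1 := h.1 a ⟨i, i.2.trans j.2⟩
      rw [g1, upperHeight_succ_same hi] at h1
      have hlow : lowerHeight j i a = a := by simp [lowerHeight, show (a : ℕ) < j by omega]
      have hPb : P ⟨i, i.2.trans j.2⟩ j = P ⟨i, i.2.trans j.2⟩ b := by rw [Fin.ext hb]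
      rw [h1 (by omega), show ε₁.toRingHom (D.gen (.inl (.left j i))) = 0 from
        ε₁.eval_eq_zero (by rw [hdeg]; decide), zero_mul, add_zero, hP, hPb,
        add_assoc, h2]
      by_cases hai : (a : ℕ) = i
      · have : a = ⟨i, i.2.trans j.2⟩ := Fin.ext hai
        rw [← this, if_neg (by omega), if_pos (by omega)]
        simp
      · rw [Matrix.one_apply_ne (fun h => hai (congrArg Fin.val h)), mul_zero, add_zero]
        exact if_congr (by omega) rfl rfl
    · obtain ⟨k1, k2, k3⟩ := lowerHeight_of_ne hi hb
      rw [k1] at h2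
      by_cases ha : (a : ℕ) = j
      · have hj := lowerHeight_self j (i + 1)
        rw [ha, hj] at h2
        rw [ha, lowerHeight_self, diskCount_crossing_lower_bottom k3, add_assoc, h2]
        exact if_congr (by omega) rfl rfl
      · obtain ⟨g1, g2, g3⟩ := lowerHeight_of_ne hi ha
        rw [g1] at h2
        rw [diskCount_crossing_of_ne g2 g3 k2 k3, h2]
        exact if_congr (by omega) rfl rfl

/-- A crossing of degree zero, at which `ε₂` is obtained from `ε₁` by the action of `P`, transfers
`P`. -/
lemma DerivationState.crossing (hη : Augmentation.IsDerivation ε₁ ε₂ η)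
    {P : Matrix (Fin n) (Fin n) A} (hP : UpperUnipotent P) (i : Fin (n - 1))
    {c : ClosureCrossing n r} (hdeg : D.degree (.inl c) = 0) (hl : DerivationState η P l)
    (hc : ε₂.eval (.inl c) = ε₁.eval (.inl c) - P (lowerStrand i) (upperStrand i)) :
    DerivationState η (transfer i (ε₁.eval (.inl c)) P) (.crossing i c :: l) := by
  have hgen : η (D.gen (.inl c)) = 0 :=
    hη.eq_zero _ _ (by rw [hdeg]; decide) (isHomogeneous_gen _)
  have hsign : D.bottomSign c = -1 := by rw [bottomSign, hdeg, if_pos (by decide)]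
  intro a b hab
  have hab' : (a : ℕ) < b := hab
  have hlo : ((lowerStrand i : Fin n) : ℕ) = i := rfl
  have hup : ((upperStrand i : Fin n) : ℕ) = i + 1 := rfl
  rw [transfer, ← hc]
  by_cases ha1 : a = upperStrand i
  · subst ha1
    rw [hup] at hab' ⊢
    rw [mul_braidMatrixInv_apply_of_ne _ _ _ _ (by rintro rfl; omega) (by rintro rfl; omega),
      braidMatrix_mul_apply_upper, diskCount_crossing_lower_top, map_add, hη.map_mul, hgen,
      mul_zero, add_zero, ← hl (upperStrand i) b hab, ← hl (lowerStrand i) b (by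
        rw [Fin.lt_def, hlo]; omega), hup, hlo, mul_comm]
    rfl
  by_cases ha2 : a = lowerStrand i
  · subst ha2
    rw [hlo] at hab' ⊢
    by_cases hb : b = upperStrand i
    · subst hb
      rw [hup, diskCount_crossing_same, map_zero, mul_braidMatrixInv_apply_upper,
        braidMatrix_mul_apply_lower]
      exact (hP.1 (lowerStrand_lt_upperStrand i)).symm
    · have hb' : (b : ℕ) ≠ i + 1 := fun h => hb (Fin.ext h)
      rw [mul_braidMatrixInv_apply_of_ne _ _ _ _ (by rintro rfl; omega) hb,
        braidMatrix_mul_apply_lower, diskCount_crossing_lower_bottom hb',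
        ← hl (upperStrand i) b (by rw [Fin.lt_def, hup]; omega), hup]
  have ha1' : (a : ℕ) ≠ i + 1 := fun h => ha1 (Fin.ext h)
  have ha2' : (a : ℕ) ≠ i := fun h => ha2 (Fin.ext h)
  by_cases hb1 : b = lowerStrand i
  · subst hb1
    rw [hlo] at hab' ⊢
    rw [mul_braidMatrixInv_apply_lower, braidMatrix_mul_apply_of_ne _ _ _ _ ha2 ha1,
      braidMatrix_mul_apply_of_ne _ _ _ _ ha2 ha1, diskCount_crossing_upper_bottom ha2' ha1',
      hsign, neg_one_zsmul, map_add, map_neg, hη.map_mul, hgen, zero_mul, zero_add,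
      ← hl a (lowerStrand i) hab, ← hl a (upperStrand i) (by rw [Fin.lt_def, hup]; omega), hup,
      hlo, sub_eq_add_neg]
    rfl
  by_cases hb2 : b = upperStrand i
  · subst hb2
    rw [hup] at hab' ⊢
    rw [mul_braidMatrixInv_apply_upper, braidMatrix_mul_apply_of_ne _ _ _ _ ha2 ha1,
      diskCount_crossing_upper_top ha2' ha1', ← hl a (lowerStrand i) (by
        rw [Fin.lt_def, hlo]; omega), hlo]
  rw [mul_braidMatrixInv_apply_of_ne _ _ _ _ hb1 hb2, braidMatrix_mul_apply_of_ne _ _ _ _ ha2 ha1,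
    diskCount_crossing_of_ne ha2' ha1' (fun h => hb1 (Fin.ext h)) (fun h => hb2 (Fin.ext h)),
    hl a b hab]

/-- Along a braid, the equation `ε₁ - ε₂ = η ∘ ∂` says that `ε₂` arises from `ε₁` by the action of
the unipotent matrix `P` of values of `η`; this matrix is then moved through the braid. -/
lemma DerivationState.braidEvents (hη : Augmentation.IsDerivation ε₁ ε₂ η)
    {P : Matrix (Fin n) (Fin n) A} (hP : UpperUnipotent P) (β : BraidWord n)
    (c : Fin β.length → ClosureCrossing n r) (hdeg : ∀ k, D.degree (.inl (c k)) = 0)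
    (hs : D.Sound ((braidEvents β c).reverse ++ l)) (hl : DerivationState η P l) :
    ((∀ k, ε₁.eval (.inl (c k)) - ε₂.eval (.inl (c k)) = η (D.genDifferential (.inl (c k)))) ↔
      (fun k => ε₂.eval (.inl (c k))) = act β (fun k => ε₁.eval (.inl (c k))) P) ∧
    ((fun k => ε₂.eval (.inl (c k))) = act β (fun k => ε₁.eval (.inl (c k))) P →
      DerivationState η (out β (fun k => ε₁.eval (.inl (c k))) P)
        ((braidEvents β c).reverse ++ l)) := by
  induction β generalizing l P with
  | nil => exact ⟨⟨fun _ => funext fun k => k.elim0, fun _ k => k.elim0⟩, fun _ => hl⟩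
  | cons i β ih =>
    rw [braidEvents_cons_reverse] at hs ⊢
    let c₀ : ClosureCrossing n r := c ⟨0, by simp⟩
    have hd : D.genDifferential (.inl c₀) = D.diskCount l i (i + 1) :=
      (CrossingsSatisfy.of_append hs).1.2
    have hη0 : η (D.genDifferential (.inl c₀)) = P (lowerStrand i) (upperStrand i) := by
      rw [hd, ← hl _ _ (lowerStrand_lt_upperStrand i)]
      rfl
    have hhead : ε₁.eval (.inl c₀) - ε₂.eval (.inl c₀) = η (D.genDifferential (.inl c₀)) ↔
        ε₂.eval (.inl c₀) = ε₁.eval (.inl c₀) - P (lowerStrand i) (upperStrand i) := by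
      rw [hη0]
      constructor <;> intro h <;> linear_combination -h
    have hact : (fun k => ε₂.eval (.inl (c k))) = act (i :: β) (fun k => ε₁.eval (.inl (c k))) P ↔
        ε₂.eval (.inl c₀) = ε₁.eval (.inl c₀) - P (lowerStrand i) (upperStrand i) ∧
        (fun k : Fin β.length => ε₂.eval (.inl (c k.succ))) =
          act β (fun k => ε₁.eval (.inl (c k.succ))) (transfer i (ε₁.eval (.inl c₀)) P) := by
      constructor
      · intro h
        have h0 := congrFun h (⟨0, Nat.succ_pos _⟩ : Fin (β.length + 1))
        exact ⟨h0, funext fun k => congrFun h k.succ⟩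
      · rintro ⟨h1, h2⟩
        funext k
        exact Fin.cases h1 (fun k => congrFun h2 k) k
    have hall : (∀ k, ε₁.eval (.inl (c k)) - ε₂.eval (.inl (c k)) =
        η (D.genDifferential (.inl (c k)))) ↔
        ε₁.eval (.inl c₀) - ε₂.eval (.inl c₀) = η (D.genDifferential (.inl c₀)) ∧
        ∀ k : Fin β.length, ε₁.eval (.inl (c k.succ)) - ε₂.eval (.inl (c k.succ)) =
          η (D.genDifferential (.inl (c k.succ))) :=
      ⟨fun h => ⟨h _, fun k => h _⟩, fun h k => Fin.cases h.1 h.2 k⟩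
    have hih := fun h => ih (hP.transfer i (ε₁.eval (.inl c₀))) (fun k => c k.succ)
      (fun k => hdeg _) hs (hl.crossing hη hP i (hdeg _) h)
    rw [hact, hall, hhead]
    exact ⟨and_congr_right fun h => (hih h).1, fun h => (hih h.1).2 h.2⟩

lemma map_diskCount_marks (hη : Augmentation.IsDerivation ε₁ ε₂ η) {ps : List (Fin n)}
    (hps : ps.Nodup) {a b : Fin n} (hab : a ≠ b) :
    η (D.diskCount (ps.map (fun p : Fin n => .marked (p : ℕ) p) ++ l) a b) =
      (if a ∈ ps then (ε₁.mark a : A) else 1) * (if b ∈ ps then ((ε₁.mark b)⁻¹ : Aˣ) else 1) *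
        η (D.diskCount l a b) := by
  have hcoeff : ∀ r, η (D.coeffElem r) = 0 := fun r =>
    hη.eq_zero 0 _ (by decide) (isHomogeneous_coeffElem r)
  induction ps with
  | nil => simp
  | cons p ps ih =>
    have ih := ih hps.of_cons
    rw [List.map_cons, List.cons_append, diskCount]
    by_cases h : p = a
    · subst h
      rw [if_pos rfl, hη.map_mul, ih, hcoeff, if_neg (List.nodup_cons.1 hps).1, one_mul, zero_mul,
        zero_add, if_pos List.mem_cons_self, mul_assoc]
      simp only [List.mem_cons, hab.symm, false_or]
      rfl
    · rw [if_neg (fun h' => h (Fin.ext h'))]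
      by_cases h' : p = b
      · subst h'
        rw [if_pos rfl, hη.map_mul, ih, hcoeff, if_neg (List.nodup_cons.1 hps).1,
          Units.val_one, mul_one, zero_mul, zero_add]
        simp only [List.mem_cons, hab, false_or, true_or, if_true]
        have hinv : ε₁.toRingHom (D.coeffElem (laurentMonomial p (-1))) =
            (((ε₁.mark p)⁻¹ : Aˣ) : A) := rfl
        rw [hinv]
        ring
      · rw [if_neg (fun h'' => h' (Fin.ext h'')), ih]
        simp [Ne.symm h, Ne.symm h']

lemma DerivationState.markEvents (hη : Augmentation.IsDerivation ε₁ ε₂ η)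
    {P : Matrix (Fin n) (Fin n) A} (hl : DerivationState η P l) :
    DerivationState η (crossMarks ε₁.mark P) (markEvents n r ++ l) := by
  intro a b hab
  rw [LegendrianBraid.markEvents, map_diskCount_marks hη
    (List.nodup_reverse.2 (List.nodup_finRange n)) hab.ne, if_pos (by simp), if_pos (by simp),
    hl a b hab, crossMarks, Matrix.mul_diagonal, Matrix.diagonal_mul]
  ring

end Derivation

/-! ### The front of the closure -/

section Closure

variable {n : ℕ}

/-- The crossing of the `k`-th letter of `β` in the closure of `β β'`. -/
def firstCrossing (β β' : BraidWord n) (k : Fin β.length) :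
    ClosureCrossing n (β ++ β').length := .braid ⟨k, by grind⟩

/-- The crossing of the `k`-th letter of `β'` in the closure of `β β'`. -/
def secondCrossing (β β' : BraidWord n) (k : Fin β'.length) :
    ClosureCrossing n (β ++ β').length := .braid ⟨β.length + k, by grind⟩

lemma braidCrossings_append (β β' : BraidWord n) :
    braidCrossings (β ++ β') =
      braidEvents β (firstCrossing β β') ++ braidEvents β' (secondCrossing β β') := by
  refine List.ext_getElem (by simp [braidCrossings, braidEvents]) fun k h1 h2 => ?_
  by_cases hk : k < β.length
  · rw [List.getElem_append_left (by simpa [braidEvents] using hk)]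
    simp [braidCrossings, braidEvents, firstCrossing, hk, List.getElem_append_left]
  · rw [List.getElem_append_right (by simpa [braidEvents] using hk)]
    simp only [braidCrossings, braidEvents, secondCrossing, List.getElem_ofFn, List.get_eq_getElem,
      List.length_ofFn]
    rw [List.getElem_append_right (by omega)]
    congr 3
    omega

lemma events_minusOneClosure (β β' : BraidWord n) :
    (minusOneClosure β β').events = leftCrossings n _ ++ braidEvents β (firstCrossing β β') ++
      strandMarks n _ ++ braidEvents β' (secondCrossing β β') ++ rightCrossings n _ := by
  have hlen : (braidEvents β (firstCrossing β β')).length = β.length := by simp [braidEvents]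
  rw [minusOneClosure, braidCrossings_append, List.take_left' hlen, List.drop_left' hlen]

lemma nodup_cuspEvents {X : Type} {E : ∀ j : Fin n, Fin (j : ℕ) → X}
    (hE : ∀ j i j' i', E j i = E j' i' → (⟨j, i⟩ : Σ j : Fin n, Fin (j : ℕ)) = ⟨j', i'⟩) :
    (cuspEvents E).Nodup := by
  rw [cuspEvents, List.nodup_flatMap]
  refine ⟨fun j _ => ?_, ?_⟩
  · refine (List.nodup_reverse.2 (List.nodup_finRange _)).map fun i i' h => ?_
    have := hE _ _ _ _ h
    simpa using this
  · refine (List.nodup_finRange n).imp fun {j j'} hjj' => ?_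
    intro x hx hx'
    obtain ⟨i, _, rfl⟩ := List.mem_map.1 hx
    obtain ⟨i', _, h⟩ := List.mem_map.1 hx'
    exact hjj' (congrArg Sigma.fst (hE _ _ _ _ h)).symm

lemma filterMap_crossingName_cuspEvents {C T : Type} (E : ∀ j : Fin n, Fin (j : ℕ) → C) :
    (cuspEvents fun j i => (.crossing ((j : ℕ) + (i : ℕ)) (E j i) : FrontEvent C T)).filterMap
      crossingName = cuspEvents E := by
  rw [cuspEvents, cuspEvents, List.filterMap_flatMap]
  congr 1
  funext j
  rw [List.filterMap_map]
  exact congrFun List.filterMap_eq_map' _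

lemma filterMap_leftCrossings (r : ℕ) : (leftCrossings n r).filterMap crossingName =
    cuspEvents fun j i => (.left j i : ClosureCrossing n r) := by
  rw [leftCrossings_eq]
  exact filterMap_crossingName_cuspEvents _

lemma filterMap_rightCrossings (r : ℕ) : (rightCrossings n r).filterMap crossingName =
    (cuspEvents fun j i => (.right j i : ClosureCrossing n r)).reverse := by
  rw [rightCrossings_eq, List.filterMap_reverse]
  exact congrArg List.reverse (filterMap_crossingName_cuspEvents _)

lemma mem_filterMap_leftCrossings {r : ℕ} {c : ClosureCrossing n r}
    (hc : c ∈ (leftCrossings n r).filterMap crossingName) : ∃ j i, c = .left j i := by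
  rw [filterMap_leftCrossings, cuspEvents, List.mem_flatMap] at hc
  obtain ⟨j, _, h⟩ := hc
  obtain ⟨i, _, h⟩ := List.mem_map.1 h
  exact ⟨j, i, h.symm⟩

lemma mem_filterMap_rightCrossings {r : ℕ} {c : ClosureCrossing n r}
    (hc : c ∈ (rightCrossings n r).filterMap crossingName) : ∃ j i, c = .right j i := by
  rw [filterMap_rightCrossings, List.mem_reverse, cuspEvents, List.mem_flatMap] at hc
  obtain ⟨j, _, h⟩ := hc
  obtain ⟨i, _, h⟩ := List.mem_map.1 h
  exact ⟨j, i, h.symm⟩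

lemma filterMap_braidEvents {r : ℕ} (β : BraidWord n) (c : Fin β.length → ClosureCrossing n r) :
    (braidEvents β c).filterMap crossingName = List.ofFn c := by
  rw [braidEvents, List.ofFn_eq_map, List.ofFn_eq_map, List.filterMap_map]
  exact congrFun List.filterMap_eq_map' _

lemma filterMap_strandMarks (n r : ℕ) : (strandMarks n r).filterMap crossingName = [] := by
  rw [List.filterMap_eq_nil_iff, strandMarks]
  intro e he
  obtain ⟨p, rfl⟩ := List.mem_ofFn.1 he
  rfl

lemma nodup_crossingName (β β' : BraidWord n) :
    ((minusOneClosure β β').events.filterMap crossingName).Nodup := by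
  rw [events_minusOneClosure]
  simp only [List.filterMap_append, filterMap_strandMarks, List.append_nil, filterMap_braidEvents]
  have h1 : ((leftCrossings n (β ++ β').length).filterMap crossingName).Nodup := by
    rw [filterMap_leftCrossings]
    refine nodup_cuspEvents fun j i j' i' h => ?_
    cases h
    rfl
  have h2 : ((rightCrossings n (β ++ β').length).filterMap crossingName).Nodup := by
    rw [filterMap_rightCrossings, List.nodup_reverse]
    refine nodup_cuspEvents fun j i j' i' h => ?_
    cases h
    rfl
  have h3 : (List.ofFn (firstCrossing β β')).Nodup := by
    rw [List.nodup_ofFn]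
    intro k k' h
    simpa [firstCrossing, Fin.ext_iff] using h
  have h4 : (List.ofFn (secondCrossing β β')).Nodup := by
    rw [List.nodup_ofFn]
    intro k k' h
    simpa [secondCrossing, Fin.ext_iff] using h
  rw [List.nodup_append, List.nodup_append, List.nodup_append]
  refine ⟨⟨⟨h1, h3, ?_⟩, h4, ?_⟩, h2, ?_⟩
  · intro c hc c' hc'
    obtain ⟨j, i, rfl⟩ := mem_filterMap_leftCrossings hc
    obtain ⟨k, rfl⟩ := List.mem_ofFn.1 hc'
    simp [firstCrossing]
  · intro c hc c' hc'
    obtain ⟨k', rfl⟩ := List.mem_ofFn.1 hc'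
    rcases List.mem_append.1 hc with hc | hc
    · obtain ⟨j, i, rfl⟩ := mem_filterMap_leftCrossings hc
      simp [secondCrossing]
    · obtain ⟨k, rfl⟩ := List.mem_ofFn.1 hc
      have := k.2
      simp [firstCrossing, secondCrossing]
      omega
  · intro c hc c' hc'
    obtain ⟨j', i', rfl⟩ := mem_filterMap_rightCrossings hc'
    rcases List.mem_append.1 hc with hc | hc
    · rcases List.mem_append.1 hc with hc | hc
      · obtain ⟨j, i, rfl⟩ := mem_filterMap_leftCrossings hc
        simp
      · obtain ⟨k, rfl⟩ := List.mem_ofFn.1 hc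
        simp [firstCrossing]
    · obtain ⟨k, rfl⟩ := List.mem_ofFn.1 hc
      simp [secondCrossing]

/-- The events to the left of the marked points, from right to left. -/
def eventsBeforeMarks (β β' : BraidWord n) :
    List (FrontEvent (ClosureCrossing n (β ++ β').length) (Fin n)) :=
  (braidEvents β (firstCrossing β β')).reverse ++ (leftCrossings n _).reverse

/-- The events up to the end of the braid, from right to left. -/
def eventsBeforeRight (β β' : BraidWord n) :
    List (FrontEvent (ClosureCrossing n (β ++ β').length) (Fin n)) :=
  (braidEvents β' (secondCrossing β β')).reverse ++ (markEvents n _ ++ eventsBeforeMarks β β')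

lemma events_reverse (β β' : BraidWord n) : (minusOneClosure β β').events.reverse =
    (rightCrossings n _).reverse ++ eventsBeforeRight β β' := by
  rw [events_minusOneClosure, eventsBeforeRight, eventsBeforeMarks, ← strandMarks_reverse]
  simp only [List.reverse_append, List.append_assoc]

variable (β β' : BraidWord n)

lemma sound_closure :
    (minusOneClosure β β').Sound ((rightCrossings n _).reverse ++ eventsBeforeRight β β') := by
  rw [← events_reverse]
  exact sound_reverse_events (nodup_crossingName β β')

lemma sound_eventsBeforeRight : (minusOneClosure β β').Sound (eventsBeforeRight β β') :=
  CrossingsSatisfy.of_append (sound_closure β β')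

lemma sound_eventsBeforeMarks : (minusOneClosure β β').Sound (eventsBeforeMarks β β') :=
  CrossingsSatisfy.of_append (CrossingsSatisfy.of_append (sound_eventsBeforeRight β β'))

lemma potentialState_eventsBeforeMarks : PotentialState n n (eventsBeforeMarks β β') :=
  potentialState_leftCrossings.braidEvents _ _

lemma potentialState_eventsBeforeRight : PotentialState n n (eventsBeforeRight β β') :=
  (potentialState_eventsBeforeMarks β β').markEvents.braidEvents _ _

lemma degree_closure_left (j : Fin n) (i : Fin (j : ℕ)) :
    (minusOneClosure β β').degree (.inl (.left j i)) = -1 :=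
  degree_left (CrossingsSatisfy.of_append (sound_eventsBeforeMarks β β')) j i

lemma degree_closure_right (j : Fin n) (i : Fin (j : ℕ)) :
    (minusOneClosure β β').degree (.inl (.right j i)) = 1 :=
  degree_right (potentialState_eventsBeforeRight β β') (sound_closure β β') j i

lemma degree_firstCrossing (k : Fin β.length) :
    (minusOneClosure β β').degree (.inl (firstCrossing β β' k)) = 0 :=
  degree_braidEvents potentialState_leftCrossings β _ (sound_eventsBeforeMarks β β') k

lemma degree_secondCrossing (k : Fin β'.length) :
    (minusOneClosure β β').degree (.inl (secondCrossing β β' k)) = 0 :=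
  degree_braidEvents (potentialState_eventsBeforeMarks β β').markEvents β' _
    (sound_eventsBeforeRight β β') k

/-- A generator is a crossing to the left, a letter of `β`, a letter of `β'`, a crossing to the
right, or a cusp. -/
lemma gen_cases {motive : (minusOneClosure β β').Gen → Prop}
    (left : ∀ j i, motive (.inl (.left j i)))
    (first : ∀ k, motive (.inl (firstCrossing β β' k)))
    (second : ∀ k, motive (.inl (secondCrossing β β' k)))
    (right : ∀ j i, motive (.inl (.right j i)))
    (cusp : ∀ m, motive (.inr m)) (g : (minusOneClosure β β').Gen) : motive g := by
  rcases g with (⟨j, i⟩ | k | ⟨j, i⟩) | m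
  · exact left j i
  · by_cases hk : (k : ℕ) < β.length
    · exact first ⟨k, hk⟩
    · have hk2 := lt_of_lt_of_eq k.2 List.length_append
      have := second ⟨k - β.length, by omega⟩
      rw [secondCrossing] at this
      convert! this using 4
      simp only
      omega
  · exact right j i
  · exact cusp m

/-- The differential lowers the degree by one. -/
lemma isHomogeneous_genDifferential (g : (minusOneClosure β β').Gen) :
    (minusOneClosure β β').IsHomogeneous ((minusOneClosure β β').degree g - 1)
      ((minusOneClosure β β').genDifferential g) := by
  have hs := sound_closure β β'
  rw [← events_reverse] at hs
  rcases g with c | m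
  · exact isHomogeneous_crossingDifferential (by rwa [List.append_nil]) c
  · rw [genDifferential]
    have hp := right_potential (potentialState_eventsBeforeRight β β') m
    rw [← events_reverse, lowerHeight_zero, upperHeight_zero] at hp
    have h1 := isHomogeneous_diskCount hs (show 2 * (m : ℕ) < 2 * m + 1 by omega)
    rw [hp.1, hp.2] at h1
    exact (isHomogeneous_coeffElem 1).add h1

end Closure

/-! ### The points of the augmentation variety -/

section Points

variable {n : ℕ} (β : BraidWord n) {A : Type} [CommRing A]

/-- A ring homomorphism which vanishes on the generators of nonzero degree is an augmentation if and
only if its values solve the augmentation equations: the values on the differentials are the entries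
of `closureMatrix`. -/
lemma map_genDifferential_closure
    {f : (minusOneClosure β (halfTwist n)).Alg →+* A} {t : Fin n → Aˣ}
    (ht : ∀ p, f ((minusOneClosure β (halfTwist n)).coeffElem (laurentMonomial p 1)) = t p)
    (hf : ∀ g, (minusOneClosure β (halfTwist n)).degree g ≠ 0 →
      f ((minusOneClosure β (halfTwist n)).gen g) = 0) :
    (∀ g, f ((minusOneClosure β (halfTwist n)).genDifferential g) = 0) ↔
      IsAugPoint β
        (fun k => f ((minusOneClosure β (halfTwist n)).gen (.inl (firstCrossing β _ k)))) t
        (fun k => f ((minusOneClosure β (halfTwist n)).gen (.inl (secondCrossing β _ k)))) := by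
  set z := fun k => f ((minusOneClosure β (halfTwist n)).gen
    (.inl (firstCrossing β (halfTwist n) k)))
  set w := fun k => f ((minusOneClosure β (halfTwist n)).gen
    (.inl (secondCrossing β (halfTwist n) k)))
  have h1 : DiskState f (closureMatrix β z t w) n n (eventsBeforeRight β (halfTwist n)) := by
    have := (DiskState.markEvents ht ((diskState_leftCrossings f).braidEvents β
      (firstCrossing β (halfTwist n)))).braidEvents (halfTwist n)
        (secondCrossing β (halfTwist n))
    rwa [Matrix.mul_one, ← Matrix.mul_assoc] at this
  obtain ⟨h2, h3⟩ := map_genDifferential_right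
    (fun j i => hf _ (by rw [degree_closure_right]; decide)) h1 (sound_closure β (halfTwist n))
  have h4 : ∀ m : Fin n, f ((minusOneClosure β (halfTwist n)).genDifferential (.inr m)) = 1 +
      closureMatrix β z t w m m := by
    intro m
    have := h2 m m
    rw [lowerHeight_zero, upperHeight_zero, ← events_reverse] at this
    rw [← this (by omega), ← map_one f, ← map_add]
    rfl
  constructor
  · intro h
    refine ⟨fun a b hab => ?_, fun a => ?_⟩
    · have := h3 a ⟨b, hab⟩
      rw [h] at this
      exact this.symm
    · have := h4 a
      rw [h] at this
      linear_combination -this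
  · intro h
    have hdeg : ∀ g, (minusOneClosure β (halfTwist n)).degree g ≠ 1 →
        f ((minusOneClosure β (halfTwist n)).genDifferential g) = 0 := fun g hg =>
      map_eq_zero_of_isHomogeneous f hf (sub_ne_zero.2 hg) (isHomogeneous_genDifferential _ _ g)
    refine gen_cases _ _ (fun j i => hdeg _ ?_) (fun k => hdeg _ ?_) (fun k => hdeg _ ?_)
      (fun j i => ?_) fun m => ?_
    · rw [degree_closure_left]; decide
    · rw [degree_firstCrossing]; decide
    · rw [degree_secondCrossing]; decide
    · rw [h3]
      exact h.1 (show _ < _ from i.2)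
    · exact (h4 m).trans ((congrArg (1 + ·) (h.2 m)).trans (add_neg_cancel 1))

variable {β}

/-- The values of an augmentation on the letters of `β`. -/
def firstCoords (ε : (minusOneClosure β (halfTwist n)).Augmentation A) (k : Fin β.length) : A :=
  ε.eval (.inl (firstCrossing β _ k))

/-- The values of an augmentation on the letters of the half twist. -/
def secondCoords (ε : (minusOneClosure β (halfTwist n)).Augmentation A)
    (k : Fin (halfTwist n).length) : A :=
  ε.eval (.inl (secondCrossing β _ k))

lemma isAugPoint_of_augmentation (ε : (minusOneClosure β (halfTwist n)).Augmentation A) :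
    IsAugPoint β (firstCoords ε) ε.mark (secondCoords ε) :=
  (map_genDifferential_closure β (fun _ => rfl) fun _ hg => ε.eval_eq_zero hg).1
    ε.map_genDifferential

/-- Augmentations are determined by their coordinates. -/
lemma augmentation_ext {ε ε' : (minusOneClosure β (halfTwist n)).Augmentation A}
    (h1 : firstCoords ε = firstCoords ε') (h2 : ε.mark = ε'.mark)
    (h3 : secondCoords ε = secondCoords ε') : ε = ε' := by
  refine Augmentation.ext_of_eval (gen_cases _ _ (fun j i => ?_) (congrFun h1) (congrFun h3)
    (fun j i => ?_) fun m => ?_) (congrFun h2)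
  · have : (minusOneClosure β (halfTwist n)).degree (.inl (.left j i)) ≠ 0 := by
      rw [degree_closure_left]; decide
    rw [ε.eval_eq_zero this, ε'.eval_eq_zero this]
  · have : (minusOneClosure β (halfTwist n)).degree (.inl (.right j i)) ≠ 0 := by
      rw [degree_closure_right]; decide
    rw [ε.eval_eq_zero this, ε'.eval_eq_zero this]
  · have : (minusOneClosure β (halfTwist n)).degree (.inr m) ≠ 0 := one_ne_zero
    rw [ε.eval_eq_zero this, ε'.eval_eq_zero this]

/-- Every solution of the augmentation equations is an augmentation. -/
lemma exists_augmentation {z : Fin β.length → A} {t : Fin n → Aˣ}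
    {w : Fin (halfTwist n).length → A} (h : IsAugPoint β z t w) :
    ∃ ε : (minusOneClosure β (halfTwist n)).Augmentation A,
      firstCoords ε = z ∧ ε.mark = t ∧ secondCoords ε = w := by
  let v : (minusOneClosure β (halfTwist n)).Gen → A
    | .inl (.braid k) => if hk : (k : ℕ) < β.length then z ⟨k, hk⟩ else
        w ⟨k - β.length, by
          have := lt_of_lt_of_eq k.2 List.length_append
          omega⟩
    | _ => 0
  have hv1 : ∀ k, v (.inl (firstCrossing β _ k)) = z k := fun k => dif_pos k.2
  have hv2 : ∀ k, v (.inl (secondCrossing β _ k)) = w k := fun k => by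
    have : v (.inl (secondCrossing β _ k)) = w ⟨β.length + k - β.length, by
      have := k.2; omega⟩ := dif_neg (by simp)
    rw [this]
    congr 1
    ext
    simp
  have hv : ∀ g, (minusOneClosure β (halfTwist n)).degree g ≠ 0 → v g = 0 :=
    gen_cases _ _ (fun _ _ _ => rfl) (fun k hk => absurd (degree_firstCrossing _ _ k) hk)
      (fun k hk => absurd (degree_secondCrossing _ _ k) hk) (fun _ _ _ => rfl) fun _ _ => rfl
  have hz : (fun k => evalHom _ v t ((minusOneClosure β (halfTwist n)).gen
      (.inl (firstCrossing β _ k)))) = z := funext fun k => (evalHom_gen _ _ _).trans (hv1 k)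
  have hw : (fun k => evalHom _ v t ((minusOneClosure β (halfTwist n)).gen
      (.inl (secondCrossing β _ k)))) = w := funext fun k => (evalHom_gen _ _ _).trans (hv2 k)
  have hd := (map_genDifferential_closure β (evalHom_mark v t)
    (fun g hg => (evalHom_gen v t g).trans (hv g hg))).2 (by rw [hz, hw]; exact h)
  exact ⟨Augmentation.mk' v t hv hd, hz, funext fun p => Units.ext (evalHom_mark v t p), hw⟩

/-- Homotopic augmentations are in one orbit of the unipotent matrices. -/
lemma exists_act_of_homotopic {ε₁ ε₂ : (minusOneClosure β (halfTwist n)).Augmentation A}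
    (h : ε₁.Homotopic ε₂) :
    ∃ P : Matrix (Fin n) (Fin n) A, UpperUnipotent P ∧
      firstCoords ε₂ = act β (firstCoords ε₁) P := by
  obtain ⟨-, η, hη, h⟩ := Augmentation.homotopic_iff.1 h
  -- The entries of `P` are the values of the homotopy on the generators of degree `-1`.
  let P : Matrix (Fin n) (Fin n) A := Matrix.of fun a b =>
    if hab : a < b then η ((minusOneClosure β (halfTwist n)).gen (.inl (.left b ⟨a, hab⟩)))
    else if a = b then 1 else 0
  have hP : UpperUnipotent P := by
    refine ⟨fun a b hab => ?_, fun a => ?_⟩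
    · have hab : b < a := hab
      simp [P, hab.not_gt, hab.ne']
    · simp [P]
  have hl := derivationState_leftCrossings (P := P) hη (degree_closure_left β (halfTwist n))
    fun j i => by
      have hij : (⟨i, i.2.trans j.2⟩ : Fin n) < j := i.2
      simp [P, hij]
  exact ⟨P, hP, ((hl.braidEvents hη hP β (firstCrossing β _) (degree_firstCrossing _ _)
    (sound_eventsBeforeMarks β (halfTwist n))).1).1 fun k => h _⟩

/-- Augmentations in one orbit of the unipotent matrices are homotopic. -/
lemma homotopic_of_act {ε₁ ε₂ : (minusOneClosure β (halfTwist n)).Augmentation A}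
    {P : Matrix (Fin n) (Fin n) A} (hP : UpperUnipotent P)
    (h1 : firstCoords ε₂ = act β (firstCoords ε₁) P) (h2 : ε₂.mark = ε₁.mark)
    (h3 : secondCoords ε₂ = act (halfTwist n) (secondCoords ε₁)
      (crossMarks ε₁.mark (out β (firstCoords ε₁) P))) : ε₁.Homotopic ε₂ := by
  have ht : ∀ i, ε₁.mark i = ε₂.mark i := fun i => (congrFun h2 i).symm
  -- The homotopy is the derivation whose values on the generators of degree `-1` are the entries of
  -- `P`.
  let a : (minusOneClosure β (halfTwist n)).Gen → A
    | .inl (.left j i) => P ⟨i, i.2.trans j.2⟩ j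
    | _ => 0
  have ha : ∀ g, (minusOneClosure β (halfTwist n)).degree g ≠ -1 → a g = 0 :=
    gen_cases _ _ (fun j i h => absurd (degree_closure_left _ _ j i) h) (fun _ _ => rfl)
      (fun _ _ => rfl) (fun _ _ _ => rfl) fun _ _ => rfl
  have hη := Augmentation.isDerivation_derivation (a := a) ht ha
  set η := Augmentation.derivation ε₁ ε₂ a
  refine Augmentation.homotopic_iff.2 ⟨ht, η, hη, ?_⟩
  have hl : DerivationState η P (leftCrossings n _).reverse :=
    derivationState_leftCrossings hη (degree_closure_left β (halfTwist n)) fun j i =>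
      Augmentation.derivation_gen _
  have hb := hl.braidEvents hη hP β (firstCrossing β _) (degree_firstCrossing _ _)
    (sound_eventsBeforeMarks β (halfTwist n))
  have hm := (hb.2 h1).markEvents hη
  have hQ : UpperUnipotent (crossMarks ε₁.mark (out β (firstCoords ε₁) P)) :=
    (hP.out β _).conj_diagonal _
  have hb' := hm.braidEvents hη hQ (halfTwist n) (secondCrossing β _) (degree_secondCrossing _ _)
    (sound_eventsBeforeRight β (halfTwist n))
  have hdeg : ∀ g, (minusOneClosure β (halfTwist n)).degree g ≠ 0 →
      ε₁.eval g - ε₂.eval g = η ((minusOneClosure β (halfTwist n)).genDifferential g) := by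
    intro g hg
    rw [ε₁.eval_eq_zero hg, ε₂.eval_eq_zero hg, sub_zero,
      hη.eq_zero _ _ (by rwa [sub_add_cancel]) (isHomogeneous_genDifferential _ _ g)]
  refine gen_cases _ _ (fun j i => hdeg _ ?_) (hb.1.2 h1) (hb'.1.2 h3) (fun j i => hdeg _ ?_)
    fun m => hdeg _ one_ne_zero
  · rw [degree_closure_left]; decide
  · rw [degree_closure_right]; decide

/-- The point of the braid variety of an augmentation. -/
def augmentationPoint (hβ : demazure β = longestElement n)
    (ε : (minusOneClosure β (halfTwist n)).Augmentation A) : BraidVariety A β :=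
  ⟨slicePoint β (firstCoords ε) ε.mark (secondCoords ε), by
    rw [hβ, longestElement_eq]
    exact (isAugPoint_of_augmentation ε).isBraidPoint_slicePoint⟩

lemma augmentationPoint_eq_of_homotopic (hβ : demazure β = longestElement n)
    {ε₁ ε₂ : (minusOneClosure β (halfTwist n)).Augmentation A} (h : ε₁.Homotopic ε₂) :
    augmentationPoint hβ ε₁ = augmentationPoint hβ ε₂ := by
  obtain ⟨P, hP, h⟩ := exists_act_of_homotopic h
  have h2 := isAugPoint_of_augmentation ε₂
  refine Subtype.ext ?_
  simp only [augmentationPoint]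
  rw [h] at h2 ⊢
  exact ((isAugPoint_of_augmentation ε₁).slicePoint_act hP h2).symm

/-- Every augmentation is homotopic to one whose coordinates on `β` are its point in the braid
variety. -/
lemma exists_homotopic_slice (ε : (minusOneClosure β (halfTwist n)).Augmentation A) :
    ∃ ε', ε.Homotopic ε' ∧
      firstCoords ε' = slicePoint β (firstCoords ε) ε.mark (secondCoords ε) := by
  have h := isAugPoint_of_augmentation ε
  obtain ⟨ε', h1, h2, h3⟩ := exists_augmentation (h.act h.upperUnipotent)
  exact ⟨ε', homotopic_of_act h.upperUnipotent h1 h2 h3, h1⟩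

/-- The map from the augmentation variety to the braid variety. -/
def augVarietyMap (hβ : demazure β = longestElement n) (A : Type) [CommRing A] :
    (minusOneClosure β (halfTwist n)).AugVariety A → BraidVariety A β :=
  Quot.lift (augmentationPoint hβ) fun _ _ h => augmentationPoint_eq_of_homotopic hβ h

lemma augVarietyMap_bijective (hβ : demazure β = longestElement n) (A : Type) [CommRing A] :
    Function.Bijective (augVarietyMap hβ A) := by
  constructor
  · rintro ⟨ε₁⟩ ⟨ε₂⟩ h
    have hx : slicePoint β (firstCoords ε₁) ε₁.mark (secondCoords ε₁) =
        slicePoint β (firstCoords ε₂) ε₂.mark (secondCoords ε₂) := congrArg Subtype.val h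
    obtain ⟨ε₁', h1, e1⟩ := exists_homotopic_slice ε₁
    obtain ⟨ε₂', h2, e2⟩ := exists_homotopic_slice ε₂
    have e : firstCoords ε₁' = firstCoords ε₂' := e1.trans (hx.trans e2.symm)
    have hX : IsBraidPoint β (firstCoords ε₁') := by
      rw [e1]
      exact (isAugPoint_of_augmentation ε₁).isBraidPoint_slicePoint
    have hu := hX.isAugPoint_unique (isAugPoint_of_augmentation ε₁')
      (by rw [e]; exact isAugPoint_of_augmentation ε₂')
    have he : ε₁' = ε₂' := augmentation_ext e hu.1 hu.2
    exact (Quot.sound h1).trans ((congrArg (Quot.mk _) he).trans (Quot.sound h2).symm)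
  · rintro ⟨x, hx⟩
    rw [hβ, longestElement_eq] at hx
    obtain ⟨t, w, h, hs⟩ := IsBraidPoint.exists_isAugPoint hx
    obtain ⟨ε, h1, h2, h3⟩ := exists_augmentation h
    refine ⟨Quot.mk _ ε, Subtype.ext ?_⟩
    change slicePoint β (firstCoords ε) ε.mark (secondCoords ε) = x
    rw [h1, h2, h3, hs]

lemma map_slicePoint {B : Type} [CommRing B] (f : A →+* B) (z : Fin β.length → A)
    (t : Fin n → Aˣ) (w : Fin (halfTwist n).length → A) (k : Fin β.length) :
    f (slicePoint β z t w k) = slicePoint β (fun k => f (z k))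
      (fun a => Units.map (f : A →* B) (t a)) (fun k => f (w k)) k := by
  rw [slicePoint, slicePoint, map_act]
  congr 1
  have hD : (diagonal fun a => (t a : A)).map f =
      diagonal fun a => ((Units.map (f : A →* B) (t a) : Bˣ) : B) := by
    rw [Matrix.diagonal_map (map_zero f)]
    rfl
  rw [closureMatrix, closureMatrix, ← map_braidWordMatrix, ← map_braidWordMatrix, ← hD,
    ← Matrix.map_mul, ← Matrix.map_mul]
  ext a b
  exact map_neg f _

lemma augmentationPoint_map (hβ : demazure β = longestElement n) {B : Type} [CommRing B]
    (f : A →+* B) (ε : (minusOneClosure β (halfTwist n)).Augmentation A) (k : Fin β.length) :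
    (augmentationPoint hβ (ε.map f)).1 k = f ((augmentationPoint hβ ε).1 k) := by
  have hm : (ε.map f).mark = fun a => Units.map (f : A →* B) (ε.mark a) :=
    funext fun a => Units.ext rfl
  have h := map_slicePoint f (firstCoords ε) ε.mark (secondCoords ε) k
  rw [← hm] at h
  exact h.symm

/-- The map to the braid variety does not move the letters after an initial half twist, which
absorbs all unipotent matrices. -/
lemma slicePoint_apply_of_halfTwist {γ : BraidWord n} (hγ : β = halfTwist n ++ γ)
    {z : Fin β.length → A} {t : Fin n → Aˣ} {w : Fin (halfTwist n).length → A}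
    (h : IsAugPoint β z t w) (k : Fin β.length) (hk : (halfTwist n).length ≤ k) :
    slicePoint β z t w k = z k := by
  subst hγ
  exact act_append_of_out_eq_one _ _ _ _ (out_halfTwist _ h.upperUnipotent) k hk

end Points

end LegendrianBraid

end

theorem mainTheorem2 (n : ℕ) (β : LegendrianBraid.BraidWord n)
    (hβ : LegendrianBraid.demazure β = LegendrianBraid.longestElement n) :
    ∃ Φ : ∀ (A : Type) [CommRing A] [Algebra ℂ A],
        (LegendrianBraid.minusOneClosure β (LegendrianBraid.halfTwist n)).AugVariety A ≃
          LegendrianBraid.BraidVariety A β,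
      (∀ (A B : Type) [CommRing A] [Algebra ℂ A] [CommRing B] [Algebra ℂ B] (f : A →ₐ[ℂ] B)
        (a : (LegendrianBraid.minusOneClosure β (LegendrianBraid.halfTwist n)).AugVariety A)
        (k : Fin β.length),
        (Φ B (LegendrianBraid.PlatFront.AugVariety.map (f : A →+* B) a)).1 k = f ((Φ A a).1 k)) ∧
      (∀ γ : LegendrianBraid.BraidWord n, β = LegendrianBraid.halfTwist n ++ γ →
        ∀ (A : Type) [CommRing A] [Algebra ℂ A]
          (ε : (LegendrianBraid.minusOneClosure β (LegendrianBraid.halfTwist n)).Augmentation A)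
          (k : Fin β.length), (LegendrianBraid.halfTwist n).length ≤ (k : ℕ) →
          (Φ A (LegendrianBraid.PlatFront.AugVariety.mk ε)).1 k =
            ε.eval (LegendrianBraid.braidGen β (LegendrianBraid.halfTwist n) k)) := by
  refine ⟨fun A _ _ => Equiv.ofBijective _ (LegendrianBraid.augVarietyMap_bijective hβ A), ?_, ?_⟩
  · rintro A B _ _ _ _ f ⟨ε⟩ k
    exact (LegendrianBraid.augmentationPoint_map hβ (f : A →+* B) ε k)
  · intro γ hγ A _ _ ε k hk
    exact LegendrianBraid.slicePoint_apply_of_halfTwist hγ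
      (LegendrianBraid.isAugPoint_of_augmentation ε) k hk
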